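/- **Theorem 1.1.** Consider the one-dimensional pressureless Euler–Alignment system $$\partial_t\rho+\partial_x(\rho u)=0,\qquad \partial_t u+u\,\partial_x u=\int_{\mathbb R}\psi(x-y)\,(u(y,t)-u(x,t))\,\rho(y,t)\,dy,\qquad (\rho,u)|_{t=0}=(\rho_0,u_0),$$ where the influence function $\psi\in W^{1,\infty}(\mathbb R)$ (i.e. bounded and Lipschitz) satisfies $\psi\ge 0$ and $\psi(-x)=\psi(x)$. Let $\rho_0\in C^1(\mathbb R)\cap L^\infty(\mathbb R)$ with $\rho_0\ge 0$ and $\int\rho_0\,dx=1$, and let $u_0\in C^2(\mathbb R)$ with $\partial_xu_0\in L^\infty(\mathbb R)$ and $\rho_0u_0\in L^1(\mathbb R)$. A *classical solution* on $I=[0,T)$ or $I=[0,\infty)$ is a pair $\rho,u\in C^1(I\times\mathbb R)$ satisfying both equations pointwise (with one-sided time derivatives at $t=0$) and the initial conditions, such that $\rho(\cdot,t)$ is a probability density for each $t\in I$, and $\|\rho(\cdot,t)\|_{L^\infty}$, $\|\partial_xu(\cdot,t)\|_{L^\infty}$ and $\int|u(x,t)|\rho(x,t)\,dx$ are bounded on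 every compact subinterval of $I$. * **Subcritical region.** If $\partial_xu_0(x)\ge-(\psi\star\rho_0)(x)$ for all $x\in\mathbb R$, then the system has a global classical solution $(\rho,u)$, i.e. one on $[0,\infty)$. If moreover $u_0$ is bounded and $\rho_0$ and $\partial_xu_0$ are uniformly continuous, then this solution satisfies $(\rho,u)\in C(\mathbb R^+;L^\infty(\mathbb R))\times C(\mathbb R^+;\dot W^{1,\infty}(\mathbb R))$. * **Supercritical region.** If there is an $x$ with $\partial_xu_0(x)<-(\psi\star\rho_0)(x)$, then the solution blows up in finite time: there are $0<T<\infty$ and a classical solution $(\rho,u)$ on $[0,T)$ such that $\inf_x\partial_xu(x,t)\to-\infty$ as $t\uparrow T$, and every classical solution on an interval $[0,T')$ with the same data has $T'\le T$ and coincides with $(\rho,u)$ on $[0,T')$. If moreover $u_0$ is bounded and $\rho_0$ and $\partial_xu_0$ are uniformly continuous, then $(\rho,u)\in C([0,T);L^\infty(\mathbb R))\times C([0,T);\dot W^{1,\infty}(\mathbb R))$. -/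

import Mathlib

open Set Filter Topology MeasureTheory
open scoped Convolution

namespace EulerAlignment

/-- Classical solutions `(ρ, u)` on the time interval `I` (in practice `[0, T)` or `[0, ∞)`) of
the one-dimensional pressureless Euler–alignment system
`∂ₜρ + ∂ₓ(ρu) = 0`,
`∂ₜu + u ∂ₓu = ∫ ψ(x - y) (u(y,t) - u(x,t)) ρ(y,t) dy`,
with initial data `(ρ₀, u₀)`. The argument order is time, then space: `ρ t x`, `u t x`.
Both unknowns are `C¹` on `I × ℝ` (up to the initial time, where the time derivative is
one-sided), the density is a probability density, `‖ρ(t)‖_{L^∞}`, `‖∂ₓu(t)‖_{L^∞}` and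
the first absolute moment of the velocity `∫ |u| ρ dx` (which makes the nonlocal
term an absolutely convergent integral) are bounded on every `[0, T]` with `T ∈ I`. -/
structure IsClassicalSolution (ψ ρ₀ u₀ : ℝ → ℝ) (I : Set ℝ) (ρ u : ℝ → ℝ → ℝ) : Prop where
  contDiffOn_density : ContDiffOn ℝ 1 (Function.uncurry ρ) (I ×ˢ univ)
  contDiffOn_velocity : ContDiffOn ℝ 1 (Function.uncurry u) (I ×ˢ univ)
  nonneg : ∀ t ∈ I, ∀ x, 0 ≤ ρ t x
  integrable : ∀ t ∈ I, Integrable (ρ t)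
  mass : ∀ t ∈ I, ∫ x, ρ t x = 1
  integrable_momentum : ∀ t ∈ I, Integrable (fun x => u t x * ρ t x)
  locally_bounded : ∀ T ∈ I, ∃ C : ℝ, ∀ t ∈ Icc 0 T,
    (∀ x, |ρ t x| ≤ C) ∧ (∀ x, |deriv (u t) x| ≤ C) ∧ ∫ x, |u t x| * ρ t x ≤ C
  continuity_eq : ∀ t ∈ I, ∀ x,
    derivWithin (fun s => ρ s x) I t + deriv (fun y => ρ t y * u t y) x = 0
  velocity_eq : ∀ t ∈ I, ∀ x,
    derivWithin (fun s => u s x) I t + u t x * deriv (u t) x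
      = ∫ y, ψ (x - y) * (u t y - u t x) * ρ t y
  initial_density : ρ 0 = ρ₀
  initial_velocity : u 0 = u₀

/-- `(ρ, u) ∈ C(I; L^∞(ℝ)) × C(I; Ẇ^{1,∞}(ℝ))`, with continuity in time with respect to the norm
of `L^∞` and the seminorm `‖∂ₓ ·‖_{L^∞}` of `Ẇ^{1,∞}`. -/
structure ContinuousInNorm (I : Set ℝ) (ρ u : ℝ → ℝ → ℝ) : Prop where
  memLp_density : ∀ t ∈ I, MemLp (ρ t) ⊤ volume
  differentiable_velocity : ∀ t ∈ I, Differentiable ℝ (u t)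
  memLp_velocity : ∀ t ∈ I, MemLp (deriv (u t)) ⊤ volume
  continuous_density : ∀ t ∈ I,
    Tendsto (fun s => eLpNorm (fun x => ρ s x - ρ t x) ⊤ volume) (𝓝[I] t) (𝓝 0)
  continuous_velocity : ∀ t ∈ I,
    Tendsto (fun s => eLpNorm (fun x => deriv (u s) x - deriv (u t) x) ⊤ volume) (𝓝[I] t) (𝓝 0)

end EulerAlignment

/-! Write `μ = ρ₀ dx` and let `Ψ` be the primitive of `ψ`. Along characteristics `X(t, α)` the
velocity satisfies `V' = ∫ ψ(X(α) - X(β)) (V(β) - V(α)) dμ(β)`, and the right side is the time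
derivative of `-∫ Ψ(X(α) - X(β)) dμ(β)`. The alignment force therefore integrates exactly, and the
dynamics reduce to the first order system `X' = u₀(α) + ∫ (Ψ(α - β) - Ψ(X(α) - X(β))) dμ(β)`. Since
`Ψ` is Lipschitz, this is a globally Lipschitz ODE for the displacement `X(α) - α` measured in units
of `1 + |u₀(α)|` (`lipschitz_field`). Its flow exists for all times, whether or not particles
collide.

The label derivative `Y = ∂X/∂α` solves the linear equation `Y' = e₀ - a Y`, where `e₀ = ∂ₓu₀ + ψ ⋆
ρ₀` and `0 ≤ a ≤ M`. Hence `Y = exp(-A) (1 + e₀ ∫ exp A)` with `A = ∫ a`. If `e₀ ≥ 0`, then `Y ≥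
exp(-M t)` for `t ≥ 0`. If `e₀(α) < 0`, then `Y` cannot stay positive up to time `-1 / e₀(α)`. While
`Y` is bounded below by a positive constant, the flow is a `C¹` change of variables, and `ρ = ρ₀ /
Y`, `u = V`, read in Eulerian coordinates, form a classical solution with `∂ₓu = e₀ / Y - a`
(`isClassicalSolution`, `Regular.deriv_u`).

The lifespan is the supremum of the times up to which `Y` has a positive lower bound. At that time
the infimum of `Y` over the labels is not positive. By the explicit formula, a small `Y` forces `e₀`
below a fixed negative number, so `∂ₓu` tends to `-∞` there (`eventually_exists_deriv_u_lt`).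

For uniqueness, the characteristics of any classical solution transport `μ` to its density and
satisfy the same first order system, so they coincide with `X` (`Characteristics.eq_X`). Their
uniform expansion bounds `Y` from below, so no classical solution outlives the lifespan. -/

namespace EulerAlignment

/-! ### Calculus: Gronwall, `C¹` from partial derivatives, parametric integrals. -/

section Calculus

variable {E : Type*} [NormedAddCommGroup E] [NormedSpace ℝ E]

/-- A Gronwall estimate on the segment between `s` and `t`, in either direction of time. -/
lemma norm_le_exp_of_norm_deriv_le {R R' : ℝ → E} {K ε s t : ℝ} (hK : 0 ≤ K) (hε : 0 ≤ ε)
    (hR : ∀ r ∈ uIcc s t, HasDerivAt R (R' r) r)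
    (hb : ∀ r ∈ uIcc s t, ‖R' r‖ ≤ K * ‖R r‖ + ε) :
    ‖R t‖ ≤ (‖R s‖ + ε * |t - s|) * Real.exp (K * |t - s|) := by
  -- Parametrizing the segment by `θ ∈ [0, 1]` turns both directions of time into forward Gronwall.
  have hmem : ∀ θ ∈ Icc (0 : ℝ) 1, s + θ * (t - s) ∈ uIcc s t := by
    intro θ hθ
    rw [← segment_eq_uIcc, segment_eq_image']
    exact ⟨θ, hθ, rfl⟩
  have hder : ∀ θ ∈ Icc (0 : ℝ) 1,
      HasDerivAt (fun θ => R (s + θ * (t - s))) ((t - s) • R' (s + θ * (t - s))) θ := by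
    intro θ hθ
    have h1 : HasDerivAt (fun θ : ℝ => s + θ * (t - s)) (t - s) θ := by
      simpa using ((hasDerivAt_id θ).mul_const (t - s)).const_add s
    exact (hR _ (hmem θ hθ)).scomp θ h1
  have key := norm_le_gronwallBound_of_norm_deriv_right_le (δ := ‖R s‖) (K := K * |t - s|)
    (ε := ε * |t - s|) (a := 0) (b := 1)
    (fun θ hθ => (hder θ hθ).continuousAt.continuousWithinAt)
    (fun θ hθ => (hder θ ⟨hθ.1, hθ.2.le⟩).hasDerivWithinAt) (by simp) (by
      intro θ hθ
      rw [norm_smul, Real.norm_eq_abs]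
      calc |t - s| * ‖R' (s + θ * (t - s))‖
          ≤ |t - s| * (K * ‖R (s + θ * (t - s))‖ + ε) := by
            gcongr; exact hb _ (hmem θ ⟨hθ.1, hθ.2.le⟩)
        _ = _ := by ring) 1 ⟨zero_le_one, le_rfl⟩
  have hend : s + 1 * (t - s) = t := by ring
  rw [hend] at key
  refine key.trans ?_
  set k := K * |t - s| with hk
  have hk0 : 0 ≤ k := by positivity
  have he : 0 ≤ ε * |t - s| := by positivity
  rcases hk0.eq_or_lt with h0 | h0
  · rw [← h0, gronwallBound_K0]; simp
  · rw [gronwallBound_of_K_ne_0 h0.ne']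
    -- This inequality removes the division by `k` from the Gronwall bound, so that `K = 0` needs no
    -- separate statement.
    have h1 : Real.exp k - 1 ≤ k * Real.exp k := by
      have := Real.add_one_le_exp (-k)
      have h2 : Real.exp (-k) * Real.exp k = 1 := by rw [← Real.exp_add]; simp
      nlinarith [Real.exp_pos k]
    have h3 : ε * |t - s| / k * (Real.exp k - 1) ≤ ε * |t - s| * Real.exp k := by
      rw [div_mul_eq_mul_div, div_le_iff₀ h0]
      nlinarith [mul_le_mul_of_nonneg_left h1 he]
    simp only [sub_zero, mul_one]
    nlinarith

lemma eq_of_hasDerivAt_zero {f : ℝ → ℝ} {a b : ℝ} (hab : a ≤ b) (hc : ContinuousOn f (Icc a b))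
    (hd : ∀ x ∈ Ioo a b, HasDerivAt f 0 x) : f b = f a := by
  rcases hab.eq_or_lt with rfl | h
  · rfl
  · obtain ⟨c, hc', h2⟩ := exists_hasDerivAt_eq_slope f (fun _ => 0) h hc hd
    have : b - a ≠ 0 := by linarith
    rw [eq_comm, div_eq_zero_iff] at h2
    rcases h2 with h2 | h2
    · linarith
    · exact absurd h2 this

/-- A function of two variables with continuous partial derivatives on an open set is `C¹`. -/
lemma hasFDerivAt_of_partials {f f₁ f₂ : ℝ → ℝ → ℝ} {U : Set (ℝ × ℝ)} (hU : IsOpen U)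
    (h₁ : ∀ p ∈ U, HasDerivAt (fun s => f s p.2) (f₁ p.1 p.2) p.1)
    (h₂ : ∀ p ∈ U, HasDerivAt (fun y => f p.1 y) (f₂ p.1 p.2) p.2)
    (c₁ : ContinuousOn (Function.uncurry f₁) U) (c₂ : ContinuousOn (Function.uncurry f₂) U)
    {p : ℝ × ℝ} (hp : p ∈ U) :
    HasFDerivAt (Function.uncurry f)
      ((ContinuousLinearMap.toSpanSingleton ℝ (f₁ p.1 p.2)).coprod
        (ContinuousLinearMap.toSpanSingleton ℝ (f₂ p.1 p.2))) p := by
  have hc : Continuous fun c : ℝ => ContinuousLinearMap.toSpanSingleton ℝ c :=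
    (ContinuousLinearMap.toSpanSingletonCLE (𝕜 := ℝ) (E := ℝ)).continuous
  exact (hasStrictFDerivAt_uncurry_coprod (u := p) (f := f)
    (f₁ := fun a b => ContinuousLinearMap.toSpanSingleton ℝ (f₁ a b))
    (f₂ := fun a b => ContinuousLinearMap.toSpanSingleton ℝ (f₂ a b))
    (by filter_upwards [hU.mem_nhds hp] with v hv using (h₁ v hv).hasFDerivAt)
    (by filter_upwards [hU.mem_nhds hp] with v hv using (h₂ v hv).hasFDerivAt)
    (hc.continuousAt.comp (c₁.continuousAt (hU.mem_nhds hp)))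
    (hc.continuousAt.comp (c₂.continuousAt (hU.mem_nhds hp)))).hasFDerivAt

lemma contDiffOn_of_partials {f f₁ f₂ : ℝ → ℝ → ℝ} {U : Set (ℝ × ℝ)} (hU : IsOpen U)
    (h₁ : ∀ p ∈ U, HasDerivAt (fun s => f s p.2) (f₁ p.1 p.2) p.1)
    (h₂ : ∀ p ∈ U, HasDerivAt (fun y => f p.1 y) (f₂ p.1 p.2) p.2)
    (c₁ : ContinuousOn (Function.uncurry f₁) U) (c₂ : ContinuousOn (Function.uncurry f₂) U) :
    ContDiffOn ℝ 1 (Function.uncurry f) U := by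
  have hc : Continuous fun c : ℝ => ContinuousLinearMap.toSpanSingleton ℝ c :=
    (ContinuousLinearMap.toSpanSingletonCLE (𝕜 := ℝ) (E := ℝ)).continuous
  intro p hp
  refine (contDiffAt_one_iff.2 ⟨fun p => (ContinuousLinearMap.toSpanSingleton ℝ
    (f₁ p.1 p.2)).coprod (ContinuousLinearMap.toSpanSingleton ℝ (f₂ p.1 p.2)), U,
    hU.mem_nhds hp, ?_, fun q hq => hasFDerivAt_of_partials hU h₁ h₂ c₁ c₂ hq⟩).contDiffWithinAt
  have : ∀ L₁ L₂ : ℝ →L[ℝ] ℝ, L₁.coprod L₂ = L₁.comp (ContinuousLinearMap.fst ℝ ℝ ℝ) +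
      L₂.comp (ContinuousLinearMap.snd ℝ ℝ ℝ) := fun _ _ => by ext <;> simp
  simp only [this]
  exact ((hc.comp_continuousOn c₁).clm_comp continuousOn_const).add
    ((hc.comp_continuousOn c₂).clm_comp continuousOn_const)

lemma hasDerivAt_along_curve {f f₁ f₂ : ℝ → ℝ → ℝ} {U : Set (ℝ × ℝ)} (hU : IsOpen U)
    (h₁ : ∀ p ∈ U, HasDerivAt (fun s => f s p.2) (f₁ p.1 p.2) p.1)
    (h₂ : ∀ p ∈ U, HasDerivAt (fun y => f p.1 y) (f₂ p.1 p.2) p.2)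
    (c₁ : ContinuousOn (Function.uncurry f₁) U) (c₂ : ContinuousOn (Function.uncurry f₂) U)
    {γ : ℝ → ℝ} {t v : ℝ} (hp : (t, γ t) ∈ U) (hγ : HasDerivAt γ v t) :
    HasDerivAt (fun s => f s (γ s)) (f₁ t (γ t) + v * f₂ t (γ t)) t := by
  have h := (hasFDerivAt_of_partials hU h₁ h₂ c₁ c₂ hp).comp_hasDerivAt t
    ((hasDerivAt_id t).prodMk hγ)
  simpa [Function.comp_def] using h

/-- Differentiation under an interval integral with jointly continuous derivative. -/
lemma hasDerivAt_intervalIntegral_param {f f' : ℝ → ℝ → ℝ} {U : Set ℝ} (hU : IsOpen U) {a b : ℝ}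
    (hf : ContinuousOn (Function.uncurry f) (U ×ˢ uIcc a b))
    (hf' : ContinuousOn (Function.uncurry f') (U ×ˢ uIcc a b))
    (hd : ∀ r ∈ U, ∀ s ∈ uIcc a b, HasDerivAt (fun r => f r s) (f' r s) r) {r : ℝ} (hr : r ∈ U) :
    HasDerivAt (fun r => ∫ s in a..b, f r s) (∫ s in a..b, f' r s) r := by
  obtain ⟨δ, hδ, hball⟩ := Metric.isOpen_iff.1 hU r hr
  have hsub : Metric.closedBall r (δ / 2) ⊆ U :=
    (Metric.closedBall_subset_ball (by linarith)).trans hball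
  have hK : IsCompact (Metric.closedBall r (δ / 2) ×ˢ uIcc a b) :=
    (isCompact_closedBall _ _).prod isCompact_uIcc
  obtain ⟨C, hC⟩ := hK.exists_bound_of_continuousOn (hf'.mono (prod_mono_left hsub))
  have slice : ∀ g : ℝ → ℝ → ℝ, ContinuousOn (Function.uncurry g) (U ×ˢ uIcc a b) → ∀ x ∈ U,
      ContinuousOn (g x) (uIcc a b) := fun g hg x hx =>
    hg.comp (continuousOn_const.prodMk continuousOn_id) fun s hs => ⟨hx, hs⟩
  have hmeas : ∀ g : ℝ → ℝ → ℝ, ContinuousOn (Function.uncurry g) (U ×ˢ uIcc a b) → ∀ x ∈ U,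
      AEStronglyMeasurable (g x) (volume.restrict (uIoc a b)) := fun g hg x hx =>
    ((slice g hg x hx).mono uIoc_subset_uIcc).aestronglyMeasurable measurableSet_uIoc
  refine (intervalIntegral.hasDerivAt_integral_of_dominated_loc_of_deriv_le
    (s := Metric.closedBall r (δ / 2)) (bound := fun _ => C) (F' := f')
    (Metric.closedBall_mem_nhds r (by linarith)) ?_ ((slice f hf r hr).intervalIntegrable)
    (hmeas f' hf' r hr) ?_ intervalIntegrable_const ?_).2
  · filter_upwards [hU.mem_nhds hr] with x hx using hmeas f hf x hx
  · exact .of_forall fun s hs x hx => hC (x, s) ⟨hx, uIoc_subset_uIcc hs⟩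
  · exact .of_forall fun s hs x hx => hd x (hsub hx) s (uIoc_subset_uIcc hs)

/-- The primitive of a jointly continuous function is jointly continuous. -/
lemma continuousOn_primitive_param {f : ℝ → ℝ → ℝ} {p q a : ℝ} (hf : ContinuousOn
    (Function.uncurry f) (Icc p q ×ˢ univ)) (ha : a ∈ Icc p q) :
    ContinuousOn (fun z : ℝ × ℝ => ∫ s in a..z.1, f s z.2) (Icc p q ×ˢ univ) := by
  have hpq : p ≤ q := ha.1.trans ha.2
  -- Freezing time outside `[p, q]` makes the integrand globally continuous without changing the
  -- integrals that occur.
  have hg : Continuous (Function.uncurry fun (x : ℝ) (s : ℝ) => f (projIcc p q hpq s) x) := by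
    refine hf.comp_continuous (f := fun z : ℝ × ℝ => ((projIcc p q hpq z.2 : ℝ), z.1)) ?_
      fun z => ⟨(projIcc p q hpq z.2).2, mem_univ _⟩
    exact (continuous_subtype_val.comp (continuous_projIcc.comp continuous_snd)).prodMk
      continuous_fst
  have h2 : Continuous fun z : ℝ × ℝ => ∫ s in a..z.1, f (projIcc p q hpq s) z.2 :=
    (intervalIntegral.continuous_parametric_primitive_of_continuous hg (μ := volume)
      (a₀ := a)).comp continuous_swap
  refine h2.continuousOn.congr fun z hz => intervalIntegral.integral_congr fun s hs => ?_
  have : s ∈ Icc p q := (uIcc_subset_Icc ha hz.1) hs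
  simp [projIcc_of_mem hpq this]

/-- Expansion by a uniform factor forces at least linear growth at both ends. This is how a lower
bound on the Jacobian becomes bijectivity of the flow map. -/
lemma strictMono_surjective_of_le_sub {f : ℝ → ℝ} {c : ℝ} (hc : 0 < c) (hf : Continuous f)
    (h : ∀ x y, x ≤ y → c * (y - x) ≤ f y - f x) : StrictMono f ∧ Function.Surjective f := by
  refine ⟨fun x y hxy => ?_, hf.surjective ?_ ?_⟩
  · nlinarith [h x y hxy.le]
  · refine tendsto_atTop_mono' atTop (f₁ := fun y => c * y + f 0) ?_
      (tendsto_atTop_add_const_right _ _ (tendsto_id.const_mul_atTop hc))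
    filter_upwards [eventually_ge_atTop 0] with y hy
    linarith [h 0 y hy]
  · have hlow : Tendsto (fun y => c * y + f 0) atBot atBot :=
      (tendsto_atBot_add_const_right _ _ (tendsto_id.const_mul_atBot hc))
    refine tendsto_atBot_mono' atBot ?_ hlow
    filter_upwards [eventually_le_atBot 0] with y hy
    linarith [h y 0 hy]

end Calculus

/-! ### Scheffé's lemma and convolution with merely bounded kernels. -/

section Scheffe

/-- Scheffé's lemma. -/
lemma tendsto_integral_abs_sub {ι : Type*} {l : Filter ι} [l.IsCountablyGenerated]
    {F : ι → ℝ → ℝ} {f : ℝ → ℝ} (hF0 : ∀ᶠ i in l, ∀ x, 0 ≤ F i x) (hf0 : ∀ x, 0 ≤ f x)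
    (hF : ∀ᶠ i in l, Integrable (F i)) (hf : Integrable f)
    (hmass : ∀ᶠ i in l, ∫ x, F i x = ∫ x, f x) (hlim : ∀ x, Tendsto (F · x) l (𝓝 (f x))) :
    Tendsto (fun i => ∫ x, |F i x - f x|) l (𝓝 0) := by
  -- Only the part `(f - F)⁺` has an integrable majorant, namely `f`. Equality of the masses makes
  -- the `L¹` distance twice its integral.
  have h1 : Tendsto (fun i => ∫ x, max (f x - F i x) 0) l (𝓝 (∫ _ : ℝ, (0 : ℝ))) := by
    refine tendsto_integral_filter_of_dominated_convergence f ?_ ?_ hf ?_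
    · filter_upwards [hF] with i hi using ((hf.sub hi).pos_part).aestronglyMeasurable
    · filter_upwards [hF0] with i hi
      refine .of_forall fun x => ?_
      rw [Real.norm_of_nonneg (le_max_right _ _)]
      exact max_le (by linarith [hi x]) (hf0 x)
    · refine .of_forall fun x => ?_
      have h2 : Tendsto (fun i => f x - F i x) l (𝓝 0) := by
        simpa using (hlim x).const_sub (f x)
      simpa using h2.max (tendsto_const_nhds (x := (0 : ℝ)))
  have h3 : Tendsto (fun i => 2 * ∫ x, max (f x - F i x) 0) l (𝓝 0) := by
    simpa using h1.const_mul 2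
  refine h3.congr' ?_
  filter_upwards [hF, hmass] with i hi hm
  have h4 : ∀ x, |F i x - f x| = 2 * max (f x - F i x) 0 + (F i x - f x) := fun x => by
    rcases le_total (f x) (F i x) with h | h
    · rw [abs_of_nonneg (by linarith), max_eq_right (by linarith)]; ring
    · rw [abs_of_nonpos (by linarith), max_eq_left (by linarith)]; ring
  simp only [h4]
  have h5 : Integrable (fun x => 2 * max (f x - F i x) 0) := (hf.sub hi).pos_part.const_mul 2
  have h6 : Integrable fun x => F i x - f x := hi.sub hf
  rw [integral_add h5 h6, integral_sub hi hf, hm, integral_const_mul]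
  ring

/-- Convolution of a bounded measurable function with a continuous family of probability
densities. -/
lemma continuousOn_convolution_density {g : ℝ → ℝ} {L : ℝ} (hg : Measurable g)
    (hgL : ∀ z, |g z| ≤ L) {U : Set ℝ} {σ : ℝ → ℝ → ℝ}
    (hσ : ContinuousOn (Function.uncurry σ) (U ×ˢ univ)) (hσ0 : ∀ t ∈ U, ∀ x, 0 ≤ σ t x)
    (hσi : ∀ t ∈ U, Integrable (σ t)) (hσ1 : ∀ t ∈ U, ∫ x, σ t x = 1) :
    ContinuousOn (fun p : ℝ × ℝ => ∫ y, g (p.2 - y) * σ p.1 y) (U ×ˢ univ) := by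
  -- Moving the translation onto the density leaves `g`, which need not be continuous, independent
  -- of `p`.
  have hrw : ∀ p : ℝ × ℝ, ∫ y, g (p.2 - y) * σ p.1 y = ∫ z, g z * σ p.1 (p.2 - z) := fun p => by
    rw [← integral_sub_left_eq_self (fun y => g (p.2 - y) * σ p.1 y) volume p.2]
    simp
  simp only [hrw]
  have hint : ∀ p ∈ U ×ˢ (univ : Set ℝ), Integrable fun z => σ p.1 (p.2 - z) := fun p hp =>
    (hσi p.1 hp.1).comp_sub_left p.2
  have hintg : ∀ p ∈ U ×ˢ (univ : Set ℝ), Integrable fun z => g z * σ p.1 (p.2 - z) :=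
    fun p hp => (hint p hp).bdd_mul (c := L) hg.aestronglyMeasurable (.of_forall hgL)
  intro p hp
  have hlim := tendsto_integral_abs_sub (l := 𝓝[U ×ˢ univ] p) (F := fun q z => σ q.1 (q.2 - z))
    (f := fun z => σ p.1 (p.2 - z))
    (by filter_upwards [self_mem_nhdsWithin] with q hq x using hσ0 q.1 hq.1 _)
    (fun x => hσ0 p.1 hp.1 _)
    (by filter_upwards [self_mem_nhdsWithin] with q hq using hint q hq) (hint p hp)
    (by
      filter_upwards [self_mem_nhdsWithin] with q hq
      rw [integral_sub_left_eq_self (σ q.1) volume q.2,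
        integral_sub_left_eq_self (σ p.1) volume p.2, hσ1 q.1 hq.1, hσ1 p.1 hp.1])
    (fun z => by
      have h2 : ContinuousWithinAt (fun q : ℝ × ℝ => (q.1, q.2 - z)) (U ×ˢ univ) p := by
        fun_prop
      exact ContinuousWithinAt.comp (f := fun q : ℝ × ℝ => (q.1, q.2 - z))
        (hσ (p.1, p.2 - z) ⟨hp.1, mem_univ _⟩) h2 fun q hq => ⟨hq.1, mem_univ _⟩)
  have hL : 0 ≤ L := (abs_nonneg _).trans (hgL 0)
  rw [ContinuousWithinAt, tendsto_iff_norm_sub_tendsto_zero]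
  refine squeeze_zero' (.of_forall fun _ => norm_nonneg _) ?_ (by simpa using hlim.const_mul L)
  filter_upwards [self_mem_nhdsWithin] with q hq
  rw [← integral_sub (hintg q hq) (hintg p hp), ← integral_const_mul]
  refine norm_integral_le_of_norm_le (((hint q hq).sub (hint p hp)).abs.const_mul L)
    (.of_forall fun z => ?_)
  rw [← mul_sub, norm_mul]
  exact mul_le_mul_of_nonneg_right (hgL z) (norm_nonneg _)

end Scheffe

/-! ### Global integral curves of Lipschitz fields on a Banach space. -/

section GlobalODE

variable {E : Type*} [NormedAddCommGroup E] [NormedSpace ℝ E]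

/-- Integration gains the factor `1 / l` in the norm weighted by `exp (l |t|)`. With `l` twice the
Lipschitz constant, the Picard map becomes a contraction on the whole time axis at once. -/
lemma norm_integral_le_exp {h : ℝ → E} {C l : ℝ} (hl : 0 < l)
    (hb : ∀ s, ‖h s‖ ≤ C * Real.exp (l * |s|)) (t : ℝ) :
    ‖∫ s in (0 : ℝ)..t, h s‖ ≤ C / l * Real.exp (l * |t|) := by
  have hC : 0 ≤ C := by simpa using (norm_nonneg _).trans (hb 0)
  have main : ∀ (h : ℝ → E), (∀ s, ‖h s‖ ≤ C * Real.exp (l * |s|)) → ∀ t : ℝ, 0 ≤ t →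
      ‖∫ s in (0 : ℝ)..t, h s‖ ≤ C / l * Real.exp (l * |t|) := by
    intro h hb t ht
    have hd : ∀ s, HasDerivAt (fun s => C / l * Real.exp (l * s)) (C * Real.exp (l * s)) s := by
      intro s
      exact ((((hasDerivAt_id' s).const_mul l).exp).const_mul (C / l)).congr_deriv
        (by field_simp)
    refine (intervalIntegral.norm_integral_le_of_norm_le (g := fun s => C * Real.exp (l * s)) ht
      (.of_forall fun s hs => ?_) (by apply Continuous.intervalIntegrable; fun_prop)).trans ?_
    · simpa [abs_of_pos hs.1] using hb s
    · rw [intervalIntegral.integral_eq_sub_of_hasDerivAt (fun s _ => hd s)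
        (by apply Continuous.intervalIntegrable; fun_prop), abs_of_nonneg ht]
      have : 0 ≤ C / l * Real.exp (l * 0) := by positivity
      linarith
  rcases le_total 0 t with ht | ht
  · exact main h hb t ht
  · have h1 := main (fun s => h (-s)) (fun s => by simpa using hb (-s)) (-t) (by linarith)
    rw [intervalIntegral.integral_comp_neg, intervalIntegral.integral_symm] at h1
    simpa using h1

/-- A continuous vector field that is globally Lipschitz in space, uniformly in time, and bounded
in time at one point has a global integral curve through that point at time `0`. -/
theorem exists_global_integralCurve [CompleteSpace E] {f : ℝ → E → E} {K : NNReal}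
    (hK : ∀ t, LipschitzWith K (f t)) (hf : Continuous (Function.uncurry f)) {B : ℝ} {x₀ : E}
    (hB : ∀ t, ‖f t x₀‖ ≤ B) :
    ∃ γ : ℝ → E, γ 0 = x₀ ∧ ∀ t, HasDerivAt γ (f t (γ t)) t := by
  set k : ℝ := K + 1 with hk
  have hk0 : 0 < k := by positivity
  have hB0 : 0 ≤ B := (norm_nonneg _).trans (hB 0)
  -- The curve is sought as `x₀ + w g` with `g` bounded: the weight absorbs exponential growth, and
  -- the exponent `2 k` yields the contraction factor `1 / 2`.
  let w : ℝ → ℝ := fun t => Real.exp (2 * k * |t|)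
  have hw : Continuous w := by fun_prop
  have hw1 : ∀ t, 1 ≤ w t := fun t => Real.one_le_exp (by positivity)
  have hw0 : ∀ t, 0 < w t := fun t => Real.exp_pos _
  have hcont : ∀ g : BoundedContinuousFunction ℝ E, Continuous fun s => f s (x₀ + w s • g s) :=
    fun g => hf.comp (continuous_id.prodMk (continuous_const.add (hw.smul g.continuous)))
  have hlip : ∀ t x y, ‖f t x - f t y‖ ≤ k * ‖x - y‖ := fun t x y => by
    have := (hK t).dist_le_mul x y
    rw [dist_eq_norm, dist_eq_norm] at this
    nlinarith [norm_nonneg (x - y)]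
  have hbound : ∀ (g : BoundedContinuousFunction ℝ E) (s : ℝ),
      ‖f s (x₀ + w s • g s)‖ ≤ (B + k * ‖g‖) * Real.exp (2 * k * |s|) := by
    intro g s
    have h1 := hlip s (x₀ + w s • g s) x₀
    rw [add_sub_cancel_left, norm_smul, Real.norm_of_nonneg (hw0 s).le] at h1
    have h2 : ‖f s (x₀ + w s • g s)‖ ≤ ‖f s (x₀ + w s • g s) - f s x₀‖ + ‖f s x₀‖ := by
      simpa using norm_add_le (f s (x₀ + w s • g s) - f s x₀) (f s x₀)
    have h3 : k * (w s * ‖g s‖) ≤ k * (w s * ‖g‖) := by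
      gcongr
      exact g.norm_coe_le_norm s
    have h4 : B * 1 ≤ B * w s := mul_le_mul_of_nonneg_left (hw1 s) hB0
    change _ ≤ (B + k * ‖g‖) * w s
    nlinarith [hB s]
  let P : BoundedContinuousFunction ℝ E → BoundedContinuousFunction ℝ E := fun g =>
    BoundedContinuousFunction.ofNormedAddCommGroup
      (fun t => (w t)⁻¹ • ∫ s in (0 : ℝ)..t, f s (x₀ + w s • g s))
      ((hw.inv₀ fun t => (hw0 t).ne').smul
        (intervalIntegral.continuous_primitive (fun _ _ => (hcont g).intervalIntegrable _ _) 0))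
      ((B + k * ‖g‖) / (2 * k)) fun t => by
        rw [norm_smul, norm_inv, Real.norm_of_nonneg (hw0 t).le, inv_mul_le_iff₀ (hw0 t)]
        rw [mul_comm]
        exact norm_integral_le_exp (by positivity) (hbound g) t
  have hP : ContractingWith 2⁻¹ P := by
    refine ⟨by rw [← NNReal.coe_lt_coe]; norm_num, LipschitzWith.of_dist_le_mul fun g g' => ?_⟩
    rw [BoundedContinuousFunction.dist_le (by positivity)]
    intro t
    change dist ((w t)⁻¹ • ∫ s in (0 : ℝ)..t, f s (x₀ + w s • g s))
      ((w t)⁻¹ • ∫ s in (0 : ℝ)..t, f s (x₀ + w s • g' s)) ≤ _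
    rw [dist_eq_norm, ← smul_sub, ← intervalIntegral.integral_sub
      ((hcont g).intervalIntegrable _ _) ((hcont g').intervalIntegrable _ _), norm_smul, norm_inv,
      Real.norm_of_nonneg (hw0 t).le, inv_mul_le_iff₀ (hw0 t)]
    refine (norm_integral_le_exp (C := k * dist g g') (l := 2 * k) (by positivity)
      (fun s => ?_) t).trans (le_of_eq ?_)
    · refine (hlip _ _ _).trans ?_
      rw [add_sub_add_left_eq_sub, ← smul_sub, norm_smul, Real.norm_of_nonneg (hw0 s).le,
        ← dist_eq_norm]
      have := g.dist_coe_le_dist (g := g') s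
      calc k * (w s * dist (g s) (g' s)) ≤ k * (w s * dist g g') := by
            gcongr
        _ = _ := by simp only [w]; ring
    · simp only [w, NNReal.coe_inv, NNReal.coe_ofNat]
      field_simp
  obtain ⟨g, hg⟩ : ∃ g, P g = g := ⟨_, hP.fixedPoint_isFixedPt⟩
  have hfix : ∀ t, ∫ s in (0 : ℝ)..t, f s (x₀ + w s • g s) = w t • g t := fun t => by
    have h1 : (w t)⁻¹ • ∫ s in (0 : ℝ)..t, f s (x₀ + w s • g s) = g t :=
      congrArg (fun h : BoundedContinuousFunction ℝ E => h t) hg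
    rw [← h1, smul_inv_smul₀ (hw0 t).ne']
  refine ⟨fun t => x₀ + w t • g t, ?_, fun t => ?_⟩
  · have h0 := hfix 0
    rw [intervalIntegral.integral_same] at h0
    simp [← h0]
  have h2 : HasDerivAt (fun t => ∫ s in (0 : ℝ)..t, f s (x₀ + w s • g s))
      (f t (x₀ + w t • g t)) t :=
    intervalIntegral.integral_hasDerivAt_right ((hcont g).intervalIntegrable _ _)
      ((hcont g).stronglyMeasurableAtFilter _ _) (hcont g).continuousAt
  simpa only [hfix] using h2.const_add x₀

end GlobalODE

end EulerAlignment

/-! ### Initial data, the mass measure and the interaction functional. -/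

namespace EulerAlignment

/-- The influence function and the initial data, with their standing assumptions. -/
structure InitialData where
  ψ : ℝ → ℝ
  L : NNReal
  M : ℝ
  ρ₀ : ℝ → ℝ
  u₀ : ℝ → ℝ
  B : ℝ
  lipschitz : LipschitzWith L ψ
  ψ_nonneg : ∀ x, 0 ≤ ψ x
  ψ_le : ∀ x, ψ x ≤ M
  contDiff_ρ₀ : ContDiff ℝ 1 ρ₀
  ρ₀_nonneg : ∀ x, 0 ≤ ρ₀ x
  integrable_ρ₀ : Integrable ρ₀
  mass : ∫ x, ρ₀ x = 1
  contDiff_u₀ : ContDiff ℝ 2 u₀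
  abs_deriv_u₀_le : ∀ x, |deriv u₀ x| ≤ B
  integrable_momentum : Integrable fun x => u₀ x * ρ₀ x

namespace InitialData

variable (D : InitialData)

lemma M_nonneg : 0 ≤ D.M := (D.ψ_nonneg 0).trans (D.ψ_le 0)

lemma B_nonneg : 0 ≤ D.B := (abs_nonneg _).trans (D.abs_deriv_u₀_le 0)

lemma continuous_ψ : Continuous D.ψ := D.lipschitz.continuous

lemma abs_ψ_le (x : ℝ) : |D.ψ x| ≤ D.M := by
  rw [abs_of_nonneg (D.ψ_nonneg x)]; exact D.ψ_le x

lemma abs_ψ_sub_le (x y : ℝ) : |D.ψ x - D.ψ y| ≤ D.L * |x - y| := by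
  simpa [Real.dist_eq] using D.lipschitz.dist_le_mul x y

/-- The initial mass distribution. -/
noncomputable def μ : Measure ℝ := volume.withDensity fun x => ENNReal.ofReal (D.ρ₀ x)

lemma measurable_density : Measurable fun x => ENNReal.ofReal (D.ρ₀ x) :=
  D.contDiff_ρ₀.continuous.measurable.ennreal_ofReal

lemma integral_μ (f : ℝ → ℝ) : ∫ x, f x ∂D.μ = ∫ x, f x * D.ρ₀ x := by
  rw [μ, integral_withDensity_eq_integral_toReal_smul D.measurable_density
    (.of_forall fun _ => ENNReal.ofReal_lt_top)]
  simp [ENNReal.toReal_ofReal (D.ρ₀_nonneg _), mul_comm]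

lemma integrable_μ_iff (f : ℝ → ℝ) : Integrable f D.μ ↔ Integrable fun x => f x * D.ρ₀ x := by
  rw [μ, integrable_withDensity_iff_integrable_smul' D.measurable_density
    (.of_forall fun _ => ENNReal.ofReal_lt_top)]
  simp [ENNReal.toReal_ofReal (D.ρ₀_nonneg _), mul_comm]

instance : IsProbabilityMeasure D.μ := by
  refine ⟨?_⟩
  rw [μ, withDensity_apply _ MeasurableSet.univ, setLIntegral_univ,
    ← ofReal_integral_eq_lintegral_ofReal D.integrable_ρ₀ (.of_forall D.ρ₀_nonneg), D.mass,
    ENNReal.ofReal_one]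

/-- The weight controlling the growth of the particle displacements. -/
def weight (x : ℝ) : ℝ := 1 + |D.u₀ x|

lemma one_le_weight (x : ℝ) : 1 ≤ D.weight x := by
  have := abs_nonneg (D.u₀ x)
  simp only [weight]; linarith

lemma weight_pos (x : ℝ) : 0 < D.weight x := zero_lt_one.trans_le (D.one_le_weight x)

lemma continuous_weight : Continuous D.weight :=
  continuous_const.add D.contDiff_u₀.continuous.abs

lemma integrable_weight : Integrable D.weight D.μ := by
  refine (integrable_const 1).add ?_
  rw [integrable_μ_iff]
  refine D.integrable_momentum.abs.congr (.of_forall fun x => ?_)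
  simp only [abs_mul, abs_of_nonneg (D.ρ₀_nonneg x)]

/-- The total weight. -/
noncomputable def totalWeight : ℝ := ∫ x, D.weight x ∂D.μ

lemma totalWeight_nonneg : 0 ≤ D.totalWeight := integral_nonneg fun x => (D.weight_pos x).le

/-- The odd primitive of the influence function. -/
noncomputable def Ψ (x : ℝ) : ℝ := ∫ y in (0 : ℝ)..x, D.ψ y

lemma hasDerivAt_Ψ (x : ℝ) : HasDerivAt D.Ψ (D.ψ x) x :=
  intervalIntegral.integral_hasDerivAt_right (D.continuous_ψ.intervalIntegrable _ _)
    (D.continuous_ψ.stronglyMeasurableAtFilter _ _) D.continuous_ψ.continuousAt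

lemma continuous_Ψ : Continuous D.Ψ :=
  continuous_iff_continuousAt.2 fun x => (D.hasDerivAt_Ψ x).continuousAt

lemma Ψ_sub (x y : ℝ) : D.Ψ x - D.Ψ y = ∫ s in y..x, D.ψ s :=
  intervalIntegral.integral_interval_sub_left (D.continuous_ψ.intervalIntegrable _ _)
    (D.continuous_ψ.intervalIntegrable _ _)

lemma abs_Ψ_sub_le (x y : ℝ) : |D.Ψ x - D.Ψ y| ≤ D.M * |x - y| := by
  rw [Ψ_sub, ← Real.norm_eq_abs]
  exact intervalIntegral.norm_integral_le_of_norm_le_const fun s _ => D.abs_ψ_le s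

lemma abs_Ψ_sub_sub_le (x y : ℝ) : |D.Ψ y - D.Ψ x - D.ψ x * (y - x)| ≤ D.L * (y - x) ^ 2 := by
  have h : D.Ψ y - D.Ψ x - D.ψ x * (y - x) = ∫ s in x..y, (D.ψ s - D.ψ x) := by
    rw [intervalIntegral.integral_sub (D.continuous_ψ.intervalIntegrable _ _)
      intervalIntegrable_const, ← Ψ_sub, intervalIntegral.integral_const, smul_eq_mul]
    ring
  rw [h, ← Real.norm_eq_abs, ← sq_abs, sq, ← mul_assoc]
  refine intervalIntegral.norm_integral_le_of_norm_le_const fun s hs => ?_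
  refine (D.abs_ψ_sub_le s x).trans ?_
  exact mul_le_mul_of_nonneg_left (abs_sub_left_of_mem_uIcc (uIoc_subset_uIcc hs)) D.L.2

/-- Admissible particle configurations. -/
structure Admissible (Z : ℝ → ℝ) : Prop where
  continuous : Continuous Z
  integrable : Integrable (fun β => Z β - β) D.μ

/-- The change `∫ (Ψ(α - β) - Ψ(x - Z(β))) dμ(β)` of the interaction potential at a particle moved
from `α` to `x` while the other particles move along `Z`. -/
noncomputable def interaction (Z : ℝ → ℝ) (α x : ℝ) : ℝ := ∫ β, (D.Ψ (α - β) - D.Ψ (x - Z β)) ∂D.μ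

/-- The local alignment strength `∫ ψ(x - Z(β)) dμ(β)`. -/
noncomputable def strength (Z : ℝ → ℝ) (x : ℝ) : ℝ := ∫ β, D.ψ (x - Z β) ∂D.μ

variable {D}

lemma Admissible.id : D.Admissible fun β => β := ⟨continuous_id, by simp⟩

/-- No first moment of `ρ₀` is assumed, so the two terms need not be integrable separately. Their
difference is controlled by the displacement `Z β - β`, which is integrable by admissibility. -/
lemma integrable_interaction {Z : ℝ → ℝ} (hZ : D.Admissible Z) (α x : ℝ) :
    Integrable (fun β => D.Ψ (α - β) - D.Ψ (x - Z β)) D.μ := by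
  have hZc := hZ.continuous
  have hΨ := D.continuous_Ψ
  refine Integrable.mono' (g := fun β => D.M * (|α - x| + |Z β - β|))
    (((integrable_const _).add hZ.integrable.abs).const_mul _)
    (Continuous.aestronglyMeasurable (by fun_prop)) (.of_forall fun β => ?_)
  refine (D.abs_Ψ_sub_le _ _).trans (mul_le_mul_of_nonneg_left ?_ D.M_nonneg)
  have : α - β - (x - Z β) = (α - x) + (Z β - β) := by ring
  rw [this]; exact abs_add_le _ _

lemma integrable_strength {Z : ℝ → ℝ} (hZ : Continuous Z) (x : ℝ) :
    Integrable (fun β => D.ψ (x - Z β)) D.μ := by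
  have hψ := D.continuous_ψ
  exact Integrable.of_bound (Continuous.aestronglyMeasurable (by fun_prop)) D.M
    (.of_forall fun β => D.abs_ψ_le _)

lemma strength_nonneg (Z : ℝ → ℝ) (x : ℝ) : 0 ≤ D.strength Z x :=
  integral_nonneg fun _ => D.ψ_nonneg _

lemma strength_le (Z : ℝ → ℝ) (x : ℝ) : D.strength Z x ≤ D.M := by
  have := norm_integral_le_of_norm_le_const (μ := D.μ) (f := fun β => D.ψ (x - Z β)) (C := D.M)
    (.of_forall fun β => D.abs_ψ_le _)
  simp only [probReal_univ, mul_one] at this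
  exact (le_abs_self _).trans this

lemma abs_interaction_sub_le {Z Z' : ℝ → ℝ} (hZ : D.Admissible Z) (hZ' : D.Admissible Z')
    (α x x' : ℝ) : |D.interaction Z α x - D.interaction Z' α x'|
      ≤ D.M * (|x - x'| + ∫ β, |Z β - Z' β| ∂D.μ) := by
  have hi : Integrable (fun β => |Z β - Z' β|) D.μ := by
    refine ((hZ.integrable.sub hZ'.integrable).abs).congr (.of_forall fun β => ?_)
    simp
  rw [interaction, interaction, ← integral_sub (integrable_interaction hZ α x)
    (integrable_interaction hZ' α x')]
  have h1 : D.M * (|x - x'| + ∫ β, |Z β - Z' β| ∂D.μ)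
      = ∫ β, D.M * (|x - x'| + |Z β - Z' β|) ∂D.μ := by
    rw [integral_const_mul, integral_add (integrable_const _) hi]; simp
  rw [h1, ← Real.norm_eq_abs]
  refine norm_integral_le_of_norm_le (((integrable_const _).add hi).const_mul _)
    (.of_forall fun β => ?_)
  rw [sub_sub_sub_cancel_left]
  refine (D.abs_Ψ_sub_le _ _).trans (mul_le_mul_of_nonneg_left ?_ D.M_nonneg)
  have : x' - Z' β - (x - Z β) = -(x - x') + (Z β - Z' β) := by ring
  rw [this]
  exact (abs_add_le _ _).trans (by rw [abs_neg])

lemma abs_interaction_sub_le' {Z : ℝ → ℝ} (hZ : D.Admissible Z)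
    (α α' x x' : ℝ) : |D.interaction Z α x - D.interaction Z α' x'|
      ≤ D.M * (|α - α'| + |x - x'|) := by
  rw [interaction, interaction, ← integral_sub (integrable_interaction hZ α x)
    (integrable_interaction hZ α' x')]
  have := norm_integral_le_of_norm_le_const (μ := D.μ) (C := D.M * (|α - α'| + |x - x'|))
    (f := fun β => D.Ψ (α - β) - D.Ψ (x - Z β) - (D.Ψ (α' - β) - D.Ψ (x' - Z β)))
    (.of_forall fun β => ?_)
  · simpa using this
  · have h1 := D.abs_Ψ_sub_le (α - β) (α' - β)
    have h2 := D.abs_Ψ_sub_le (x' - Z β) (x - Z β)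
    rw [sub_sub_sub_cancel_right] at h1 h2
    have : D.Ψ (α - β) - D.Ψ (x - Z β) - (D.Ψ (α' - β) - D.Ψ (x' - Z β))
      = (D.Ψ (α - β) - D.Ψ (α' - β)) + (D.Ψ (x' - Z β) - D.Ψ (x - Z β)) := by ring
    rw [this, mul_add, abs_sub_comm x x']
    exact (norm_add_le _ _).trans (add_le_add h1 h2)

/-- First order expansion of the interaction with quadratic remainder. -/
lemma abs_interaction_expansion_le {Z : ℝ → ℝ} (hZ : D.Admissible Z) (α α' x x' : ℝ) :
    |D.interaction Z α' x' - D.interaction Z α x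
      - (D.strength (fun β => β) α * (α' - α) - D.strength Z x * (x' - x))|
      ≤ D.L * ((α' - α) ^ 2 + (x' - x) ^ 2) := by
  have i1 := integrable_interaction hZ α x
  have i2 := integrable_interaction hZ α' x'
  have i3 := (integrable_strength (D := D) continuous_id' α).mul_const (α' - α)
  have i4 := (integrable_strength (D := D) hZ.continuous x).mul_const (x' - x)
  have i5 : Integrable (fun β => D.Ψ (α' - β) - D.Ψ (x' - Z β) - (D.Ψ (α - β) - D.Ψ (x - Z β)))
    D.μ := i2.sub i1
  have i6 : Integrable (fun β => D.ψ (α - β) * (α' - α) - D.ψ (x - Z β) * (x' - x)) D.μ :=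
    i3.sub i4
  rw [interaction, interaction, strength, strength, ← integral_mul_const, ← integral_mul_const,
    ← integral_sub i2 i1, ← integral_sub i3 i4, ← integral_sub i5 i6]
  have := norm_integral_le_of_norm_le_const (μ := D.μ)
    (C := D.L * ((α' - α) ^ 2 + (x' - x) ^ 2))
    (f := fun β => D.Ψ (α' - β) - D.Ψ (x' - Z β) - (D.Ψ (α - β) - D.Ψ (x - Z β))
      - (D.ψ (α - β) * (α' - α) - D.ψ (x - Z β) * (x' - x)))
    (.of_forall fun β => ?_)
  · simpa using this
  · have h1 := D.abs_Ψ_sub_sub_le (α - β) (α' - β)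
    have h2 := D.abs_Ψ_sub_sub_le (x - Z β) (x' - Z β)
    rw [sub_sub_sub_cancel_right] at h1 h2
    rw [mul_add]
    refine le_trans (le_of_eq ?_) ((norm_sub_le
      (D.Ψ (α' - β) - D.Ψ (α - β) - D.ψ (α - β) * (α' - α))
      (D.Ψ (x' - Z β) - D.Ψ (x - Z β) - D.ψ (x - Z β) * (x' - x))).trans (add_le_add h1 h2))
    congr 1
    ring

/-- The quadratic remainder estimate gives joint Fréchet differentiability in the label and the
position. The two strengths are the partial derivatives, and the chain rule along `α ↦ (α, X α)`
finishes. -/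
lemma hasDerivAt_interaction {Z : ℝ → ℝ} (hZ : D.Admissible Z) {X : ℝ → ℝ} {α y : ℝ}
    (hX : HasDerivAt X y α) : HasDerivAt (fun α => D.interaction Z α (X α))
      (D.strength (fun β => β) α - D.strength Z (X α) * y) α := by
  have h : HasFDerivAt (Function.uncurry (D.interaction Z))
      ((ContinuousLinearMap.toSpanSingleton ℝ (D.strength (fun β => β) α)).coprod
        (ContinuousLinearMap.toSpanSingleton ℝ (-D.strength Z (X α)))) (α, X α) := by
    refine .of_isLittleO ?_
    have h2 : (fun p : ℝ × ℝ => p - (α, X α)) =o[𝓝 (α, X α)] fun _ => (1 : ℝ) := by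
      rw [Asymptotics.isLittleO_one_iff]
      exact tendsto_sub_nhds_zero_iff.2 tendsto_id
    have h1 : (fun p : ℝ × ℝ => Function.uncurry (D.interaction Z) p
        - Function.uncurry (D.interaction Z) (α, X α)
        - ((ContinuousLinearMap.toSpanSingleton ℝ (D.strength (fun β => β) α)).coprod
        (ContinuousLinearMap.toSpanSingleton ℝ (-D.strength Z (X α)))) (p - (α, X α)))
        =O[𝓝 (α, X α)] fun p => ‖p - (α, X α)‖ * ‖p - (α, X α)‖ := by
      refine Asymptotics.IsBigO.of_bound (D.L * 2) (.of_forall fun p => ?_)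
      have h3 := abs_interaction_expansion_le hZ α p.1 (X α) p.2
      refine le_trans (le_of_eq ?_) (h3.trans ?_)
      · simp only [Function.uncurry, Real.norm_eq_abs, ContinuousLinearMap.coprod_apply,
          ContinuousLinearMap.toSpanSingleton_apply, Prod.fst_sub, Prod.snd_sub, smul_eq_mul]
        congr 1; ring
      · rw [Real.norm_of_nonneg (by positivity), mul_assoc]
        refine mul_le_mul_of_nonneg_left ?_ D.L.2
        have e1 : |p.1 - α| ≤ ‖p - (α, X α)‖ := norm_fst_le (p - (α, X α))
        have e2 : |p.2 - X α| ≤ ‖p - (α, X α)‖ := norm_snd_le (p - (α, X α))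
        rw [← sq_abs (p.1 - α), ← sq_abs (p.2 - X α)]
        nlinarith [abs_nonneg (p.1 - α), abs_nonneg (p.2 - X α)]
    refine h1.trans_isLittleO ?_
    have h4 := (Asymptotics.isBigO_refl (fun p : ℝ × ℝ => ‖p - (α, X α)‖)
      (𝓝 (α, X α))).mul_isLittleO h2.norm_left
    simp only [mul_one] at h4
    exact h4.of_norm_right
  have h5 := h.comp_hasDerivAt α ((hasDerivAt_id α).prodMk hX)
  refine h5.congr_deriv ?_
  simp; ring

/-! ### The Lagrangian flow -/

variable (D)

/-- The particle configuration with weighted displacement `d`. -/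
def config (d : BoundedContinuousFunction ℝ ℝ) (α : ℝ) : ℝ := α + D.weight α * d α

lemma admissible_config (d : BoundedContinuousFunction ℝ ℝ) : D.Admissible (D.config d) := by
  refine ⟨continuous_id.add (D.continuous_weight.mul d.continuous), ?_⟩
  simp only [config, add_sub_cancel_left]
  exact D.integrable_weight.mul_bdd (c := ‖d‖) d.continuous.aestronglyMeasurable
    (.of_forall d.norm_coe_le_norm)

lemma abs_config_sub_le (d d' : BoundedContinuousFunction ℝ ℝ) (α : ℝ) :
    |D.config d α - D.config d' α| ≤ D.weight α * ‖d - d'‖ := by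
  have h : D.config d α - D.config d' α = D.weight α * (d - d') α := by
    simp [config]; ring
  rw [h, abs_mul, abs_of_pos (D.weight_pos α)]
  exact mul_le_mul_of_nonneg_left ((d - d').norm_coe_le_norm α) (D.weight_pos α).le

lemma integral_abs_config_sub_le (d d' : BoundedContinuousFunction ℝ ℝ) :
    ∫ α, |D.config d α - D.config d' α| ∂D.μ ≤ D.totalWeight * ‖d - d'‖ := by
  rw [totalWeight, ← integral_mul_const]
  exact integral_mono_of_nonneg (.of_forall fun _ => abs_nonneg _)
    (D.integrable_weight.mul_const _) (.of_forall (D.abs_config_sub_le d d'))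

lemma config_zero (α : ℝ) : D.config 0 α = α := by simp [config]

lemma interaction_id (α : ℝ) : D.interaction (D.config 0) α α = 0 := by
  simp [interaction, config_zero]

/-- The velocity of the particle `α` in the configuration with weighted displacement `d`. -/
noncomputable def velocity (d : BoundedContinuousFunction ℝ ℝ) (α : ℝ) : ℝ :=
  D.u₀ α + D.interaction (D.config d) α (D.config d α)

lemma continuous_velocity (d : BoundedContinuousFunction ℝ ℝ) : Continuous (D.velocity d) := by
  refine D.contDiff_u₀.continuous.add ?_
  have h : Continuous (Function.uncurry (D.interaction (D.config d))) := by
    rw [continuous_iff_continuousAt]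
    intro p
    rw [ContinuousAt, tendsto_iff_norm_sub_tendsto_zero]
    refine squeeze_zero (fun _ => norm_nonneg _)
      (fun q => abs_interaction_sub_le' (D.admissible_config d) q.1 p.1 q.2 p.2) ?_
    have : Continuous fun q : ℝ × ℝ => D.M * (|q.1 - p.1| + |q.2 - p.2|) := by fun_prop
    simpa using this.tendsto p
  exact h.comp (continuous_id.prodMk (D.admissible_config d).continuous)

/-- The mean-field term carries the total weight but no pointwise weight. It is absorbed because the
weight is at least `1`, and this makes the field Lipschitz on weighted displacements. -/
lemma abs_velocity_sub_le (d d' : BoundedContinuousFunction ℝ ℝ) (α : ℝ) :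
    |D.velocity d α - D.velocity d' α| ≤ D.weight α * (D.M * (1 + D.totalWeight) * ‖d - d'‖) := by
  have h := abs_interaction_sub_le (D.admissible_config d) (D.admissible_config d') α
    (D.config d α) (D.config d' α)
  have h1 := D.abs_config_sub_le d d' α
  have h2 := D.integral_abs_config_sub_le d d'
  simp only [velocity, add_sub_add_left_eq_sub]
  refine h.trans ?_
  have h3 : D.totalWeight * ‖d - d'‖ ≤ D.weight α * (D.totalWeight * ‖d - d'‖) :=
    le_mul_of_one_le_left (mul_nonneg D.totalWeight_nonneg (norm_nonneg _)) (D.one_le_weight α)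
  calc D.M * (|D.config d α - D.config d' α| + ∫ β, |D.config d β - D.config d' β| ∂D.μ)
      ≤ D.M * (D.weight α * ‖d - d'‖ + D.weight α * (D.totalWeight * ‖d - d'‖)) :=
        mul_le_mul_of_nonneg_left (by linarith) D.M_nonneg
    _ = _ := by ring

lemma abs_velocity_le (d : BoundedContinuousFunction ℝ ℝ) (α : ℝ) :
    |D.velocity d α| ≤ D.weight α * (1 + D.M * (1 + D.totalWeight) * ‖d‖) := by
  have h := D.abs_velocity_sub_le d 0 α
  have h0 : |D.velocity 0 α| ≤ D.weight α := by
    simp only [velocity, config_zero, interaction_id, add_zero, weight]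
    linarith
  rw [sub_zero] at h
  have := abs_add_le (D.velocity d α - D.velocity 0 α) (D.velocity 0 α)
  rw [sub_add_cancel] at this
  linarith

/-- The vector field on weighted displacements. -/
noncomputable def field (d : BoundedContinuousFunction ℝ ℝ) : BoundedContinuousFunction ℝ ℝ :=
  BoundedContinuousFunction.ofNormedAddCommGroup (fun α => (D.weight α)⁻¹ * D.velocity d α)
    ((D.continuous_weight.inv₀ fun α => (D.weight_pos α).ne').mul (D.continuous_velocity d))
    (1 + D.M * (1 + D.totalWeight) * ‖d‖) fun α => by
      rw [norm_mul, norm_inv, Real.norm_of_nonneg (D.weight_pos α).le,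
        inv_mul_le_iff₀ (D.weight_pos α)]
      exact D.abs_velocity_le d α

lemma weight_mul_field (d : BoundedContinuousFunction ℝ ℝ) (α : ℝ) :
    D.weight α * D.field d α = D.velocity d α := by
  change D.weight α * ((D.weight α)⁻¹ * D.velocity d α) = _
  rw [mul_inv_cancel_left₀ (D.weight_pos α).ne']

lemma lipschitz_field :
    LipschitzWith (Real.toNNReal (D.M * (1 + D.totalWeight))) D.field := by
  have hc : 0 ≤ D.M * (1 + D.totalWeight) :=
    mul_nonneg D.M_nonneg (by linarith [D.totalWeight_nonneg])
  refine LipschitzWith.of_dist_le_mul fun d d' => ?_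
  rw [Real.coe_toNNReal _ hc, dist_eq_norm d d',
    BoundedContinuousFunction.dist_le (mul_nonneg hc (norm_nonneg _))]
  intro α
  change |(D.weight α)⁻¹ * D.velocity d α - (D.weight α)⁻¹ * D.velocity d' α| ≤ _
  rw [← mul_sub, abs_mul, abs_inv, abs_of_pos (D.weight_pos α), inv_mul_le_iff₀ (D.weight_pos α)]
  exact D.abs_velocity_sub_le d d' α

/-- The curve is global, through negative times and through collisions of particles. Loss of
regularity shows up only in the invertibility of the flow map. -/
lemma exists_displacement : ∃ γ : ℝ → BoundedContinuousFunction ℝ ℝ,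
    γ 0 = 0 ∧ ∀ t, HasDerivAt γ (D.field (γ t)) t :=
  exists_global_integralCurve (f := fun _ => D.field) (fun _ => D.lipschitz_field)
    (D.lipschitz_field.continuous.comp continuous_snd) (B := ‖D.field 0‖) fun _ => le_rfl

/-- The weighted displacement of the particles. -/
noncomputable def displacement : ℝ → BoundedContinuousFunction ℝ ℝ := D.exists_displacement.choose

lemma displacement_zero : D.displacement 0 = 0 := D.exists_displacement.choose_spec.1

lemma hasDerivAt_displacement (t : ℝ) :
    HasDerivAt D.displacement (D.field (D.displacement t)) t :=
  D.exists_displacement.choose_spec.2 t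

lemma continuous_displacement : Continuous D.displacement :=
  continuous_iff_continuousAt.2 fun t => (D.hasDerivAt_displacement t).continuousAt

/-- The flow map. -/
noncomputable def X (t α : ℝ) : ℝ := D.config (D.displacement t) α

/-- The velocity along the flow. -/
noncomputable def V (t α : ℝ) : ℝ := D.velocity (D.displacement t) α

lemma X_zero (α : ℝ) : D.X 0 α = α := by rw [X, displacement_zero, config_zero]

lemma admissible_X (t : ℝ) : D.Admissible (D.X t) := D.admissible_config _

lemma continuous_X_apply (t : ℝ) : Continuous (D.X t) := (D.admissible_X t).continuous

lemma V_eq (t α : ℝ) : D.V t α = D.u₀ α + D.interaction (D.X t) α (D.X t α) := rfl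

lemma hasDerivAt_X (t α : ℝ) : HasDerivAt (fun t => D.X t α) (D.V t α) t := by
  have h := ((BoundedContinuousFunction.evalCLM ℝ α).hasFDerivAt.comp_hasDerivAt t
    (D.hasDerivAt_displacement t))
  rw [V, ← weight_mul_field]
  exact (h.const_mul (D.weight α)).const_add α

lemma continuous_X : Continuous (Function.uncurry D.X) := by
  have : Continuous fun p : ℝ × ℝ => D.displacement p.1 p.2 :=
    continuous_eval.comp ((D.continuous_displacement.comp continuous_fst).prodMk continuous_snd)
  exact continuous_snd.add ((D.continuous_weight.comp continuous_snd).mul this)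

lemma continuous_V : Continuous (Function.uncurry D.V) := by
  have : Continuous fun p : ℝ × ℝ => D.field (D.displacement p.1) p.2 :=
    continuous_eval.comp (((D.lipschitz_field.continuous.comp D.continuous_displacement).comp
      continuous_fst).prodMk continuous_snd)
  have h2 := (D.continuous_weight.comp continuous_snd).mul this
  refine h2.congr fun p => ?_
  exact D.weight_mul_field _ _

lemma continuous_V_apply (t : ℝ) : Continuous (D.V t) := D.continuous_velocity _

/-- On compact time intervals, displacements and velocities are dominated by the weight. -/
lemma exists_displacement_bound (T : ℝ) : ∃ C : ℝ, 0 ≤ C ∧ ∀ t, |t| ≤ T → ∀ α,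
    |D.X t α - α| ≤ C * D.weight α ∧ |D.V t α| ≤ C * D.weight α := by
  obtain ⟨K, hK⟩ := (isCompact_Icc (a := -T) (b := T)).exists_bound_of_continuousOn
    D.continuous_displacement.continuousOn
  have hM := D.M_nonneg
  have hW := D.totalWeight_nonneg
  refine ⟨|K| + (1 + D.M * (1 + D.totalWeight) * |K|), by positivity, fun t ht α => ?_⟩
  have h1 := (hK t (abs_le.1 ht)).trans (le_abs_self K)
  have h2 := D.abs_config_sub_le (D.displacement t) 0 α
  have h3 := D.abs_velocity_le (D.displacement t) α
  rw [config_zero, sub_zero] at h2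
  have hw := (D.weight_pos α).le
  have h4 : D.M * (1 + D.totalWeight) * ‖D.displacement t‖ ≤ D.M * (1 + D.totalWeight) * |K| :=
    mul_le_mul_of_nonneg_left h1 (by positivity)
  have h5 : 0 ≤ D.M * (1 + D.totalWeight) * |K| := by positivity
  constructor
  · refine h2.trans ?_
    rw [mul_comm]
    exact mul_le_mul_of_nonneg_right (by linarith) hw
  · refine h3.trans ?_
    rw [mul_comm]
    exact mul_le_mul_of_nonneg_right (by linarith [abs_nonneg K]) hw

end InitialData

end EulerAlignment

/-! ### Derivatives of the flow in time and in the label. -/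

namespace EulerAlignment

namespace InitialData

variable {D : InitialData}

lemma Admissible.of_abs_sub_le {Z : ℝ → ℝ} (hZ : Continuous Z) {C : ℝ}
    (h : ∀ β, |Z β - β| ≤ C * D.weight β) : D.Admissible Z :=
  ⟨hZ, (D.integrable_weight.const_mul C).mono' (hZ.sub continuous_id).aestronglyMeasurable
    (.of_forall h)⟩

/-- The time derivative of the interaction along moving particles. -/
lemma hasDerivAt_interaction_time {Z Z' : ℝ → ℝ → ℝ} {t α C : ℝ} {s : Set ℝ} (hs : s ∈ 𝓝 t)
    (hZ : ∀ r ∈ s, D.Admissible (Z r)) (hd : ∀ r ∈ s, ∀ β, HasDerivAt (fun r => Z r β) (Z' r β) r)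
    (hZ' : Continuous (Z' t)) (hC : ∀ r ∈ s, ∀ β, |Z' r β| ≤ C * D.weight β) :
    HasDerivAt (fun r => D.interaction (Z r) α (Z r α))
      (∫ β, D.ψ (Z t α - Z t β) * (Z' t β - Z' t α) ∂D.μ) t := by
  have hψ := D.continuous_ψ
  have ht := mem_of_mem_nhds hs
  have hZt := (hZ t ht).continuous
  refine (hasDerivAt_integral_of_dominated_loc_of_deriv_le (s := s)
    (F := fun r β => D.Ψ (α - β) - D.Ψ (Z r α - Z r β))
    (F' := fun r β => D.ψ (Z r α - Z r β) * (Z' r β - Z' r α))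
    (bound := fun β => D.M * (C * D.weight β + C * D.weight α)) hs ?_
    (integrable_interaction (hZ t ht) α (Z t α)) ?_ ?_ ?_ ?_).2
  · filter_upwards [hs] with r hr using
      (integrable_interaction (hZ r hr) α (Z r α)).aestronglyMeasurable
  · exact Continuous.aestronglyMeasurable (by fun_prop)
  · refine .of_forall fun β r hr => ?_
    rw [norm_mul]
    refine mul_le_mul (D.abs_ψ_le _) ?_ (norm_nonneg _) D.M_nonneg
    exact (norm_sub_le _ _).trans (add_le_add (hC r hr β) (hC r hr α))
  · exact ((D.integrable_weight.const_mul C).add (integrable_const _)).const_mul _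
  · refine .of_forall fun β r hr => ?_
    have h1 := (D.hasDerivAt_Ψ (Z r α - Z r β)).comp r ((hd r hr α).sub (hd r hr β))
    exact (h1.const_sub (D.Ψ (α - β))).congr_deriv (by ring)

variable (D)

/-- The acceleration along the flow. -/
noncomputable def acceleration (t α : ℝ) : ℝ :=
  ∫ β, D.ψ (D.X t α - D.X t β) * (D.V t β - D.V t α) ∂D.μ

/-- Differentiating the first order system in time recovers the alignment force, which is the second
order equation along trajectories. -/
lemma hasDerivAt_V (t α : ℝ) : HasDerivAt (fun t => D.V t α) (D.acceleration t α) t := by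
  obtain ⟨C, -, hC⟩ := D.exists_displacement_bound (|t| + 1)
  have hs : {r : ℝ | |r| ≤ |t| + 1} ∈ 𝓝 t :=
    continuous_abs.continuousAt.preimage_mem_nhds (Iic_mem_nhds (by linarith))
  exact (hasDerivAt_interaction_time (α := α) hs (fun r _ => D.admissible_X r)
    (fun r _ β => D.hasDerivAt_X r β) (D.continuous_V_apply t)
    (fun r hr β => (hC r hr β).2)).const_add (D.u₀ α)

lemma continuous_acceleration : Continuous (Function.uncurry D.acceleration) := by
  rw [continuous_iff_continuousAt]
  intro p
  have hψ := D.continuous_ψ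
  have hX := D.continuous_X
  have hV := D.continuous_V
  obtain ⟨C, hC0, hC⟩ := D.exists_displacement_bound (|p.1| + 1)
  have hs : {q : ℝ × ℝ | |q.1| ≤ |p.1| + 1} ∈ 𝓝 p :=
    (continuous_abs.comp continuous_fst).continuousAt.preimage_mem_nhds
      (Iic_mem_nhds (by simp))
  have hs' : {q : ℝ × ℝ | D.weight q.2 ≤ D.weight p.2 + 1} ∈ 𝓝 p :=
    (D.continuous_weight.comp continuous_snd).continuousAt.preimage_mem_nhds
      (Iic_mem_nhds (by simp))
  refine continuousAt_of_dominated
    (F := fun (q : ℝ × ℝ) β => D.ψ (D.X q.1 q.2 - D.X q.1 β) * (D.V q.1 β - D.V q.1 q.2))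
    (bound := fun β => D.M * (C * D.weight β + C * (D.weight p.2 + 1))) ?_ ?_ ?_ ?_
  · refine .of_forall fun q => Continuous.aestronglyMeasurable ?_
    have h1 := D.continuous_X_apply q.1
    have h2 := D.continuous_V_apply q.1
    fun_prop
  · filter_upwards [hs, hs'] with q hq hq'
    refine .of_forall fun β => ?_
    rw [norm_mul]
    refine mul_le_mul (D.abs_ψ_le _) ?_ (norm_nonneg _) D.M_nonneg
    refine (norm_sub_le _ _).trans (add_le_add (hC _ hq β).2 ((hC _ hq q.2).2.trans ?_))
    exact mul_le_mul_of_nonneg_left hq' hC0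
  · exact ((D.integrable_weight.const_mul C).add (integrable_const _)).const_mul _
  · refine .of_forall fun β => Continuous.continuousAt ?_
    have h1 : Continuous fun q : ℝ × ℝ => D.X q.1 q.2 := hX
    have h2 : Continuous fun q : ℝ × ℝ => D.V q.1 q.2 := hV
    have h3 : Continuous fun q : ℝ × ℝ => D.X q.1 β := hX.comp (continuous_fst.prodMk continuous_const)
    have h4 : Continuous fun q : ℝ × ℝ => D.V q.1 β := hV.comp (continuous_fst.prodMk continuous_const)
    fun_prop

/-- The alignment strength along the flow. -/
noncomputable def a (t α : ℝ) : ℝ := D.strength (D.X t) (D.X t α)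

lemma a_nonneg (t α : ℝ) : 0 ≤ D.a t α := strength_nonneg _ _

lemma a_le (t α : ℝ) : D.a t α ≤ D.M := strength_le _ _

lemma abs_a_le (t α : ℝ) : |D.a t α| ≤ D.M := by
  rw [abs_of_nonneg (D.a_nonneg t α)]; exact D.a_le t α

lemma continuous_a : Continuous (Function.uncurry D.a) := by
  have hψ := D.continuous_ψ
  refine continuous_of_dominated (F := fun (q : ℝ × ℝ) β => D.ψ (D.X q.1 q.2 - D.X q.1 β))
    (bound := fun _ => D.M) ?_ ?_ (integrable_const _) ?_
  · refine fun q => Continuous.aestronglyMeasurable ?_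
    have h1 := D.continuous_X_apply q.1
    fun_prop
  · exact fun q => .of_forall fun β => D.abs_ψ_le _
  · refine .of_forall fun β => ?_
    have h1 : Continuous fun q : ℝ × ℝ => D.X q.1 q.2 := D.continuous_X
    have h3 : Continuous fun q : ℝ × ℝ => D.X q.1 β :=
      D.continuous_X.comp (continuous_fst.prodMk continuous_const)
    fun_prop

/-- The threshold quantity `∂ₓu₀ + ψ ⋆ ρ₀`. -/
noncomputable def e₀ (α : ℝ) : ℝ := deriv D.u₀ α + D.strength (fun β => β) α

lemma abs_e₀_le (α : ℝ) : |D.e₀ α| ≤ D.B + D.M := by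
  refine (abs_add_le _ _).trans (add_le_add (D.abs_deriv_u₀_le α) ?_)
  rw [abs_of_nonneg (strength_nonneg _ _)]
  exact strength_le _ _

lemma hasDerivAt_u₀ (α : ℝ) : HasDerivAt D.u₀ (deriv D.u₀ α) α :=
  (D.contDiff_u₀.differentiable two_ne_zero α).hasDerivAt

lemma a_zero (α : ℝ) : D.a 0 α = D.strength (fun β => β) α := by
  rw [a, funext D.X_zero]

lemma continuous_deriv_u₀ : Continuous (deriv D.u₀) :=
  D.contDiff_u₀.continuous_deriv (by norm_num)

lemma continuous_e₀ : Continuous D.e₀ := by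
  refine D.continuous_deriv_u₀.add ?_
  have := D.continuous_a.comp (continuous_const (y := (0 : ℝ)).prodMk continuous_id)
  exact this.congr fun α => D.a_zero α

/-- The accumulated alignment strength. -/
noncomputable def A (t α : ℝ) : ℝ := ∫ s in (0 : ℝ)..t, D.a s α

/-- The accumulated growth factor. -/
noncomputable def growth (t α : ℝ) : ℝ := ∫ s in (0 : ℝ)..t, Real.exp (D.A s α)

/-- The derivative of the flow map. -/
noncomputable def Y (t α : ℝ) : ℝ := Real.exp (-D.A t α) * (1 + D.e₀ α * D.growth t α)

lemma continuous_A : Continuous (Function.uncurry D.A) := by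
  have h : Continuous (Function.uncurry fun (α : ℝ) (s : ℝ) => D.a s α) :=
    D.continuous_a.comp continuous_swap
  exact (intervalIntegral.continuous_parametric_primitive_of_continuous (μ := volume) (a₀ := 0)
    h).comp continuous_swap

lemma continuous_growth : Continuous (Function.uncurry D.growth) := by
  have h : Continuous (Function.uncurry fun (α : ℝ) (s : ℝ) => Real.exp (D.A s α)) :=
    Real.continuous_exp.comp (D.continuous_A.comp continuous_swap)
  exact (intervalIntegral.continuous_parametric_primitive_of_continuous (μ := volume) (a₀ := 0)
    h).comp continuous_swap

lemma continuous_Y : Continuous (Function.uncurry D.Y) :=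
  (Real.continuous_exp.comp D.continuous_A.neg).mul
    (continuous_const.add ((D.continuous_e₀.comp continuous_snd).mul D.continuous_growth))

lemma hasDerivAt_A (t α : ℝ) : HasDerivAt (fun t => D.A t α) (D.a t α) t := by
  have h : Continuous fun s => D.a s α :=
    D.continuous_a.comp (continuous_id.prodMk continuous_const)
  exact intervalIntegral.integral_hasDerivAt_right (h.intervalIntegrable _ _)
    (h.stronglyMeasurableAtFilter _ _) h.continuousAt

lemma hasDerivAt_growth (t α : ℝ) :
    HasDerivAt (fun t => D.growth t α) (Real.exp (D.A t α)) t := by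
  have h : Continuous fun s => Real.exp (D.A s α) :=
    Real.continuous_exp.comp (D.continuous_A.comp (continuous_id.prodMk continuous_const))
  exact intervalIntegral.integral_hasDerivAt_right (h.intervalIntegrable _ _)
    (h.stronglyMeasurableAtFilter _ _) h.continuousAt

/-- `Y` was defined by variation of constants. This is the linear equation that it solves. -/
lemma hasDerivAt_Y (t α : ℝ) :
    HasDerivAt (fun t => D.Y t α) (D.e₀ α - D.a t α * D.Y t α) t := by
  have h := (D.hasDerivAt_A t α).fun_neg.exp.mul
    (((D.hasDerivAt_growth t α).const_mul (D.e₀ α)).const_add 1)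
  refine h.congr_deriv ?_
  have h2 : Real.exp (-D.A t α) * Real.exp (D.A t α) = 1 := by rw [← Real.exp_add]; simp
  rw [Y]
  linear_combination D.e₀ α * h2

lemma Y_zero (α : ℝ) : D.Y 0 α = 1 := by simp [Y, A, growth]

/-- The Lipschitz constant of the flow map up to time `T`. -/
noncomputable def flowBound (T : ℝ) : ℝ := (1 + (D.B + D.M) * T) * Real.exp (D.M * T)

lemma flowBound_nonneg {T : ℝ} (hT : 0 ≤ T) : 0 ≤ D.flowBound T := by
  have := D.B_nonneg; have := D.M_nonneg; unfold flowBound; positivity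

lemma abs_u₀_sub_le (α α' : ℝ) : |D.u₀ α' - D.u₀ α| ≤ D.B * |α' - α| :=
  Convex.norm_image_sub_le_of_norm_deriv_le (f := D.u₀) (s := univ)
    (fun x _ => D.contDiff_u₀.differentiable two_ne_zero x) (fun x _ => D.abs_deriv_u₀_le x)
    convex_univ (mem_univ _) (mem_univ _)

lemma flowBound_mono {S T : ℝ} (hS : 0 ≤ S) (h : S ≤ T) : D.flowBound S ≤ D.flowBound T := by
  have := D.B_nonneg; have := D.M_nonneg; have := hS.trans h
  unfold flowBound; gcongr

lemma abs_X_sub_le {t T : ℝ} (ht : |t| ≤ T) (α α' : ℝ) :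
    |D.X t α' - D.X t α| ≤ D.flowBound T * |α' - α| := by
  have hB := D.B_nonneg
  have hM := D.M_nonneg
  have h := norm_le_exp_of_norm_deriv_le (s := 0) (t := t) hM
    (ε := (D.B + D.M) * |α' - α|) (by positivity)
    (fun r _ => (D.hasDerivAt_X r α').sub (D.hasDerivAt_X r α)) (fun r _ => by
      have h1 := abs_interaction_sub_le' (D.admissible_X r) α' α (D.X r α') (D.X r α)
      have h2 := D.abs_u₀_sub_le α α'
      rw [V_eq, V_eq, add_sub_add_comm]
      refine (norm_add_le _ _).trans ((add_le_add h2 h1).trans (le_of_eq ?_))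
      simp only [Pi.sub_apply, Real.norm_eq_abs]; ring)
  simp only [Pi.sub_apply, X_zero, sub_zero, Real.norm_eq_abs] at h
  refine h.trans ?_
  refine le_trans (le_of_eq ?_) (mul_le_mul_of_nonneg_right
    (D.flowBound_mono (abs_nonneg t) ht) (abs_nonneg _))
  unfold flowBound
  ring

/-- The candidate derivative is already known explicitly, so it suffices to apply Gronwall in time
to the remainder `X(α') - X(α) - (α' - α) Y(α)`. It vanishes at time `0` and solves a linear
equation with damping `a`, whose source is the Taylor error of `u₀` plus a term quadratic in `α' -
α`. -/
lemma hasDerivAt_X_space (t α : ℝ) : HasDerivAt (D.X t) (D.Y t α) α := by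
  have hM := D.M_nonneg
  have hL := D.L.2
  set T := |t| with hT
  set C := D.flowBound T with hC
  have key : ∀ α', |D.X t α' - D.X t α - (α' - α) * D.Y t α| ≤
      ((|D.u₀ α' - D.u₀ α - (α' - α) * deriv D.u₀ α| + D.L * (1 + C ^ 2) * (α' - α) ^ 2) * T)
        * Real.exp (D.M * T) := by
    intro α'
    have h := norm_le_exp_of_norm_deriv_le (s := 0) (t := t) hM
      (ε := |D.u₀ α' - D.u₀ α - (α' - α) * deriv D.u₀ α| + D.L * (1 + C ^ 2) * (α' - α) ^ 2)
      (by positivity)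
      (fun r _ => ((D.hasDerivAt_X r α').fun_sub (D.hasDerivAt_X r α)).fun_sub
        ((D.hasDerivAt_Y r α).const_mul (α' - α))) (fun r hr => by
        have hr' : |r| ≤ T := by
          rcases le_total 0 t with h0 | h0
          · rw [uIcc_of_le h0] at hr
            rw [hT, abs_of_nonneg h0, abs_of_nonneg hr.1]; exact hr.2
          · rw [uIcc_of_ge h0] at hr
            rw [hT, abs_of_nonpos h0, abs_of_nonpos hr.2]; linarith [hr.1]
        have h1 := abs_interaction_expansion_le (D.admissible_X r) α α' (D.X r α) (D.X r α')
        have h2 := D.abs_X_sub_le hr' α α'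
        have h3 : (D.X r α' - D.X r α) ^ 2 ≤ C ^ 2 * (α' - α) ^ 2 := by
          rw [← sq_abs, ← sq_abs (α' - α), ← mul_pow]
          exact pow_le_pow_left₀ (abs_nonneg _) h2 2
        set R := D.X r α' - D.X r α - (α' - α) * D.Y r α with hR
        have h4 : |D.a r α * R| ≤ D.M * |R| := by
          rw [abs_mul]; exact mul_le_mul_of_nonneg_right (D.abs_a_le r α) (abs_nonneg _)
        have h5 : D.V r α' - D.V r α - (α' - α) * (D.e₀ α - D.a r α * D.Y r α)
            = (D.u₀ α' - D.u₀ α - (α' - α) * deriv D.u₀ α)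
              + (D.interaction (D.X r) α' (D.X r α') - D.interaction (D.X r) α (D.X r α)
                - (D.strength (fun β => β) α * (α' - α)
                  - D.strength (D.X r) (D.X r α) * (D.X r α' - D.X r α))) - D.a r α * R := by
          rw [V_eq, V_eq, e₀, hR, a]; ring
        rw [h5, Real.norm_eq_abs, Real.norm_eq_abs]
        have h6 := abs_sub ((D.u₀ α' - D.u₀ α - (α' - α) * deriv D.u₀ α)
              + (D.interaction (D.X r) α' (D.X r α') - D.interaction (D.X r) α (D.X r α)
                - (D.strength (fun β => β) α * (α' - α)
                  - D.strength (D.X r) (D.X r α) * (D.X r α' - D.X r α)))) (D.a r α * R)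
        have h7 := abs_add_le (D.u₀ α' - D.u₀ α - (α' - α) * deriv D.u₀ α)
              (D.interaction (D.X r) α' (D.X r α') - D.interaction (D.X r) α (D.X r α)
                - (D.strength (fun β => β) α * (α' - α)
                  - D.strength (D.X r) (D.X r α) * (D.X r α' - D.X r α)))
        nlinarith [mul_le_mul_of_nonneg_left h3 hL])
    simpa [X_zero, Y_zero] using h
  rw [hasDerivAt_iff_isLittleO]
  have o1 : (fun α' => D.u₀ α' - D.u₀ α - (α' - α) * deriv D.u₀ α) =o[𝓝 α] fun α' => α' - α :=
    hasDerivAt_iff_isLittleO.1 (D.hasDerivAt_u₀ α)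
  have o2 : (fun α' : ℝ => (α' - α) ^ 2) =o[𝓝 α] fun α' => α' - α := by
    have h1 : (fun α' : ℝ => α' - α) =o[𝓝 α] fun _ => (1 : ℝ) := by
      rw [Asymptotics.isLittleO_one_iff]
      exact tendsto_sub_nhds_zero_iff.2 tendsto_id
    simpa [sq] using (Asymptotics.isBigO_refl (fun α' : ℝ => α' - α) (𝓝 α)).mul_isLittleO h1
  have o3 : (fun α' => ((|D.u₀ α' - D.u₀ α - (α' - α) * deriv D.u₀ α|
      + D.L * (1 + C ^ 2) * (α' - α) ^ 2) * T) * Real.exp (D.M * T)) =o[𝓝 α] fun α' => α' - α := by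
    have := ((o1.norm_left.add (o2.const_mul_left (D.L * (1 + C ^ 2)))).const_mul_left
      (T * Real.exp (D.M * T)))
    refine this.congr_left fun α' => ?_
    simp only [Real.norm_eq_abs]; ring
  refine Asymptotics.IsBigO.trans_isLittleO (.of_bound 1 (.of_forall fun α' => ?_)) o3
  rw [one_mul, smul_eq_mul, Real.norm_eq_abs]
  exact (key α').trans (le_abs_self _)

/-- The value equals the time derivative of `Y`, as equality of mixed derivatives of `X` demands. -/
lemma hasDerivAt_V_space (t α : ℝ) :
    HasDerivAt (D.V t) (D.e₀ α - D.a t α * D.Y t α) α := by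
  have h := (D.hasDerivAt_u₀ α).add
    (hasDerivAt_interaction (D.admissible_X t) (D.hasDerivAt_X_space t α))
  refine h.congr_deriv ?_
  rw [e₀, a]; ring

lemma abs_Y_le {t T : ℝ} (ht : |t| ≤ T) (α : ℝ) : |D.Y t α| ≤ D.flowBound T := by
  have hT : 0 ≤ T := (abs_nonneg t).trans ht
  exact (D.hasDerivAt_X_space t α).le_of_lip' (D.flowBound_nonneg hT)
    (.of_forall fun α' => D.abs_X_sub_le ht α α')

lemma contDiff_X : ContDiff ℝ 1 (Function.uncurry D.X) := by
  rw [← contDiffOn_univ]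
  exact contDiffOn_of_partials isOpen_univ (fun p _ => D.hasDerivAt_X p.1 p.2)
    (fun p _ => D.hasDerivAt_X_space p.1 p.2) D.continuous_V.continuousOn D.continuous_Y.continuousOn

lemma contDiff_V : ContDiff ℝ 1 (Function.uncurry D.V) := by
  rw [← contDiffOn_univ]
  exact contDiffOn_of_partials (f₂ := fun t α => D.e₀ α - D.a t α * D.Y t α) isOpen_univ
    (fun p _ => D.hasDerivAt_V p.1 p.2)
    (fun p _ => D.hasDerivAt_V_space p.1 p.2) D.continuous_acceleration.continuousOn
    (((D.continuous_e₀.comp continuous_snd).sub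
      (D.continuous_a.mul D.continuous_Y)).continuousOn)

/-- The Lipschitz constant in time of the derivative of the flow map up to time `T`. -/
noncomputable def rateBound (T : ℝ) : ℝ := D.B + D.M + D.M * D.flowBound T

lemma abs_rate_le {t T : ℝ} (ht : |t| ≤ T) (α : ℝ) :
    |D.e₀ α - D.a t α * D.Y t α| ≤ D.rateBound T := by
  refine (abs_sub _ _).trans (add_le_add (D.abs_e₀_le α) ?_)
  rw [abs_mul]
  exact mul_le_mul (D.abs_a_le _ _) (D.abs_Y_le ht α) (abs_nonneg _) D.M_nonneg

lemma rateBound_nonneg {T : ℝ} (hT : 0 ≤ T) : 0 ≤ D.rateBound T :=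
  (abs_nonneg _).trans (D.abs_rate_le (t := 0) (by simpa using hT) 0)

/-- The uniformity in the label is the point: a uniform lower bound on `Y` survives a short time
step. -/
lemma abs_Y_sub_le {s t T : ℝ} (hs : |s| ≤ T) (ht : |t| ≤ T) (α : ℝ) :
    |D.Y t α - D.Y s α| ≤ D.rateBound T * |t - s| :=
  Convex.norm_image_sub_le_of_norm_hasDerivWithin_le (s := Icc (-T) T)
    (f := fun t => D.Y t α) (fun r _ => (D.hasDerivAt_Y r α).hasDerivWithinAt)
    (fun _ hr => D.abs_rate_le (abs_le.2 hr) α) (convex_Icc _ _) (abs_le.1 hs) (abs_le.1 ht)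

lemma A_nonneg {t : ℝ} (ht : 0 ≤ t) (α : ℝ) : 0 ≤ D.A t α :=
  intervalIntegral.integral_nonneg ht fun s _ => D.a_nonneg s α

lemma A_le {t : ℝ} (ht : 0 ≤ t) (α : ℝ) : D.A t α ≤ D.M * t := by
  have := intervalIntegral.norm_integral_le_of_norm_le_const (a := 0) (b := t) (C := D.M)
    (f := fun s => D.a s α) fun s _ => D.abs_a_le s α
  rw [sub_zero, abs_of_nonneg ht] at this
  exact (le_abs_self _).trans this

lemma le_growth {t : ℝ} (ht : 0 ≤ t) (α : ℝ) : t ≤ D.growth t α := by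
  have h : Continuous fun s => Real.exp (D.A s α) :=
    Real.continuous_exp.comp (D.continuous_A.comp (continuous_id.prodMk continuous_const))
  have := intervalIntegral.integral_mono_on ht (intervalIntegrable_const (c := (1 : ℝ)))
    (h.intervalIntegrable 0 t) (μ := volume) fun s hs => Real.one_le_exp (D.A_nonneg hs.1 α)
  simpa [growth] using this

lemma growth_le {t : ℝ} (ht : 0 ≤ t) (α : ℝ) : D.growth t α ≤ Real.exp (D.M * t) * t := by
  have := intervalIntegral.norm_integral_le_of_norm_le_const (a := 0) (b := t)
    (C := Real.exp (D.M * t)) (f := fun s => Real.exp (D.A s α)) fun s hs => by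
      rw [uIoc_of_le ht] at hs
      rw [Real.norm_of_nonneg (Real.exp_pos _).le, Real.exp_le_exp]
      exact (D.A_le hs.1.le α).trans (mul_le_mul_of_nonneg_left hs.2 D.M_nonneg)
  rw [sub_zero, abs_of_nonneg ht] at this
  exact (le_abs_self _).trans this

end InitialData

end EulerAlignment

/-! ### Inversion of the flow map and Eulerian unknowns. -/

namespace EulerAlignment

namespace InitialData

variable (D : InitialData)

/-- A time interval around `0` on which the flow map is uniformly expanding by at least `c`. -/
structure Regular (p q c : ℝ) : Prop where
  neg : p < 0
  pos : 0 < q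
  c_pos : 0 < c
  le_Y : ∀ t ∈ Icc p q, ∀ α, c ≤ D.Y t α

/-- The initial position of the particle which is at `x` at time `t`. -/
noncomputable def label (t x : ℝ) : ℝ := Function.invFun (D.X t) x

/-- The Eulerian density. -/
noncomputable def ρ (t x : ℝ) : ℝ := D.ρ₀ (D.label t x) / D.Y t (D.label t x)

/-- The Eulerian velocity. -/
noncomputable def u (t x : ℝ) : ℝ := D.V t (D.label t x)

/-- The derivative `ψ' ⋆ ρ` of the alignment strength. -/
noncomputable def κ (t x : ℝ) : ℝ := ∫ y, deriv D.ψ (x - y) * D.ρ t y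

/-- The derivative of `a` with respect to the label. -/
noncomputable def a' (t α : ℝ) : ℝ := D.κ t (D.X t α) * D.Y t α

variable {D} {p q c : ℝ}

namespace Regular

variable (h : D.Regular p q c)

include h

lemma zero_mem : (0 : ℝ) ∈ Icc p q := ⟨h.neg.le, h.pos.le⟩

lemma Y_pos {t : ℝ} (ht : t ∈ Icc p q) (α : ℝ) : 0 < D.Y t α := h.c_pos.trans_le (h.le_Y t ht α)

lemma mul_sub_le {t : ℝ} (ht : t ∈ Icc p q) (α β : ℝ) (hαβ : α ≤ β) :
    c * (β - α) ≤ D.X t β - D.X t α := by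
  refine convex_univ.mul_sub_le_image_sub_of_le_deriv (D.continuous_X_apply t).continuousOn
    (fun x _ => (D.hasDerivAt_X_space t x).differentiableAt.differentiableWithinAt)
    (fun x _ => ?_) α (mem_univ _) β (mem_univ _) hαβ
  rw [(D.hasDerivAt_X_space t x).deriv]
  exact h.le_Y t ht x

lemma strictMono {t : ℝ} (ht : t ∈ Icc p q) : StrictMono (D.X t) :=
  (strictMono_surjective_of_le_sub h.c_pos (D.continuous_X_apply t) (h.mul_sub_le ht)).1

lemma surjective {t : ℝ} (ht : t ∈ Icc p q) : Function.Surjective (D.X t) :=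
  (strictMono_surjective_of_le_sub h.c_pos (D.continuous_X_apply t) (h.mul_sub_le ht)).2

lemma X_label {t : ℝ} (ht : t ∈ Icc p q) (x : ℝ) : D.X t (D.label t x) = x :=
  Function.invFun_eq (h.surjective ht x)

lemma label_X {t : ℝ} (ht : t ∈ Icc p q) (α : ℝ) : D.label t (D.X t α) = α :=
  Function.leftInverse_invFun (h.strictMono ht).injective α

lemma abs_sub_le {t : ℝ} (ht : t ∈ Icc p q) (α β : ℝ) :
    c * |α - β| ≤ |D.X t α - D.X t β| := by
  rcases le_total α β with h1 | h1
  · rw [abs_sub_comm, abs_sub_comm (D.X t α), abs_of_nonneg (by linarith)]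
    exact (h.mul_sub_le ht α β h1).trans (le_abs_self _)
  · rw [abs_of_nonneg (by linarith)]
    exact (h.mul_sub_le ht β α h1).trans (le_abs_self _)

lemma abs_label_sub_le {t : ℝ} (ht : t ∈ Icc p q) (x α : ℝ) :
    c * |D.label t x - α| ≤ |x - D.X t α| := by
  simpa only [h.X_label ht] using h.abs_sub_le ht (D.label t x) α

/-- Expansion bounds the change of label by `|x - X t α₀| / c`, with `α₀` the label at the base
point. This bound is continuous in `(t, x)` and vanishes there. -/
lemma continuousOn_label : ContinuousOn (Function.uncurry D.label) (Icc p q ×ˢ univ) := by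
  rintro ⟨t₀, x₀⟩ ⟨ht₀, -⟩
  rw [ContinuousWithinAt, tendsto_iff_norm_sub_tendsto_zero]
  refine squeeze_zero' (g := fun z : ℝ × ℝ => c⁻¹ * |z.2 - D.X z.1 (D.label t₀ x₀)|)
    (.of_forall fun _ => norm_nonneg _) ?_ ?_
  · filter_upwards [self_mem_nhdsWithin] with z hz
    rw [← div_eq_inv_mul, le_div_iff₀ h.c_pos, mul_comm]
    exact h.abs_label_sub_le hz.1 z.2 _
  · have h1 : Continuous fun z : ℝ × ℝ => c⁻¹ * |z.2 - D.X z.1 (D.label t₀ x₀)| := by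
      have : Continuous fun z : ℝ × ℝ => D.X z.1 (D.label t₀ x₀) :=
        D.continuous_X.comp (continuous_fst.prodMk continuous_const)
      fun_prop
    have h2 := h1.tendsto (t₀, x₀)
    simp only [h.X_label ht₀, sub_self, abs_zero, mul_zero] at h2
    exact h2.mono_left nhdsWithin_le_nhds

lemma ρ_X {t : ℝ} (ht : t ∈ Icc p q) (α : ℝ) : D.ρ t (D.X t α) = D.ρ₀ α / D.Y t α := by
  rw [ρ, h.label_X ht]

lemma u_X {t : ℝ} (ht : t ∈ Icc p q) (α : ℝ) : D.u t (D.X t α) = D.V t α := by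
  rw [u, h.label_X ht]

lemma ρ_nonneg {t : ℝ} (ht : t ∈ Icc p q) (x : ℝ) : 0 ≤ D.ρ t x :=
  div_nonneg (D.ρ₀_nonneg _) (h.Y_pos ht _).le

lemma continuousOn_comp_label {f : ℝ → ℝ → ℝ}
    (hf : ContinuousOn (Function.uncurry f) (Icc p q ×ˢ univ)) :
    ContinuousOn (fun z : ℝ × ℝ => f z.1 (D.label z.1 z.2)) (Icc p q ×ˢ univ) :=
  hf.comp (f := fun z : ℝ × ℝ => (z.1, D.label z.1 z.2))
    (continuousOn_fst.prodMk h.continuousOn_label) fun _ hz => ⟨hz.1, mem_univ _⟩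

lemma continuousOn_ρ : ContinuousOn (Function.uncurry D.ρ) (Icc p q ×ˢ univ) := by
  refine h.continuousOn_comp_label (f := fun t α => D.ρ₀ α / D.Y t α) ?_
  exact (D.contDiff_ρ₀.continuous.comp continuous_snd).continuousOn.div
    D.continuous_Y.continuousOn fun z hz => (h.Y_pos hz.1 _).ne'

/-- The Jacobian `Y` cancels the denominator of `ρ = ρ₀ / Y`: the measure `ρ dx` is the image of `μ`
under the flow map. -/
lemma integral_mul_ρ {t : ℝ} (ht : t ∈ Icc p q) (f : ℝ → ℝ) :
    ∫ y, f y * D.ρ t y = ∫ β, f (D.X t β) ∂D.μ := by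
  have h1 := integral_image_eq_integral_abs_deriv_smul MeasurableSet.univ
    (fun x _ => (D.hasDerivAt_X_space t x).hasDerivWithinAt) (h.strictMono ht).injective.injOn
    (fun y => f y * D.ρ t y)
  rw [image_univ, (h.surjective ht).range_eq, setIntegral_univ, setIntegral_univ] at h1
  rw [h1, integral_μ]
  refine integral_congr_ae (.of_forall fun α => ?_)
  have h2 := h.Y_pos ht α
  simp only [h.ρ_X ht, abs_of_pos h2, smul_eq_mul]
  field_simp

lemma integrable_mul_ρ_iff {t : ℝ} (ht : t ∈ Icc p q) (f : ℝ → ℝ) :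
    Integrable (fun y => f y * D.ρ t y) ↔ Integrable (fun β => f (D.X t β)) D.μ := by
  have h1 := integrableOn_image_iff_integrableOn_abs_deriv_smul MeasurableSet.univ
    (fun x _ => (D.hasDerivAt_X_space t x).hasDerivWithinAt) (h.strictMono ht).injective.injOn
    (fun y => f y * D.ρ t y)
  rw [image_univ, (h.surjective ht).range_eq, integrableOn_univ, integrableOn_univ] at h1
  rw [h1, integrable_μ_iff]
  refine integrable_congr (.of_forall fun α => ?_)
  have h2 := h.Y_pos ht α
  simp only [h.ρ_X ht, abs_of_pos h2, smul_eq_mul]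
  field_simp

lemma integrable_ρ {t : ℝ} (ht : t ∈ Icc p q) : Integrable (D.ρ t) := by
  have := (h.integrable_mul_ρ_iff ht fun _ => 1).2 (integrable_const _)
  simpa using this

lemma integral_ρ {t : ℝ} (ht : t ∈ Icc p q) : ∫ x, D.ρ t x = 1 := by
  have := h.integral_mul_ρ ht fun _ => 1
  simpa using this

/-! ### Spatial regularity -/

lemma strength_eq {t : ℝ} (ht : t ∈ Icc p q) (x : ℝ) :
    D.strength (D.X t) x = ∫ y, D.ψ (x - y) * D.ρ t y :=
  (h.integral_mul_ρ ht fun y => D.ψ (x - y)).symm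

/-- `ψ` is only Lipschitz, but for fixed `x` it is differentiable at `x - y` for almost every `y`.
The bound `L ρ` on the difference quotients then permits differentiation under the integral. -/
lemma hasDerivAt_strength {t : ℝ} (ht : t ∈ Icc p q) (x : ℝ) :
    HasDerivAt (D.strength (D.X t)) (D.κ t x) x := by
  have hψ := D.continuous_ψ
  have hρ : Continuous (D.ρ t) := continuousOn_univ.1
    (h.continuousOn_ρ.comp (f := fun x => (t, x)) (by fun_prop) fun x _ => ⟨ht, mem_univ _⟩)
  have hi := h.integrable_ρ ht
  rw [funext (h.strength_eq ht)]
  refine (hasDerivAt_integral_of_dominated_loc_of_lip (s := univ)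
    (F := fun x y => D.ψ (x - y) * D.ρ t y) (F' := fun y => deriv D.ψ (x - y) * D.ρ t y)
    (bound := fun y => D.L * D.ρ t y) univ_mem ?_ ?_ ?_ ?_ (hi.const_mul _) ?_).2
  · exact .of_forall fun x => Continuous.aestronglyMeasurable (by fun_prop)
  · exact (h.integrable_mul_ρ_iff ht fun y => D.ψ (x - y)).2
      (integrable_strength (D.continuous_X_apply t) x)
  · exact (((measurable_deriv D.ψ).comp (measurable_const.sub measurable_id)).mul
      hρ.measurable).aestronglyMeasurable
  · refine .of_forall fun y => (LipschitzWith.of_dist_le_mul fun x x' => ?_).lipschitzOnWith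
    have h1 := D.abs_ψ_sub_le (x - y) (x' - y)
    rw [sub_sub_sub_cancel_right] at h1
    rw [Real.coe_nnabs, abs_of_nonneg (mul_nonneg D.L.coe_nonneg (h.ρ_nonneg ht y)), Real.dist_eq,
      Real.dist_eq, ← sub_mul, abs_mul, abs_of_nonneg (h.ρ_nonneg ht y)]
    calc |D.ψ (x - y) - D.ψ (x' - y)| * D.ρ t y ≤ D.L * |x - x'| * D.ρ t y :=
          mul_le_mul_of_nonneg_right h1 (h.ρ_nonneg ht y)
      _ = _ := by ring
  · have h1 : ∀ᵐ y : ℝ, DifferentiableAt ℝ D.ψ (x - y) :=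
      (quasiMeasurePreserving_sub_left_of_right_invariant volume x).ae
        D.lipschitz.ae_differentiableAt_real
    filter_upwards [h1] with y hy
    have h2 := (hy.hasDerivAt.comp x ((hasDerivAt_id x).sub_const y)).mul_const (D.ρ t y)
    exact h2.congr_deriv (by simp)

/-- The kernel `ψ'` is only bounded and measurable, so continuity comes from the `L¹` continuity of
translated densities given by Scheffé's lemma. -/
lemma continuousOn_κ : ContinuousOn (Function.uncurry D.κ) (Icc p q ×ˢ univ) :=
  continuousOn_convolution_density (measurable_deriv D.ψ)
    (fun _ => norm_deriv_le_of_lipschitz D.lipschitz) h.continuousOn_ρ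
    (fun _ ht => h.ρ_nonneg ht) (fun _ ht => h.integrable_ρ ht) fun _ ht => h.integral_ρ ht

lemma hasDerivAt_a {t : ℝ} (ht : t ∈ Icc p q) (α : ℝ) : HasDerivAt (D.a t) (D.a' t α) α :=
  (h.hasDerivAt_strength ht (D.X t α)).comp α (D.hasDerivAt_X_space t α)

lemma continuousOn_a' : ContinuousOn (Function.uncurry D.a') (Icc p q ×ˢ univ) := by
  refine ContinuousOn.mul ?_ D.continuous_Y.continuousOn
  exact h.continuousOn_κ.comp (f := fun z : ℝ × ℝ => (z.1, D.X z.1 z.2))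
    (continuous_fst.prodMk D.continuous_X).continuousOn fun z hz => ⟨hz.1, mem_univ _⟩

lemma uIcc_zero_subset {t : ℝ} (ht : t ∈ Icc p q) : uIcc 0 t ⊆ Icc p q :=
  uIcc_subset_Icc h.zero_mem ht

lemma hasDerivAt_primitive {f f' : ℝ → ℝ → ℝ} (hf : Continuous (Function.uncurry f))
    (hf' : ContinuousOn (Function.uncurry f') (Icc p q ×ˢ univ))
    (hd : ∀ t ∈ Icc p q, ∀ α, HasDerivAt (f t) (f' t α) α) {t : ℝ} (ht : t ∈ Icc p q) (α : ℝ) :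
    HasDerivAt (fun α => ∫ s in (0 : ℝ)..t, f s α) (∫ s in (0 : ℝ)..t, f' s α) α := by
  refine hasDerivAt_intervalIntegral_param (f := fun α s => f s α) (f' := fun α s => f' s α)
    isOpen_univ ?_ ?_ (fun α _ s hs => hd s (h.uIcc_zero_subset ht hs) α) (mem_univ _)
  · exact (hf.comp continuous_swap).continuousOn
  · exact hf'.comp continuous_swap.continuousOn fun z hz =>
      ⟨h.uIcc_zero_subset ht hz.2, mem_univ _⟩

lemma hasDerivAt_e₀ (α : ℝ) : HasDerivAt D.e₀ (deriv (deriv D.u₀) α + D.a' 0 α) α := by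
  have h1 : HasDerivAt (deriv D.u₀) (deriv (deriv D.u₀) α) α := by
    have h2 : ContDiff ℝ 1 (deriv D.u₀) :=
      ((contDiff_succ_iff_deriv (n := 1)).1 (by simpa [one_add_one_eq_two] using D.contDiff_u₀)).2.2
    exact (h2.differentiable one_ne_zero α).hasDerivAt
  have h2 := h.hasDerivAt_a h.zero_mem α
  rw [funext D.a_zero] at h2
  exact h1.add h2

/-- A `C¹` density `ρ₀ / Y` requires a label derivative of `Y`, hence one of `e₀` and one of `a`.
The first uses `u₀ ∈ C²`, and both use the convolution `ψ' ⋆ ρ`. -/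
lemma contDiffOn_Y : ContDiffOn ℝ 1 (Function.uncurry D.Y) (Ioo p q ×ˢ univ) := by
  have hsub : Ioo p q ×ˢ (univ : Set ℝ) ⊆ Icc p q ×ˢ univ := prod_mono_left Ioo_subset_Icc_self
  have ca : ContinuousOn (fun z : ℝ × ℝ => ∫ s in (0 : ℝ)..z.1, D.a' s z.2) (Icc p q ×ˢ univ) :=
    continuousOn_primitive_param h.continuousOn_a' h.zero_mem
  have dA : ∀ t ∈ Icc p q, ∀ α, HasDerivAt (D.A t) (∫ s in (0 : ℝ)..t, D.a' s α) α :=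
    fun t ht α => h.hasDerivAt_primitive D.continuous_a h.continuousOn_a'
      (fun t ht α => h.hasDerivAt_a ht α) ht α
  have cg' : ContinuousOn (Function.uncurry fun t α =>
      Real.exp (D.A t α) * ∫ s in (0 : ℝ)..t, D.a' s α) (Icc p q ×ˢ univ) :=
    (Real.continuous_exp.comp D.continuous_A).continuousOn.mul ca
  have cg : ContinuousOn (fun z : ℝ × ℝ => ∫ s in (0 : ℝ)..z.1,
      Real.exp (D.A s z.2) * ∫ r in (0 : ℝ)..s, D.a' r z.2) (Icc p q ×ˢ univ) :=
    continuousOn_primitive_param cg' h.zero_mem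
  have dg : ∀ t ∈ Icc p q, ∀ α, HasDerivAt (D.growth t)
      (∫ s in (0 : ℝ)..t, Real.exp (D.A s α) * ∫ r in (0 : ℝ)..s, D.a' r α) α :=
    fun t ht α => h.hasDerivAt_primitive (f := fun t α => Real.exp (D.A t α))
      (Real.continuous_exp.comp D.continuous_A) cg' (fun t ht α => (dA t ht α).exp) ht α
  have ce : Continuous fun α => deriv (deriv D.u₀) α + D.a' 0 α := by
    refine Continuous.add ?_ ?_
    · have h2 : ContDiff ℝ 1 (deriv D.u₀) := ((contDiff_succ_iff_deriv (n := 1)).1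
        (by simpa [one_add_one_eq_two] using D.contDiff_u₀)).2.2
      exact h2.continuous_deriv le_rfl
    · exact continuousOn_univ.1 (h.continuousOn_a'.comp (f := fun x => ((0 : ℝ), x))
        (by fun_prop) fun x _ => ⟨h.zero_mem, mem_univ _⟩)
  refine contDiffOn_of_partials (isOpen_Ioo.prod isOpen_univ)
    (f₁ := fun t α => D.e₀ α - D.a t α * D.Y t α)
    (f₂ := fun t α => Real.exp (-D.A t α) * -(∫ s in (0 : ℝ)..t, D.a' s α)
        * (1 + D.e₀ α * D.growth t α) + Real.exp (-D.A t α) *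
        ((deriv (deriv D.u₀) α + D.a' 0 α) * D.growth t α + D.e₀ α *
        ∫ s in (0 : ℝ)..t, Real.exp (D.A s α) * ∫ r in (0 : ℝ)..s, D.a' r α))
    (fun z _ => D.hasDerivAt_Y z.1 z.2) (fun z hz => ?_)
    ((D.continuous_e₀.comp continuous_snd).sub
      (D.continuous_a.mul D.continuous_Y)).continuousOn ?_
  · have ht := Ioo_subset_Icc_self hz.1
    exact ((dA _ ht z.2).fun_neg.exp).mul
      (((h.hasDerivAt_e₀ z.2).mul (dg _ ht z.2)).const_add 1)
  · have cA : ContinuousOn (fun z : ℝ × ℝ => Real.exp (-D.A z.1 z.2)) (Icc p q ×ˢ univ) :=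
      (Real.continuous_exp.comp D.continuous_A.neg).continuousOn
    have cG : ContinuousOn (fun z : ℝ × ℝ => D.growth z.1 z.2) (Icc p q ×ˢ univ) :=
      D.continuous_growth.continuousOn
    have cE : ContinuousOn (fun z : ℝ × ℝ => D.e₀ z.2) (Icc p q ×ˢ univ) :=
      (D.continuous_e₀.comp continuous_snd).continuousOn
    have cE' : ContinuousOn (fun z : ℝ × ℝ => deriv (deriv D.u₀) z.2 + D.a' 0 z.2)
      (Icc p q ×ˢ univ) := (ce.comp continuous_snd).continuousOn
    exact (((cA.mul ca.neg).mul (continuousOn_const.add (cE.mul cG))).add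
      (cA.mul ((cE'.mul cG).add (cE.mul cg)))).mono hsub

/-! ### Regularity in Eulerian coordinates -/

/-- This is the inverse function theorem for `(t, α) ↦ (t, X t α)`. The inverse is already known to
exist and to be continuous, so only invertibility of the derivative is needed. -/
lemma contDiffOn_label : ContDiffOn ℝ 1 (Function.uncurry D.label) (Ioo p q ×ˢ univ) := by
  have hsub : Ioo p q ×ˢ (univ : Set ℝ) ⊆ Icc p q ×ˢ univ := prod_mono_left Ioo_subset_Icc_self
  have hopen : IsOpen (Ioo p q ×ˢ (univ : Set ℝ)) := isOpen_Ioo.prod isOpen_univ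
  let Φ : OpenPartialHomeomorph (ℝ × ℝ) (ℝ × ℝ) :=
    { toFun := fun z => (z.1, D.X z.1 z.2)
      invFun := fun z => (z.1, D.label z.1 z.2)
      source := Ioo p q ×ˢ univ
      target := Ioo p q ×ˢ univ
      map_source' := fun z hz => ⟨hz.1, mem_univ _⟩
      map_target' := fun z hz => ⟨hz.1, mem_univ _⟩
      left_inv' := fun z hz => by
        simp only [h.label_X (Ioo_subset_Icc_self hz.1)]
      right_inv' := fun z hz => by
        simp only [h.X_label (Ioo_subset_Icc_self hz.1)]
      open_source := hopen
      open_target := hopen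
      continuousOn_toFun := (continuous_fst.prodMk D.continuous_X).continuousOn
      continuousOn_invFun := continuousOn_fst.prodMk (h.continuousOn_label.mono hsub) }
  have hΦ : ContDiff ℝ 1 Φ := contDiff_fst.prodMk D.contDiff_X
  intro z hz
  have hY := (h.Y_pos (Ioo_subset_Icc_self hz.1) (D.label z.1 z.2)).ne'
  set v := D.V z.1 (D.label z.1 z.2)
  set y := D.Y z.1 (D.label z.1 z.2)
  -- The derivative is the triangular matrix with rows `(1, 0)` and `(v, y)`, invertible because `y
  -- ≠ 0`.
  let S : (ℝ × ℝ) ≃L[ℝ] (ℝ × ℝ) := ContinuousLinearEquiv.equivOfInverse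
    ((ContinuousLinearMap.fst ℝ ℝ ℝ).prod
      ((ContinuousLinearMap.toSpanSingleton ℝ v).coprod (ContinuousLinearMap.toSpanSingleton ℝ y)))
    ((ContinuousLinearMap.fst ℝ ℝ ℝ).prod
      ((ContinuousLinearMap.toSpanSingleton ℝ (-(v / y))).coprod
        (ContinuousLinearMap.toSpanSingleton ℝ y⁻¹)))
    (fun w => by ext <;> simp; field_simp; ring) (fun w => by ext <;> simp; field_simp; ring)
  have hS : HasFDerivAt Φ (S : (ℝ × ℝ) →L[ℝ] (ℝ × ℝ)) (Φ.symm z) := by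
    refine (hasFDerivAt_fst).prodMk ?_
    exact hasFDerivAt_of_partials isOpen_univ (fun p _ => D.hasDerivAt_X p.1 p.2)
      (fun p _ => D.hasDerivAt_X_space p.1 p.2) D.continuous_V.continuousOn
      D.continuous_Y.continuousOn (p := (z.1, D.label z.1 z.2)) (mem_univ _)
  have hsymm := Φ.contDiffAt_symm (a := z) hz hS hΦ.contDiffAt
  exact (contDiffAt_snd.comp z hsymm).contDiffWithinAt

lemma contDiffOn_u : ContDiffOn ℝ 1 (Function.uncurry D.u) (Ioo p q ×ˢ univ) :=
  D.contDiff_V.comp_contDiffOn (contDiffOn_fst.prodMk h.contDiffOn_label)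

lemma contDiffOn_ρ : ContDiffOn ℝ 1 (Function.uncurry D.ρ) (Ioo p q ×ˢ univ) := by
  have h1 := D.contDiff_ρ₀.comp_contDiffOn h.contDiffOn_label
  have h2 := h.contDiffOn_Y.comp (contDiffOn_fst.prodMk h.contDiffOn_label)
    (fun z hz => (⟨hz.1, mem_univ _⟩ : ((z.1, D.label z.1 z.2) : ℝ × ℝ) ∈ Ioo p q ×ˢ univ))
  exact h1.div h2 fun z hz => (h.Y_pos (Ioo_subset_Icc_self hz.1) _).ne'

end Regular

end InitialData

end EulerAlignment

/-! ### The Eulerian equations and continuity in norm. -/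

namespace EulerAlignment

lemma hasDerivAt_along_curve_of_differentiableAt {F : ℝ → ℝ → ℝ} {γ : ℝ → ℝ} {t v : ℝ}
    (hF : DifferentiableAt ℝ (Function.uncurry F) (t, γ t)) (hγ : HasDerivAt γ v t) :
    DifferentiableAt ℝ (fun s => F s (γ t)) t ∧ DifferentiableAt ℝ (F t) (γ t) ∧
    HasDerivAt (fun s => F s (γ s))
      (deriv (fun s => F s (γ t)) t + v * deriv (F t) (γ t)) t := by
  have h1 : HasDerivAt (fun s => F s (γ t)) (fderiv ℝ (Function.uncurry F) (t, γ t) (1, 0)) t :=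
    HasFDerivAt.comp_hasDerivAt (f := fun s => (s, γ t)) t hF.hasFDerivAt
      ((hasDerivAt_id t).prodMk (hasDerivAt_const t (γ t)))
  have h2 : HasDerivAt (F t) (fderiv ℝ (Function.uncurry F) (t, γ t) (0, 1)) (γ t) :=
    hF.hasFDerivAt.comp_hasDerivAt (γ t) ((hasDerivAt_const (γ t) t).prodMk (hasDerivAt_id (γ t)))
  refine ⟨h1.differentiableAt, h2.differentiableAt, ?_⟩
  have h3 : HasDerivAt (fun s => F s (γ s)) (fderiv ℝ (Function.uncurry F) (t, γ t) (1, v)) t :=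
    HasFDerivAt.comp_hasDerivAt (f := fun s => (s, γ s)) t hF.hasFDerivAt
      ((hasDerivAt_id t).prodMk hγ)
  rw [h1.deriv, h2.deriv]
  refine h3.congr_deriv ?_
  have h4 : ((1, v) : ℝ × ℝ) = (1, 0) + v • (0, 1) := by simp
  rw [h4, map_add, map_smul, smul_eq_mul]

namespace InitialData

variable {D : InitialData} {p q c : ℝ}

namespace Regular

variable (h : D.Regular p q c)

include h

lemma differentiableAt_u {t : ℝ} (ht : t ∈ Ioo p q) (x : ℝ) :
    DifferentiableAt ℝ (Function.uncurry D.u) (t, x) :=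
  (h.contDiffOn_u.differentiableOn one_ne_zero).differentiableAt
    ((isOpen_Ioo.prod isOpen_univ).mem_nhds ⟨ht, mem_univ _⟩)

lemma differentiableAt_ρ {t : ℝ} (ht : t ∈ Ioo p q) (x : ℝ) :
    DifferentiableAt ℝ (Function.uncurry D.ρ) (t, x) :=
  (h.contDiffOn_ρ.differentiableOn one_ne_zero).differentiableAt
    ((isOpen_Ioo.prod isOpen_univ).mem_nhds ⟨ht, mem_univ _⟩)

lemma differentiableAt_u_space {t : ℝ} (ht : t ∈ Ioo p q) (x : ℝ) :
    DifferentiableAt ℝ (D.u t) x :=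
  (hasDerivAt_along_curve_of_differentiableAt (γ := fun _ => x) (h.differentiableAt_u ht x)
    (hasDerivAt_const t x)).2.1

lemma differentiableAt_ρ_space {t : ℝ} (ht : t ∈ Ioo p q) (x : ℝ) :
    DifferentiableAt ℝ (D.ρ t) x :=
  (hasDerivAt_along_curve_of_differentiableAt (γ := fun _ => x) (h.differentiableAt_ρ ht x)
    (hasDerivAt_const t x)).2.1

lemma deriv_u_mul_Y {t : ℝ} (ht : t ∈ Ioo p q) (α : ℝ) :
    deriv (D.u t) (D.X t α) * D.Y t α = D.e₀ α - D.a t α * D.Y t α := by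
  have h1 := (h.differentiableAt_u_space ht (D.X t α)).hasDerivAt.comp α
    (D.hasDerivAt_X_space t α)
  have h2 : D.u t ∘ D.X t = D.V t := funext fun β => h.u_X (Ioo_subset_Icc_self ht) β
  rw [h2] at h1
  exact h1.unique (D.hasDerivAt_V_space t α)

/-- As `e₀` and `a` are bounded, this formula yields both the bound on `∂ₓu` while `Y ≥ c` and its
divergence where `Y` degenerates. -/
lemma deriv_u {t : ℝ} (ht : t ∈ Ioo p q) (x : ℝ) :
    deriv (D.u t) x = D.e₀ (D.label t x) / D.Y t (D.label t x) - D.a t (D.label t x) := by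
  have h1 := h.deriv_u_mul_Y ht (D.label t x)
  have h2 := (h.Y_pos (Ioo_subset_Icc_self ht) (D.label t x)).ne'
  rw [h.X_label (Ioo_subset_Icc_self ht)] at h1
  field_simp
  linarith

lemma material_derivative_u {t : ℝ} (ht : t ∈ Ioo p q) (x : ℝ) :
    deriv (fun s => D.u s x) t + D.u t x * deriv (D.u t) x
      = ∫ y, D.ψ (x - y) * (D.u t y - D.u t x) * D.ρ t y := by
  have ht' := Ioo_subset_Icc_self ht
  obtain ⟨α, rfl⟩ := h.surjective ht' x
  have h1 := (hasDerivAt_along_curve_of_differentiableAt (γ := fun s => D.X s α)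
    (h.differentiableAt_u ht _) (D.hasDerivAt_X t α)).2.2
  have h2 : HasDerivAt (fun s => D.u s (D.X s α)) (D.acceleration t α) t := by
    refine (D.hasDerivAt_V t α).congr_of_eventuallyEq ?_
    filter_upwards [isOpen_Ioo.mem_nhds ht] with s hs using h.u_X (Ioo_subset_Icc_self hs) α
  rw [h.u_X ht', h1.unique h2,
    h.integral_mul_ρ ht' fun y => D.ψ (D.X t α - y) * (D.u t y - D.V t α)]
  simp only [h.u_X ht', acceleration]

/-- Along a trajectory `ρ Y` stays equal to `ρ₀`. Differentiating this product and dividing by `Y >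
0` gives the equation. -/
lemma continuity_equation {t : ℝ} (ht : t ∈ Ioo p q) (x : ℝ) :
    deriv (fun s => D.ρ s x) t + deriv (fun y => D.ρ t y * D.u t y) x = 0 := by
  have ht' := Ioo_subset_Icc_self ht
  have h0 := (h.differentiableAt_ρ_space ht x).hasDerivAt.mul
    (h.differentiableAt_u_space ht x).hasDerivAt
  change _ + deriv (D.ρ t * D.u t) x = 0
  rw [h0.deriv]
  obtain ⟨α, rfl⟩ := h.surjective ht' x
  have h1 := (hasDerivAt_along_curve_of_differentiableAt (γ := fun s => D.X s α)
    (h.differentiableAt_ρ ht _) (D.hasDerivAt_X t α)).2.2.mul (D.hasDerivAt_Y t α)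
  have h2 : HasDerivAt ((fun s => D.ρ s (D.X s α)) * fun s => D.Y s α) 0 t := by
    refine (hasDerivAt_const t (D.ρ₀ α)).congr_of_eventuallyEq ?_
    filter_upwards [isOpen_Ioo.mem_nhds ht] with s hs
    have h3 := (h.Y_pos (Ioo_subset_Icc_self hs) α).ne'
    rw [Pi.mul_apply, h.ρ_X (Ioo_subset_Icc_self hs), div_mul_cancel₀ _ h3]
  have h4 := h1.unique h2
  rw [← h.deriv_u_mul_Y ht α] at h4
  rw [h.u_X ht']
  have h5 := (h.Y_pos ht' α).ne'
  have h6 : (deriv (fun s => D.ρ s (D.X t α)) t + (deriv (D.ρ t) (D.X t α) * D.V t α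
      + D.ρ t (D.X t α) * deriv (D.u t) (D.X t α))) * D.Y t α = 0 := by
    linear_combination h4
  exact (mul_eq_zero.1 h6).resolve_right h5

lemma abs_deriv_u_le {t : ℝ} (ht : t ∈ Ioo p q) (x : ℝ) :
    |deriv (D.u t) x| ≤ (D.B + D.M) / c + D.M := by
  rw [h.deriv_u ht]
  refine (abs_sub _ _).trans (add_le_add ?_ (D.abs_a_le _ _))
  have hY := h.le_Y t (Ioo_subset_Icc_self ht) (D.label t x)
  rw [abs_div, abs_of_pos (h.c_pos.trans_le hY)]
  exact div_le_div₀ (add_nonneg D.B_nonneg D.M_nonneg) (D.abs_e₀_le _) h.c_pos hY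

lemma abs_ρ_le {C : ℝ} (hC : ∀ x, D.ρ₀ x ≤ C) {t : ℝ} (ht : t ∈ Icc p q) (x : ℝ) :
    |D.ρ t x| ≤ C / c := by
  rw [abs_of_nonneg (h.ρ_nonneg ht x), ρ]
  exact div_le_div₀ ((D.ρ₀_nonneg 0).trans (hC 0)) (hC _) h.c_pos (h.le_Y t ht _)

end Regular

lemma label_zero (x : ℝ) : D.label 0 x = x := by
  have h : Function.LeftInverse (Function.invFun (D.X 0)) (D.X 0) :=
    Function.leftInverse_invFun fun a b hab => by simpa [X_zero] using hab
  have := h x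
  rwa [X_zero] at this

/-- The Lagrangian construction gives a classical solution as long as the flow map is regular. -/
theorem isClassicalSolution {I : Set ℝ} (hI : I ⊆ Ici 0)
    (hI' : UniqueDiffOn ℝ I) (hreg : ∀ t ∈ I, ∃ p q c, D.Regular p q c ∧ t < q) {C₀ : ℝ}
    (hC₀ : ∀ x, D.ρ₀ x ≤ C₀) : IsClassicalSolution D.ψ D.ρ₀ D.u₀ I D.ρ D.u := by
  -- Regular intervals extend to negative times, so even `t = 0` is an interior point and one-sided
  -- derivatives reduce to ordinary ones.
  have hreg' : ∀ t ∈ I, ∃ p q c, D.Regular p q c ∧ t ∈ Ioo p q := fun t ht => by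
    obtain ⟨p, q, c, h, htq⟩ := hreg t ht
    exact ⟨p, q, c, h, h.neg.trans_le (hI ht), htq⟩
  refine ⟨?_, ?_, ?_, ?_, ?_, ?_, ?_, ?_, ?_, ?_, ?_⟩
  · rintro ⟨t, x⟩ ⟨ht, -⟩
    obtain ⟨p, q, c, h, htq⟩ := hreg' t ht
    exact (h.contDiffOn_ρ.contDiffAt
      ((isOpen_Ioo.prod isOpen_univ).mem_nhds ⟨htq, mem_univ _⟩)).contDiffWithinAt
  · rintro ⟨t, x⟩ ⟨ht, -⟩
    obtain ⟨p, q, c, h, htq⟩ := hreg' t ht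
    exact (h.contDiffOn_u.contDiffAt
      ((isOpen_Ioo.prod isOpen_univ).mem_nhds ⟨htq, mem_univ _⟩)).contDiffWithinAt
  · intro t ht
    obtain ⟨p, q, c, h, htq⟩ := hreg' t ht
    exact h.ρ_nonneg (Ioo_subset_Icc_self htq)
  · intro t ht
    obtain ⟨p, q, c, h, htq⟩ := hreg' t ht
    exact h.integrable_ρ (Ioo_subset_Icc_self htq)
  · intro t ht
    obtain ⟨p, q, c, h, htq⟩ := hreg' t ht
    exact h.integral_ρ (Ioo_subset_Icc_self htq)
  · intro t ht
    obtain ⟨p, q, c, h, htq⟩ := hreg' t ht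
    have ht' := Ioo_subset_Icc_self htq
    rw [h.integrable_mul_ρ_iff ht']
    simp only [h.u_X ht']
    obtain ⟨K, -, hK⟩ := D.exists_displacement_bound |t|
    exact (D.integrable_weight.const_mul K).mono' (D.continuous_V_apply t).aestronglyMeasurable
      (.of_forall fun α => (hK t le_rfl α).2)
  · intro T hT
    obtain ⟨p, q, c, h, hTq⟩ := hreg T hT
    obtain ⟨K, hK0, hK⟩ := D.exists_displacement_bound T
    refine ⟨max (C₀ / c) (max ((D.B + D.M) / c + D.M) (K * D.totalWeight)), fun t ht => ?_⟩
    have htq : t ∈ Ioo p q := ⟨h.neg.trans_le ht.1, ht.2.trans_lt hTq⟩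
    have ht' := Ioo_subset_Icc_self htq
    refine ⟨fun x => (h.abs_ρ_le hC₀ ht' x).trans (le_max_left _ _),
      fun x => (h.abs_deriv_u_le htq x).trans ((le_max_left _ _).trans (le_max_right _ _)), ?_⟩
    refine le_trans ?_ ((le_max_right _ _).trans (le_max_right _ _))
    rw [h.integral_mul_ρ ht' fun y => |D.u t y|]
    simp only [h.u_X ht']
    rw [totalWeight, ← integral_const_mul]
    exact integral_mono_of_nonneg (.of_forall fun _ => abs_nonneg _)
      (D.integrable_weight.const_mul _)
      (.of_forall fun α => (hK t (by rw [abs_of_nonneg ht.1]; exact ht.2) α).2)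
  · intro t ht x
    obtain ⟨p, q, c, h, htq⟩ := hreg' t ht
    rw [(hasDerivAt_along_curve_of_differentiableAt (γ := fun _ => x) (h.differentiableAt_ρ htq x)
      (hasDerivAt_const t x)).1.derivWithin (hI' t ht)]
    exact h.continuity_equation htq x
  · intro t ht x
    obtain ⟨p, q, c, h, htq⟩ := hreg' t ht
    rw [(hasDerivAt_along_curve_of_differentiableAt (γ := fun _ => x) (h.differentiableAt_u htq x)
      (hasDerivAt_const t x)).1.derivWithin (hI' t ht)]
    exact h.material_derivative_u htq x
  · funext x
    rw [ρ, label_zero, Y_zero, div_one]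
  · funext x
    rw [u, label_zero, V_eq, X_zero, funext D.X_zero]
    simp [interaction]

/-! ### Continuity in the norm -/

variable (D)

lemma abs_strength_sub_le {Z Z' : ℝ → ℝ} (hZ : D.Admissible Z) (hZ' : D.Admissible Z')
    {x x' δ ε : ℝ} (hx : |x - x'| ≤ δ) (hε : ∀ β, |Z β - Z' β| ≤ ε) :
    |D.strength Z x - D.strength Z' x'| ≤ D.L * (δ + ε) := by
  rw [strength, strength, ← integral_sub (integrable_strength hZ.continuous x)
    (integrable_strength hZ'.continuous x')]
  have := norm_integral_le_of_norm_le_const (μ := D.μ) (C := D.L * (δ + ε))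
    (f := fun β => D.ψ (x - Z β) - D.ψ (x' - Z' β)) (.of_forall fun β => ?_)
  · simpa using this
  · refine (D.abs_ψ_sub_le _ _).trans (mul_le_mul_of_nonneg_left ?_ D.L.coe_nonneg)
    rw [show x - Z β - (x' - Z' β) = (x - x') - (Z β - Z' β) by ring]
    exact (abs_sub _ _).trans (add_le_add hx (hε β))

lemma abs_a_sub_le {s t T v : ℝ} (ht : |t| ≤ T) (α β : ℝ) (hv : ∀ γ, |D.X t γ - D.X s γ| ≤ v) :
    |D.a t α - D.a s β| ≤ D.L * (D.flowBound T * |α - β| + v + v) := by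
  refine D.abs_strength_sub_le (D.admissible_X t) (D.admissible_X s) ?_ hv
  rw [show D.X t α - D.X s β = (D.X t α - D.X t β) + (D.X t β - D.X s β) by ring]
  exact (abs_add_le _ _).trans (add_le_add (D.abs_X_sub_le ht β α) (hv β))

/-- Subtracting the linear equations at two labels and applying Gronwall transfers the modulus of
continuity of `e₀` to `Y`, up to a Lipschitz term. -/
lemma abs_Y_space_sub_le {t T : ℝ} (ht : |t| ≤ T) (α β : ℝ) :
    |D.Y t α - D.Y t β| ≤ (|D.e₀ α - D.e₀ β| + D.L * D.flowBound T ^ 2 * |α - β|) * T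
      * Real.exp (D.M * T) := by
  have hT : 0 ≤ T := (abs_nonneg _).trans ht
  have hF := D.flowBound_nonneg hT
  have hL := D.L.coe_nonneg
  have hM := D.M_nonneg
  have h := norm_le_exp_of_norm_deriv_le (s := 0) (t := t) D.M_nonneg
    (ε := |D.e₀ α - D.e₀ β| + D.L * D.flowBound T ^ 2 * |α - β|) (by positivity)
    (fun r _ => (D.hasDerivAt_Y r α).fun_sub (D.hasDerivAt_Y r β)) (fun r hr => by
      have hr' : |r| ≤ T := by
        have h0 : |r - 0| ≤ |t - 0| := abs_sub_left_of_mem_uIcc hr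
        rw [sub_zero, sub_zero] at h0
        exact h0.trans ht
      have h1 := D.abs_a_sub_le hr' α β (s := r) (v := 0) (by simp)
      have h2 := D.abs_Y_le hr' β
      have h3 : D.e₀ α - D.a r α * D.Y r α - (D.e₀ β - D.a r β * D.Y r β)
        = (D.e₀ α - D.e₀ β) - D.a r α * (D.Y r α - D.Y r β)
          - (D.a r α - D.a r β) * D.Y r β := by ring
      rw [h3, Real.norm_eq_abs, Real.norm_eq_abs]
      have h4 : |D.a r α * (D.Y r α - D.Y r β)| ≤ D.M * |D.Y r α - D.Y r β| := by
        rw [abs_mul]; exact mul_le_mul_of_nonneg_right (D.abs_a_le _ _) (abs_nonneg _)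
      have h5 : |(D.a r α - D.a r β) * D.Y r β|
          ≤ D.L * (D.flowBound T * |α - β| + 0 + 0) * D.flowBound T := by
        rw [abs_mul]
        exact mul_le_mul h1 h2 (abs_nonneg _) (by positivity)
      have h6 := abs_sub ((D.e₀ α - D.e₀ β) - D.a r α * (D.Y r α - D.Y r β))
        ((D.a r α - D.a r β) * D.Y r β)
      have h7 := abs_sub (D.e₀ α - D.e₀ β) (D.a r α * (D.Y r α - D.Y r β))
      nlinarith)
  simp only [Y_zero, sub_self, norm_zero, zero_add, sub_zero, Real.norm_eq_abs] at h
  refine h.trans ?_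
  gcongr

lemma uniformContinuous_e₀ (hu : UniformContinuous (deriv D.u₀)) : UniformContinuous D.e₀ := by
  refine hu.add (LipschitzWith.uniformContinuous (K := D.L) (LipschitzWith.of_dist_le_mul ?_))
  intro x y
  have := D.abs_strength_sub_le .id .id (x := x) (x' := y) le_rfl (ε := 0) (by simp)
  simpa [Real.dist_eq] using this

lemma abs_div_sub_div_le {a b y z c A : ℝ} (hc : 0 < c) (hy : c ≤ y) (hz : c ≤ z) (hb : |b| ≤ A) :
    |a / y - b / z| ≤ |a - b| / c + A * |y - z| / c ^ 2 := by
  have hy0 := hc.trans_le hy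
  have hz0 := hc.trans_le hz
  have h1 : a / y - b / z = (a - b) / y - b * (y - z) / (y * z) := by field_simp; ring
  rw [h1]
  refine (abs_sub _ _).trans (add_le_add ?_ ?_)
  · rw [abs_div, abs_of_pos hy0]
    exact div_le_div_of_nonneg_left (abs_nonneg _) hc hy
  · rw [abs_div, abs_mul, abs_of_pos (mul_pos hy0 hz0)]
    have : 0 ≤ A := (abs_nonneg _).trans hb
    refine div_le_div₀ (by positivity) (mul_le_mul_of_nonneg_right hb (abs_nonneg _))
      (by positivity) ?_
    rw [sq]
    exact mul_le_mul hy hz hc.le hy0.le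

variable {D}

/-- At fixed `x` time acts through the label and through `Y` and `a`. All of these are Lipschitz in
time uniformly in `x`, except for the oscillation of `ρ₀` and `e₀` between the two labels, which is
kept explicit. -/
lemma Regular.exists_modulus (h : D.Regular p q c) {U C₀ : ℝ} (hU : ∀ x, |D.u₀ x| ≤ U)
    (hC₀ : ∀ x, D.ρ₀ x ≤ C₀) : ∃ K, 0 ≤ K ∧ ∀ s ∈ Ioo p q, ∀ t ∈ Ioo p q, ∀ x,
      |D.label s x - D.label t x| ≤ K * |s - t| ∧
      |D.ρ s x - D.ρ t x| ≤ K * (|D.ρ₀ (D.label s x) - D.ρ₀ (D.label t x)|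
        + |D.e₀ (D.label s x) - D.e₀ (D.label t x)| + |s - t|) ∧
      |deriv (D.u s) x - deriv (D.u t) x| ≤ K * (|D.e₀ (D.label s x) - D.e₀ (D.label t x)|
        + |s - t|) := by
  set T := max (-p) q with hT
  have hT0 : 0 ≤ T := h.pos.le.trans (le_max_right _ _)
  have habs : ∀ t ∈ Icc p q, |t| ≤ T := fun t ht =>
    abs_le.2 ⟨by linarith [ht.1, le_max_left (-p) q], ht.2.trans (le_max_right _ _)⟩
  obtain ⟨K, hK0, hK⟩ := D.exists_displacement_bound T
  -- Boundedness of `u₀` bounds the weight, so all particles share one speed bound.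
  set v := K * (1 + U) with hv
  have hc := h.c_pos
  have hU0 : 0 ≤ U := (abs_nonneg _).trans (hU 0)
  have hC00 : 0 ≤ C₀ := (D.ρ₀_nonneg 0).trans (hC₀ 0)
  have hF := D.flowBound_nonneg hT0
  have hR := D.rateBound_nonneg hT0
  have hL := D.L.coe_nonneg
  have hM := D.M_nonneg
  have hB := D.B_nonneg
  have hv0 : 0 ≤ v := by positivity
  have hX : ∀ s ∈ Icc p q, ∀ t ∈ Icc p q, ∀ α, |D.X s α - D.X t α| ≤ v * |s - t| := by
    intro s hs t ht α
    refine Convex.norm_image_sub_le_of_norm_hasDerivWithin_le (s := Icc p q)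
      (f := fun t => D.X t α) (fun r _ => (D.hasDerivAt_X r α).hasDerivWithinAt)
      (fun r hr => ?_) (convex_Icc _ _) ht hs
    refine (hK r (habs r hr) α).2.trans (mul_le_mul_of_nonneg_left ?_ hK0)
    exact add_le_add le_rfl (hU α)
  have hlabel : ∀ s ∈ Icc p q, ∀ t ∈ Icc p q, ∀ x,
      |D.label s x - D.label t x| ≤ v / c * |s - t| := by
    intro s hs t ht x
    have h1 := h.abs_label_sub_le hs x (D.label t x)
    have h2 := hX t ht s hs (D.label t x)
    rw [h.X_label ht, abs_sub_comm t s] at h2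
    rw [div_mul_eq_mul_div, le_div_iff₀ hc, mul_comm]
    exact h1.trans h2
  set E := Real.exp (D.M * T)
  have hE : 0 < E := Real.exp_pos _
  set G := D.L * D.flowBound T ^ 2 with hG
  have hG0 : 0 ≤ G := by positivity
  have hY : ∀ s ∈ Icc p q, ∀ t ∈ Icc p q, ∀ α β,
      |D.Y s α - D.Y t β| ≤ D.rateBound T * |s - t| + (|D.e₀ α - D.e₀ β| + G * |α - β|) * T * E := by
    intro s hs t ht α β
    rw [show D.Y s α - D.Y t β = (D.Y s α - D.Y t α) + (D.Y t α - D.Y t β) by ring]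
    exact (abs_add_le _ _).trans (add_le_add (D.abs_Y_sub_le (habs t ht) (habs s hs) α)
      (D.abs_Y_space_sub_le (habs t ht) α β))
  set N := D.rateBound T + T * E + G * (v / c) * T * E with hN
  have hvc : 0 ≤ v / c := by positivity
  have hN0 : 0 ≤ N := by positivity
  have hY' : ∀ s ∈ Icc p q, ∀ t ∈ Icc p q, ∀ x, |D.Y s (D.label s x) - D.Y t (D.label t x)|
      ≤ N * (|D.e₀ (D.label s x) - D.e₀ (D.label t x)| + |s - t|) := by
    intro s hs t ht x
    refine (hY s hs t ht _ _).trans ?_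
    have h1 : G * |D.label s x - D.label t x| ≤ G * (v / c * |s - t|) :=
      mul_le_mul_of_nonneg_left (hlabel s hs t ht x) hG0
    set d := |s - t|
    set e := |D.e₀ (D.label s x) - D.e₀ (D.label t x)|
    have hd : 0 ≤ d := abs_nonneg _
    have he : 0 ≤ e := abs_nonneg _
    calc D.rateBound T * d + (e + G * |D.label s x - D.label t x|) * T * E
        ≤ D.rateBound T * d + (e + G * (v / c * d)) * T * E := by gcongr
      _ = D.rateBound T * d + T * E * e + G * (v / c) * T * E * d := by ring
      -- Adding the nonnegative cross terms makes the right side factor as `N (e + d)`.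
      _ ≤ (D.rateBound T * d + T * E * e + G * (v / c) * T * E * d)
          + (D.rateBound T * e + T * E * d + G * (v / c) * T * E * e) :=
          le_add_of_nonneg_right (by positivity)
      _ = _ := by rw [hN]; ring
  set P := D.L * (D.flowBound T * (v / c) + v + v) with hP
  have hP0 : 0 ≤ P := by positivity
  set K' := v / c + (1 / c + C₀ * N / c ^ 2) + (1 / c + (D.B + D.M) * N / c ^ 2 + P) with hK'
  refine ⟨K', by positivity, fun s hs t ht x => ?_⟩
  have hs' := Ioo_subset_Icc_self hs
  have ht' := Ioo_subset_Icc_self ht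
  have hYx := hY' s hs' t ht' x
  have hlx := hlabel s hs' t ht' x
  set d := |s - t| with hd
  set e := |D.e₀ (D.label s x) - D.e₀ (D.label t x)| with he
  have hd0 : 0 ≤ d := abs_nonneg _
  have he0 : 0 ≤ e := abs_nonneg _
  have k1 : v / c ≤ K' := by
    rw [hK', add_assoc]; exact le_add_of_nonneg_right (by positivity)
  have k2 : 1 / c + C₀ * N / c ^ 2 ≤ K' := by
    have : 0 ≤ 1 / c + (D.B + D.M) * N / c ^ 2 + P := by positivity
    linarith
  have k3 : 1 / c + (D.B + D.M) * N / c ^ 2 + P ≤ K' := by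
    have : 0 ≤ 1 / c + C₀ * N / c ^ 2 := by positivity
    linarith
  refine ⟨hlx.trans (mul_le_mul_of_nonneg_right k1 hd0), ?_, ?_⟩
  · set r := |D.ρ₀ (D.label s x) - D.ρ₀ (D.label t x)|
    have hr0 : 0 ≤ r := abs_nonneg _
    refine (abs_div_sub_div_le (A := C₀) hc (h.le_Y s hs' _) (h.le_Y t ht' _)
      (by rw [abs_of_nonneg (D.ρ₀_nonneg _)]; exact hC₀ _)).trans ?_
    calc r / c + C₀ * |D.Y s (D.label s x) - D.Y t (D.label t x)| / c ^ 2
        ≤ r / c + C₀ * (N * (e + d)) / c ^ 2 := by gcongr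
      _ ≤ (r / c + C₀ * (N * (e + d)) / c ^ 2) + ((e + d) / c + C₀ * (N * r) / c ^ 2) :=
          le_add_of_nonneg_right (by positivity)
      _ = (1 / c + C₀ * N / c ^ 2) * (r + e + d) := by ring
      _ ≤ _ := mul_le_mul_of_nonneg_right k2 (by positivity)
  · rw [h.deriv_u hs, h.deriv_u ht, sub_sub_sub_comm]
    have h1 := abs_div_sub_div_le (a := D.e₀ (D.label s x)) hc (h.le_Y s hs' (D.label s x))
      (h.le_Y t ht' (D.label t x)) (D.abs_e₀_le (D.label t x))
    have h2 := D.abs_a_sub_le (habs s hs') (D.label s x) (D.label t x) (hX s hs' t ht')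
    refine (abs_sub _ _).trans ((add_le_add h1 h2).trans ?_)
    calc e / c + (D.B + D.M) * |D.Y s (D.label s x) - D.Y t (D.label t x)| / c ^ 2
          + D.L * (D.flowBound T * |D.label s x - D.label t x| + v * d + v * d)
        ≤ e / c + (D.B + D.M) * (N * (e + d)) / c ^ 2
          + D.L * (D.flowBound T * (v / c * d) + v * d + v * d) := by gcongr
      _ ≤ (e / c + (D.B + D.M) * (N * (e + d)) / c ^ 2
          + D.L * (D.flowBound T * (v / c * d) + v * d + v * d)) + (d / c + P * e) :=
          le_add_of_nonneg_right (by positivity)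
      _ = (1 / c + (D.B + D.M) * N / c ^ 2 + P) * (e + d) := by rw [hP]; ring
      _ ≤ _ := mul_le_mul_of_nonneg_right k3 (by positivity)

lemma tendsto_eLpNorm_top_of_forall {I : Set ℝ} {F : ℝ → ℝ → ℝ} {t : ℝ}
    (hF : ∀ ε > 0, ∀ᶠ s in 𝓝[I] t, ∀ x, |F s x| ≤ ε) :
    Tendsto (fun s => eLpNorm (F s) ⊤ volume) (𝓝[I] t) (𝓝 0) := by
  rw [ENNReal.tendsto_nhds_zero]
  intro ε hε
  rcases eq_or_ne ε ⊤ with rfl | htop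
  · exact .of_forall fun _ => le_top
  · filter_upwards [hF ε.toReal (ENNReal.toReal_pos hε.ne' htop)] with s hs
    rw [eLpNorm_exponent_top, ← ENNReal.ofReal_toReal htop]
    exact eLpNormEssSup_le_of_ae_bound (.of_forall hs)

theorem continuousInNorm {I : Set ℝ} (hI : I ⊆ Ici 0)
    (hreg : ∀ t ∈ I, ∃ p q c, D.Regular p q c ∧ t < q) {U C₀ : ℝ} (hC₀ : ∀ x, D.ρ₀ x ≤ C₀)
    (hρ : UniformContinuous D.ρ₀) (hu : UniformContinuous (deriv D.u₀))
    (hU : ∀ x, |D.u₀ x| ≤ U) : ContinuousInNorm I D.ρ D.u := by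
  have hreg' : ∀ t ∈ I, ∃ p q c, D.Regular p q c ∧ t ∈ Ioo p q := fun t ht => by
    obtain ⟨p, q, c, h, htq⟩ := hreg t ht
    exact ⟨p, q, c, h, h.neg.trans_le (hI ht), htq⟩
  have he := D.uniformContinuous_e₀ hu
  have main : ∀ t ∈ I, ∀ ε > 0, ∀ᶠ s in 𝓝[I] t, ∀ x, |D.ρ s x - D.ρ t x| ≤ ε ∧
      |deriv (D.u s) x - deriv (D.u t) x| ≤ ε := by
    intro t ht ε hε
    obtain ⟨p, q, c, h, htq⟩ := hreg' t ht
    obtain ⟨K, hK0, hK⟩ := h.exists_modulus hU hC₀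
    -- Three contributions, each at most `η`, are multiplied by `K`; the summand `1` covers `K = 0`.
    set η := ε / (3 * (K + 1)) with hη
    have hη0 : 0 < η := by positivity
    have hKη : K * (3 * η) ≤ ε := by
      rw [hη, show K * (3 * (ε / (3 * (K + 1)))) = ε * (K / (K + 1)) by field_simp]
      exact mul_le_of_le_one_right hε.le ((div_le_one (by positivity)).2 (by linarith))
    obtain ⟨δ₁, hδ₁, h₁⟩ := Metric.uniformContinuous_iff.1 hρ η hη0
    obtain ⟨δ₂, hδ₂, h₂⟩ := Metric.uniformContinuous_iff.1 he η hη0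
    have hm : 0 < min η (min δ₁ δ₂ / (K + 1)) := by positivity
    filter_upwards [mem_nhdsWithin_of_mem_nhds (isOpen_Ioo.mem_nhds htq),
      mem_nhdsWithin_of_mem_nhds (Metric.ball_mem_nhds t hm)] with s hs hst x
    rw [Metric.mem_ball, Real.dist_eq, lt_min_iff] at hst
    obtain ⟨l1, l2, l3⟩ := hK s hs t htq x
    have l4 : |D.label s x - D.label t x| < min δ₁ δ₂ := by
      have := (lt_div_iff₀ (by positivity)).1 hst.2
      nlinarith [abs_nonneg (s - t)]
    have l5 := (h₁ (lt_of_lt_of_le l4 (min_le_left _ _))).le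
    have l6 := (h₂ (lt_of_lt_of_le l4 (min_le_right _ _))).le
    rw [Real.dist_eq] at l5 l6
    constructor
    · refine l2.trans (le_trans (mul_le_mul_of_nonneg_left ?_ hK0) hKη)
      linarith [hst.1]
    · refine l3.trans (le_trans (mul_le_mul_of_nonneg_left ?_ hK0) hKη)
      linarith [hst.1]
  refine ⟨fun t ht => ?_, fun t ht x => ?_, fun t ht => ?_, fun t ht => ?_, fun t ht => ?_⟩
  · obtain ⟨p, q, c, h, htq⟩ := hreg' t ht
    have hc : Continuous (D.ρ t) := continuous_iff_continuousAt.2 fun x =>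
      (h.differentiableAt_ρ_space htq x).continuousAt
    exact memLp_top_of_bound hc.aestronglyMeasurable (C₀ / c)
      (.of_forall fun x => h.abs_ρ_le hC₀ (Ioo_subset_Icc_self htq) x)
  · obtain ⟨p, q, c, h, htq⟩ := hreg' t ht
    exact h.differentiableAt_u_space htq x
  · obtain ⟨p, q, c, h, htq⟩ := hreg' t ht
    exact memLp_top_of_bound (measurable_deriv _).aestronglyMeasurable _
      (.of_forall fun x => h.abs_deriv_u_le htq x)
  · refine tendsto_eLpNorm_top_of_forall (F := fun s x => D.ρ s x - D.ρ t x) fun ε hε => ?_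
    filter_upwards [main t ht ε hε] with s hs x using (hs x).1
  · refine tendsto_eLpNorm_top_of_forall
      (F := fun s x => deriv (D.u s) x - deriv (D.u t) x) fun ε hε => ?_
    filter_upwards [main t ht ε hε] with s hs x using (hs x).2

end InitialData

end EulerAlignment

/-! ### Characteristics of an arbitrary classical solution. -/

namespace EulerAlignment

/-- Projection of time onto `[0, b]`. -/
def clamp (b t : ℝ) : ℝ := max 0 (min b t)

lemma continuous_clamp (b : ℝ) : Continuous (clamp b) := by unfold clamp; fun_prop

lemma clamp_mem {b : ℝ} (hb : 0 ≤ b) (t : ℝ) : clamp b t ∈ Icc 0 b :=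
  ⟨le_max_left _ _, max_le hb (min_le_left _ _)⟩

lemma clamp_of_mem {b t : ℝ} (ht : t ∈ Icc 0 b) : clamp b t = t := by
  rw [clamp, min_eq_right ht.2, max_eq_right ht.1]

lemma Ico_prod_univ_mem_nhds {t T : ℝ} (ht : t ∈ Ioo 0 T) (x : ℝ) :
    Ico 0 T ×ˢ (univ : Set ℝ) ∈ 𝓝 (t, x) :=
  prod_mem_nhds (Ico_mem_nhds ht.1 ht.2) univ_mem

namespace IsClassicalSolution

variable {ψ ρ₀ u₀ : ℝ → ℝ} {T : ℝ} {σ v : ℝ → ℝ → ℝ}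
  (hs : IsClassicalSolution ψ ρ₀ u₀ (Ico 0 T) σ v)

include hs

lemma contDiff_density {t : ℝ} (ht : t ∈ Ico 0 T) : ContDiff ℝ 1 (σ t) := by
  rw [← contDiffOn_univ]
  exact hs.contDiffOn_density.comp (f := fun x => (t, x)) (by fun_prop)
    fun x _ => ⟨ht, mem_univ _⟩

lemma contDiff_velocity {t : ℝ} (ht : t ∈ Ico 0 T) : ContDiff ℝ 1 (v t) := by
  rw [← contDiffOn_univ]
  exact hs.contDiffOn_velocity.comp (f := fun x => (t, x)) (by fun_prop)
    fun x _ => ⟨ht, mem_univ _⟩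

lemma differentiableAt_density {t : ℝ} (ht : t ∈ Ioo 0 T) (x : ℝ) :
    DifferentiableAt ℝ (Function.uncurry σ) (t, x) :=
  (hs.contDiffOn_density.differentiableOn one_ne_zero).differentiableAt (Ico_prod_univ_mem_nhds ht x)

lemma differentiableAt_velocity {t : ℝ} (ht : t ∈ Ioo 0 T) (x : ℝ) :
    DifferentiableAt ℝ (Function.uncurry v) (t, x) :=
  (hs.contDiffOn_velocity.differentiableOn one_ne_zero).differentiableAt (Ico_prod_univ_mem_nhds ht x)

lemma hasDerivAt_density_time {t : ℝ} (ht : t ∈ Ioo 0 T) (x : ℝ) :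
    HasDerivAt (fun s => σ s x) (-deriv (fun y => σ t y * v t y) x) t := by
  have h1 := (hasDerivAt_along_curve_of_differentiableAt (γ := fun _ => x)
    (hs.differentiableAt_density ht x) (hasDerivAt_const t x)).1
  have h2 := hs.continuity_eq t ⟨ht.1.le, ht.2⟩ x
  rw [derivWithin_of_mem_nhds (Ico_mem_nhds ht.1 ht.2)] at h2
  rw [← eq_neg_of_add_eq_zero_left h2]
  exact h1.hasDerivAt

lemma hasDerivAt_velocity_along {γ : ℝ → ℝ} {t : ℝ} (ht : t ∈ Ioo 0 T)
    (hγ : HasDerivAt γ (v t (γ t)) t) : HasDerivAt (fun s => v s (γ s))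
      (∫ y, ψ (γ t - y) * (v t y - v t (γ t)) * σ t y) t := by
  have h1 := (hasDerivAt_along_curve_of_differentiableAt
    (hs.differentiableAt_velocity ht (γ t)) hγ).2.2
  have h2 := hs.velocity_eq t ⟨ht.1.le, ht.2⟩ (γ t)
  rw [derivWithin_of_mem_nhds (Ico_mem_nhds ht.1 ht.2)] at h2
  rwa [h2] at h1

lemma continuousOn_flux_deriv : ContinuousOn
    (Function.uncurry fun t x => -deriv (fun y => σ t y * v t y) x) (Ioo 0 T ×ˢ univ) := by
  have hopen : IsOpen (Ioo 0 T ×ˢ (univ : Set ℝ)) := isOpen_Ioo.prod isOpen_univ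
  have h1 : ContDiffOn ℝ 1 (Function.uncurry fun t y => σ t y * v t y) (Ioo 0 T ×ˢ univ) :=
    (hs.contDiffOn_density.mul hs.contDiffOn_velocity).mono
      (prod_mono_left Ioo_subset_Ico_self)
  have h2 := (h1.continuousOn_fderiv_of_isOpen hopen le_rfl).clm_apply
    (continuousOn_const (c := ((0 : ℝ), (1 : ℝ))))
  refine h2.neg.congr fun z hz => ?_
  have h3 := (h1.differentiableOn one_ne_zero).differentiableAt (hopen.mem_nhds hz)
  have h4 : HasDerivAt (fun y => σ z.1 y * v z.1 y)
      (fderiv ℝ (Function.uncurry fun t y => σ t y * v t y) z (0, 1)) z.2 :=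
    HasFDerivAt.comp_hasDerivAt (f := fun y => (z.1, y)) z.2 h3.hasFDerivAt
      ((hasDerivAt_const z.2 z.1).prodMk (hasDerivAt_id' z.2))
  simp only [Function.uncurry]
  exact congrArg Neg.neg h4.deriv

lemma continuous_clamp_density {b : ℝ} (hb : b ∈ Ico 0 T) :
    Continuous (Function.uncurry fun t x => σ (clamp b t) x) :=
  hs.contDiffOn_density.continuousOn.comp_continuous
    (((continuous_clamp b).comp continuous_fst).prodMk continuous_snd)
    fun z => ⟨Icc_subset_Ico_right hb.2 (clamp_mem hb.1 z.1), mem_univ _⟩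

lemma continuous_clamp_velocity {b : ℝ} (hb : b ∈ Ico 0 T) :
    Continuous (Function.uncurry fun t x => v (clamp b t) x) :=
  hs.contDiffOn_velocity.continuousOn.comp_continuous
    (((continuous_clamp b).comp continuous_fst).prodMk continuous_snd)
    fun z => ⟨Icc_subset_Ico_right hb.2 (clamp_mem hb.1 z.1), mem_univ _⟩

end IsClassicalSolution

/-- Characteristics of a classical solution up to time `b`, with the bounds on `[0, b]`. -/
structure Characteristics (D : InitialData) (T b C : ℝ) (σ v χ : ℝ → ℝ → ℝ) : Prop where
  sol : IsClassicalSolution D.ψ D.ρ₀ D.u₀ (Ico 0 T) σ v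
  mem : b ∈ Ico 0 T
  deriv_le : ∀ t ∈ Icc 0 b, ∀ x, |deriv (v t) x| ≤ C
  moment_le : ∀ t ∈ Icc 0 b, ∫ x, |v t x| * σ t x ≤ C
  zero : ∀ α, χ 0 α = α
  hasDerivAt' : ∀ t α, HasDerivAt (fun t => χ t α) (v (clamp b t) (χ t α)) t

/-- With time clamped to `[0, b]` the velocity is globally Lipschitz in space, uniformly in time, by
the local bound on `∂ₓv`. The global existence theorem for integral curves then applies. -/
lemma IsClassicalSolution.exists_characteristics {D : InitialData} {T b : ℝ} {σ v : ℝ → ℝ → ℝ}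
    (hs : IsClassicalSolution D.ψ D.ρ₀ D.u₀ (Ico 0 T) σ v) (hb : b ∈ Ico 0 T) :
    ∃ C χ, Characteristics D T b C σ v χ := by
  obtain ⟨C, hC⟩ := hs.locally_bounded b hb
  have hC0 : 0 ≤ C := (abs_nonneg _).trans ((hC 0 ⟨le_rfl, hb.1⟩).2.1 0)
  have key : ∀ α, ∃ γ : ℝ → ℝ, γ 0 = α ∧ ∀ t, HasDerivAt γ (v (clamp b t) (γ t)) t := by
    intro α
    obtain ⟨B, hB⟩ := (isCompact_Icc (a := (0 : ℝ)) (b := b)).exists_bound_of_continuousOn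
      (f := fun t => v t α) (hs.contDiffOn_velocity.continuousOn.comp (f := fun t => (t, α))
        (by fun_prop) fun t ht => ⟨Icc_subset_Ico_right hb.2 ht, mem_univ _⟩)
    refine exists_global_integralCurve (f := fun t x => v (clamp b t) x) (K := C.toNNReal)
      (fun t => ?_) (hs.continuous_clamp_velocity hb) (B := B)
      fun t => hB _ (clamp_mem hb.1 t)
    have ht := clamp_mem hb.1 t
    refine lipschitzWith_of_nnnorm_deriv_le
      ((hs.contDiff_velocity (Icc_subset_Ico_right hb.2 ht)).differentiable one_ne_zero)
      fun x => ?_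
    rw [← NNReal.coe_le_coe, coe_nnnorm, Real.coe_toNNReal _ hC0]
    exact (hC _ ht).2.1 x
  choose γ h0 h1 using key
  exact ⟨C, fun t α => γ α t, hs, hb, fun t ht => (hC t ht).2.1, fun t ht => (hC t ht).2.2, h0,
    fun t α => h1 α t⟩

namespace Characteristics

variable {D : InitialData} {T b C : ℝ} {σ v χ : ℝ → ℝ → ℝ}
  (H : Characteristics D T b C σ v χ)

include H

lemma C_nonneg : 0 ≤ C := (abs_nonneg _).trans (H.deriv_le 0 ⟨le_rfl, H.mem.1⟩ 0)

lemma mem_Ico {t : ℝ} (ht : t ∈ Icc 0 b) : t ∈ Ico 0 T := Icc_subset_Ico_right H.mem.2 ht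

lemma hasDerivAt {t : ℝ} (ht : t ∈ Icc 0 b) (α : ℝ) :
    HasDerivAt (fun t => χ t α) (v t (χ t α)) t := by
  simpa only [clamp_of_mem ht] using H.hasDerivAt' t α

lemma continuous_time (α : ℝ) : Continuous fun t => χ t α :=
  continuous_iff_continuousAt.2 fun t => (H.hasDerivAt' t α).continuousAt

lemma abs_velocity_sub_le {t : ℝ} (ht : t ∈ Icc 0 b) (x y : ℝ) :
    |v t x - v t y| ≤ C * |x - y| :=
  Convex.norm_image_sub_le_of_norm_deriv_le (s := univ)
    (fun x _ => (H.sol.contDiff_velocity (H.mem_Ico ht)).differentiable one_ne_zero x)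
    (fun x _ => H.deriv_le t ht x) convex_univ (mem_univ _) (mem_univ _)

lemma abs_sub_le {s t : ℝ} (hs : s ∈ Icc 0 b) (ht : t ∈ Icc 0 b) (α β : ℝ) :
    |χ t α - χ t β| ≤ |χ s α - χ s β| * Real.exp (C * b) := by
  have h := norm_le_exp_of_norm_deriv_le (s := s) (t := t) H.C_nonneg le_rfl
    (fun r hr => (H.hasDerivAt (uIcc_subset_Icc hs ht hr) α).fun_sub
      (H.hasDerivAt (uIcc_subset_Icc hs ht hr) β))
    (fun r hr => by
      rw [add_zero]; exact H.abs_velocity_sub_le (uIcc_subset_Icc hs ht hr) _ _)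
  rw [zero_mul, add_zero] at h
  refine h.trans (mul_le_mul_of_nonneg_left (Real.exp_le_exp.2 ?_) (norm_nonneg _))
  refine mul_le_mul_of_nonneg_left ?_ H.C_nonneg
  rw [abs_le]; constructor <;> linarith [hs.1, hs.2, ht.1, ht.2]

/-- Gronwall backwards in time bounds the size of the gap from below. A change of sign would, by the
intermediate value theorem, pass through a zero gap. -/
lemma mul_sub_le {t : ℝ} (ht : t ∈ Icc 0 b) (α β : ℝ) (hαβ : α ≤ β) :
    Real.exp (-(C * b)) * (β - α) ≤ χ t β - χ t α := by
  have h0 : (0 : ℝ) ∈ Icc 0 b := ⟨le_rfl, H.mem.1⟩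
  have hlow : ∀ r ∈ Icc 0 b, Real.exp (-(C * b)) * (β - α) ≤ |χ r β - χ r α| := by
    intro r hr
    have := H.abs_sub_le hr h0 β α
    rw [H.zero, H.zero, abs_of_nonneg (by linarith)] at this
    rw [Real.exp_neg, inv_mul_le_iff₀ (Real.exp_pos _), mul_comm]
    exact this
  rcases hαβ.eq_or_lt with rfl | hlt
  · simp
  have hpos : 0 ≤ χ t β - χ t α := by
    by_contra! hneg
    have hc : ContinuousOn (fun r => χ r β - χ r α) (Icc 0 t) :=
      ((H.continuous_time β).sub (H.continuous_time α)).continuousOn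
    obtain ⟨r, hr, hr0⟩ := intermediate_value_Icc' ht.1 hc
      (show (0 : ℝ) ∈ _ from ⟨hneg.le, by rw [H.zero, H.zero]; linarith⟩)
    have h1 := hlow r ⟨hr.1, hr.2.trans ht.2⟩
    simp only at hr0
    rw [hr0, abs_zero] at h1
    have : 0 < Real.exp (-(C * b)) * (β - α) := mul_pos (Real.exp_pos _) (by linarith)
    linarith
  exact (hlow t ht).trans_eq (abs_of_nonneg hpos)

lemma continuous_space {t : ℝ} (ht : t ∈ Icc 0 b) : Continuous (χ t) := by
  refine (LipschitzWith.of_dist_le_mul (K := (Real.exp (C * b)).toNNReal)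
    fun α β => ?_).continuous
  have := H.abs_sub_le ⟨le_rfl, H.mem.1⟩ ht α β
  rw [H.zero, H.zero, mul_comm] at this
  rwa [Real.coe_toNNReal _ (Real.exp_pos _).le]

lemma strictMono {t : ℝ} (ht : t ∈ Icc 0 b) : StrictMono (χ t) :=
  (strictMono_surjective_of_le_sub (Real.exp_pos _) (H.continuous_space ht)
    (H.mul_sub_le ht)).1

lemma surjective {t : ℝ} (ht : t ∈ Icc 0 b) : Function.Surjective (χ t) :=
  (strictMono_surjective_of_le_sub (Real.exp_pos _) (H.continuous_space ht)
    (H.mul_sub_le ht)).2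

/-! ### Conservation of mass along characteristics -/

/-- The continuity equation provides a potential `G` with `∂ₓG = σ` and `∂ₜG = -σ v`. It is constant
along characteristics. -/
lemma integral_density_eq {t : ℝ} (ht : t ∈ Icc 0 b) (α β : ℝ) :
    ∫ y in χ t α..χ t β, σ t y = ∫ y in α..β, D.ρ₀ y := by
  have hT := H.sol
  have hσ := hT.continuous_clamp_density H.mem
  have hv := hT.continuous_clamp_velocity H.mem
  have hm : Continuous fun s => σ (clamp b s) 0 * v (clamp b s) 0 :=
    (hσ.comp (continuous_id.prodMk continuous_const)).mul
      (hv.comp (continuous_id.prodMk continuous_const))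
  -- The second integral compensates for the mass flux through the origin.
  let G : ℝ → ℝ → ℝ := fun s x => (∫ y in (0 : ℝ)..x, σ (clamp b s) y)
    - ∫ r in (0 : ℝ)..s, σ (clamp b r) 0 * v (clamp b r) 0
  have hsub : Ioo 0 b ⊆ Ioo 0 T := Ioo_subset_Ioo_right H.mem.2.le
  have hG1 : ∀ z ∈ Ioo 0 b ×ˢ (univ : Set ℝ), HasDerivAt (fun s => G s z.2)
      (-(σ (clamp b z.1) z.2 * v (clamp b z.1) z.2)) z.1 := by
    rintro ⟨s, x⟩ ⟨hs, -⟩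
    have hs' : s ∈ Icc 0 b := Ioo_subset_Icc_self hs
    have e1 : HasDerivAt (fun s => ∫ y in (0 : ℝ)..x, σ s y)
        (∫ y in (0 : ℝ)..x, -deriv (fun y => σ s y * v s y) y) s :=
      hasDerivAt_intervalIntegral_param (f' := fun s x => -deriv (fun y => σ s y * v s y) x)
        isOpen_Ioo (hT.contDiffOn_density.continuousOn.mono
          (prod_mono Ioo_subset_Ico_self (subset_univ _)))
        (hT.continuousOn_flux_deriv.mono (prod_mono_right (subset_univ _)))
        (fun r hr y _ => hT.hasDerivAt_density_time hr y) (hsub hs)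
    have hflux : ContDiff ℝ 1 fun y => σ s y * v s y :=
      (hT.contDiff_density (H.mem_Ico hs')).mul (hT.contDiff_velocity (H.mem_Ico hs'))
    rw [intervalIntegral.integral_neg, intervalIntegral.integral_deriv_eq_sub
      (fun y _ => hflux.differentiable one_ne_zero y)
      ((hflux.continuous_deriv le_rfl).intervalIntegrable _ _)] at e1
    have e2 : HasDerivAt (fun s => ∫ y in (0 : ℝ)..x, σ (clamp b s) y)
        (-(σ s x * v s x - σ s 0 * v s 0)) s := by
      refine e1.congr_of_eventuallyEq ?_
      filter_upwards [isOpen_Ioo.mem_nhds hs] with r hr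
      rw [clamp_of_mem (Ioo_subset_Icc_self hr)]
    have e3 : HasDerivAt (fun s => ∫ r in (0 : ℝ)..s, σ (clamp b r) 0 * v (clamp b r) 0)
        (σ (clamp b s) 0 * v (clamp b s) 0) s :=
      intervalIntegral.integral_hasDerivAt_right (hm.intervalIntegrable _ _)
        (hm.stronglyMeasurableAtFilter _ _) hm.continuousAt
    simp only [clamp_of_mem hs'] at e3 ⊢
    exact (e2.fun_sub e3).congr_deriv (by ring)
  have hG2 : ∀ z ∈ Ioo 0 b ×ˢ (univ : Set ℝ), HasDerivAt (fun x => G z.1 x)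
      (σ (clamp b z.1) z.2) z.2 := by
    rintro ⟨s, x⟩ -
    have h1 : Continuous (σ (clamp b s)) := hσ.comp (continuous_const.prodMk continuous_id)
    exact (intervalIntegral.integral_hasDerivAt_right (h1.intervalIntegrable _ _)
      (h1.stronglyMeasurableAtFilter _ _) h1.continuousAt).sub_const _
  have hconst : ∀ α, G t (χ t α) = ∫ y in (0 : ℝ)..α, D.ρ₀ y := by
    intro α
    have h1 : Continuous fun s => G s (χ s α) :=
      (intervalIntegral.continuous_parametric_intervalIntegral_of_continuous
        (f := fun s y => σ (clamp b s) y) hσ (H.continuous_time α)).sub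
        (intervalIntegral.continuous_primitive (fun _ _ => hm.intervalIntegrable _ _) 0)
    have h2 := eq_of_hasDerivAt_zero (f := fun s => G s (χ s α)) ht.1 h1.continuousOn
      fun s hs => by
        have hs' : s ∈ Ioo 0 b := ⟨hs.1, hs.2.trans_le ht.2⟩
        have h3 := hasDerivAt_along_curve (f := G)
          (f₁ := fun s x => -(σ (clamp b s) x * v (clamp b s) x)) (isOpen_Ioo.prod isOpen_univ) hG1 hG2
          (hσ.mul hv).neg.continuousOn hσ.continuousOn (γ := fun s => χ s α)
          ⟨hs', mem_univ _⟩ (H.hasDerivAt' s α)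
        exact h3.congr_deriv (by ring)
    rw [h2]
    simp only [G, intervalIntegral.integral_same, sub_zero, H.zero,
      clamp_of_mem (⟨le_rfl, H.mem.1⟩ : (0 : ℝ) ∈ Icc 0 b), hT.initial_density]
  have hσt : Continuous (σ t) := (hT.contDiff_density (H.mem_Ico ht)).continuous
  have hρ := D.contDiff_ρ₀.continuous
  rw [← intervalIntegral.integral_interval_sub_left (hσt.intervalIntegrable 0 _)
      (hσt.intervalIntegrable 0 _), ← intervalIntegral.integral_interval_sub_left
      (hρ.intervalIntegrable 0 _) (hρ.intervalIntegrable 0 _), ← hconst α, ← hconst β]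
  simp only [G, clamp_of_mem ht]
  ring

/-- Half-open intervals determine the measures, and increasing bijections pull them back to
half-open intervals. No label derivative of `χ` is needed, only the mass identity. -/
lemma map_eq {t : ℝ} (ht : t ∈ Icc 0 b) :
    D.μ.map (χ t) = volume.withDensity fun x => ENNReal.ofReal (σ t x) := by
  have hχ := H.continuous_space ht
  have hσ := (H.sol.contDiff_density (H.mem_Ico ht)).continuous
  have : IsProbabilityMeasure (D.μ.map (χ t)) :=
    Measure.isProbabilityMeasure_map hχ.measurable.aemeasurable
  refine Measure.ext_of_Ioc _ _ fun x y hxy => ?_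
  obtain ⟨α, rfl⟩ := H.surjective ht x
  obtain ⟨β, rfl⟩ := H.surjective ht y
  have hm := H.strictMono ht
  have hpre : χ t ⁻¹' Ioc (χ t α) (χ t β) = Ioc α β := by
    ext z; simp [hm.lt_iff_lt, hm.le_iff_le]
  have hαβ : α ≤ β := (hm.lt_iff_lt.1 hxy).le
  have general : ∀ (f : ℝ → ℝ), Continuous f → (∀ x, 0 ≤ f x) → ∀ a c, a ≤ c →
      volume.withDensity (fun x => ENNReal.ofReal (f x)) (Ioc a c)
        = ENNReal.ofReal (∫ y in a..c, f y) := by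
    intro f hf hf0 a c hac
    rw [withDensity_apply _ measurableSet_Ioc, intervalIntegral.integral_of_le hac,
      ofReal_integral_eq_lintegral_ofReal (hf.integrableOn_Ioc) (.of_forall hf0)]
  rw [Measure.map_apply hχ.measurable measurableSet_Ioc, hpre, InitialData.μ,
    general _ D.contDiff_ρ₀.continuous D.ρ₀_nonneg α β hαβ,
    general _ hσ (H.sol.nonneg t (H.mem_Ico ht)) _ _ hxy.le, H.integral_density_eq ht]

lemma measurableEmbedding {t : ℝ} (ht : t ∈ Icc 0 b) : MeasurableEmbedding (χ t) :=
  (H.continuous_space ht).measurableEmbedding (H.strictMono ht).injective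

lemma integral_mul_density {t : ℝ} (ht : t ∈ Icc 0 b) (f : ℝ → ℝ) :
    ∫ y, f y * σ t y = ∫ β, f (χ t β) ∂D.μ := by
  have hσ := (H.sol.contDiff_density (H.mem_Ico ht)).continuous
  rw [← (H.measurableEmbedding ht).integral_map, H.map_eq ht,
    integral_withDensity_eq_integral_toReal_smul hσ.measurable.ennreal_ofReal
    (.of_forall fun _ => ENNReal.ofReal_lt_top)]
  simp [ENNReal.toReal_ofReal (H.sol.nonneg t (H.mem_Ico ht) _), mul_comm]

lemma integrable_mul_density_iff {t : ℝ} (ht : t ∈ Icc 0 b) (f : ℝ → ℝ) :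
    Integrable (fun y => f y * σ t y) ↔ Integrable (fun β => f (χ t β)) D.μ := by
  have hσ := (H.sol.contDiff_density (H.mem_Ico ht)).continuous
  have h1 := (H.measurableEmbedding ht).integrable_map_iff (μ := D.μ) (g := f)
  rw [H.map_eq ht, integrable_withDensity_iff_integrable_smul' hσ.measurable.ennreal_ofReal
    (.of_forall fun _ => ENNReal.ofReal_lt_top)] at h1
  simp only [ENNReal.toReal_ofReal (H.sol.nonneg t (H.mem_Ico ht) _), smul_eq_mul] at h1
  simp only [mul_comm (f _)]
  exact h1

/-! ### Velocities along characteristics -/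

lemma hasDerivAt_velocity {t : ℝ} (ht : t ∈ Ioo 0 b) (α : ℝ) :
    HasDerivAt (fun s => v s (χ s α))
      (∫ β, D.ψ (χ t α - χ t β) * (v t (χ t β) - v t (χ t α)) ∂D.μ) t := by
  have ht' := Ioo_subset_Icc_self ht
  have h := H.sol.hasDerivAt_velocity_along ⟨ht.1, ht.2.trans H.mem.2⟩ (H.hasDerivAt ht' α)
  rwa [H.integral_mul_density ht' fun y => D.ψ (χ t α - y) * (v t y - v t (χ t α))] at h

lemma integrable_velocity {t : ℝ} (ht : t ∈ Icc 0 b) :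
    Integrable (fun β => v t (χ t β)) D.μ :=
  (H.integrable_mul_density_iff ht _).1 (H.sol.integrable_momentum t (H.mem_Ico ht))

/-- The bound on `∫ |v| σ` controls the mean-field part. What remains is linear in the particle's
own velocity, as Gronwall requires. -/
lemma abs_acceleration_le {t : ℝ} (ht : t ∈ Icc 0 b) (α : ℝ) :
    |∫ β, D.ψ (χ t α - χ t β) * (v t (χ t β) - v t (χ t α)) ∂D.μ|
      ≤ D.M * |v t (χ t α)| + D.M * C := by
  have h1 := H.moment_le t ht
  rw [H.integral_mul_density ht fun y => |v t y|] at h1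
  have hi := (H.integrable_velocity ht).abs
  have h2 : ∫ β, D.M * (|v t (χ t β)| + |v t (χ t α)|) ∂D.μ
      ≤ D.M * |v t (χ t α)| + D.M * C := by
    rw [integral_const_mul, integral_add hi (integrable_const _)]
    simp only [integral_const, probReal_univ, one_smul]
    nlinarith [mul_le_mul_of_nonneg_left h1 D.M_nonneg]
  refine le_trans ?_ h2
  rw [← Real.norm_eq_abs]
  refine norm_integral_le_of_norm_le ((hi.add (integrable_const _)).const_mul _)
    (.of_forall fun β => ?_)
  rw [norm_mul]
  exact mul_le_mul (D.abs_ψ_le _) (abs_sub _ _) (norm_nonneg _) D.M_nonneg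

lemma continuous_velocity_time (α : ℝ) : Continuous fun s => v (clamp b s) (χ s α) :=
  (H.sol.continuous_clamp_velocity H.mem).comp (continuous_id.prodMk (H.continuous_time α))

/-- The velocity along characteristics is dominated by the weight. -/
lemma exists_velocity_bound : ∃ K, 0 ≤ K ∧ ∀ t ∈ Ico 0 b, ∀ α,
    |v t (χ t α)| ≤ K * D.weight α := by
  have hM := D.M_nonneg
  have hC := H.C_nonneg
  have hb := H.mem.1
  set K := (1 + D.M * C * b) * Real.exp (D.M * b) with hK
  have hstep : ∀ t ∈ Ioo 0 b, ∀ α, |v t (χ t α)|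
      ≤ (|D.u₀ α| + D.M * C * b) * Real.exp (D.M * b) := by
    intro t ht α
    -- The two-sided derivative of the velocity is available only at positive times, so Gronwall
    -- starts at `s > 0` and then `s → 0`.
    have h1 : ∀ᶠ s in 𝓝[>] (0 : ℝ), |v t (χ t α)|
        ≤ (|v (clamp b s) (χ s α)| + D.M * C * b) * Real.exp (D.M * b) := by
      filter_upwards [Ioo_mem_nhdsGT ht.1] with s hs
      have hsub : uIcc s t ⊆ Ioo 0 b := by
        rw [uIcc_of_le hs.2.le]
        exact fun r hr => ⟨hs.1.trans_le hr.1, hr.2.trans_lt ht.2⟩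
      have h := norm_le_exp_of_norm_deriv_le (s := s) (t := t) hM
        (ε := D.M * C) (by positivity) (fun r hr => H.hasDerivAt_velocity (hsub hr) α)
        (fun r hr => H.abs_acceleration_le (Ioo_subset_Icc_self (hsub hr)) α)
      rw [clamp_of_mem ⟨hs.1.le, hs.2.le.trans ht.2.le⟩]
      refine h.trans ?_
      have hts : |t - s| ≤ b := by
        rw [abs_of_nonneg (by linarith [hs.2])]; linarith [hs.1, ht.2]
      simp only [Real.norm_eq_abs]
      gcongr
    have h2 : Tendsto (fun s => (|v (clamp b s) (χ s α)| + D.M * C * b) * Real.exp (D.M * b))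
        (𝓝[>] 0) (𝓝 ((|D.u₀ α| + D.M * C * b) * Real.exp (D.M * b))) := by
      have h3 := ((((H.continuous_velocity_time α).abs.add_const (D.M * C * b)).mul_const
        (Real.exp (D.M * b))).tendsto 0).mono_left (nhdsWithin_le_nhds (s := Ioi 0))
      rwa [clamp_of_mem ⟨le_rfl, hb⟩, H.zero, H.sol.initial_velocity] at h3
    exact ge_of_tendsto h2 h1
  have hKw : ∀ α, (|D.u₀ α| + D.M * C * b) * Real.exp (D.M * b) ≤ K * D.weight α := by
    intro α
    have h1 := D.one_le_weight α
    have h2 : 0 ≤ D.M * C * b := by positivity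
    have h3 : |D.u₀ α| + D.M * C * b ≤ (1 + D.M * C * b) * D.weight α := by
      have : |D.u₀ α| ≤ D.weight α := by simp [InitialData.weight]
      nlinarith
    rw [hK, mul_right_comm (1 + D.M * C * b)]
    exact mul_le_mul_of_nonneg_right h3 (Real.exp_pos _).le
  refine ⟨K, by positivity, fun t ht α => ?_⟩
  rcases ht.1.eq_or_lt with rfl | h0
  · rw [H.zero, H.sol.initial_velocity]
    refine le_trans ?_ (hKw α)
    have h2 : 0 ≤ D.M * C * b := by positivity
    have h3 := Real.one_le_exp (show 0 ≤ D.M * b by positivity)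
    nlinarith [abs_nonneg (D.u₀ α)]
  · exact (hstep t ⟨h0, ht.2⟩ α).trans (hKw α)

lemma abs_displacement_le {K : ℝ} (hK : ∀ t ∈ Ico 0 b, ∀ α, |v t (χ t α)| ≤ K * D.weight α)
    {s t : ℝ} (hs : s ∈ Ico 0 b) (ht : t ∈ Ico 0 b) (α : ℝ) :
    |χ t α - χ s α| ≤ K * D.weight α * |t - s| :=
  Convex.norm_image_sub_le_of_norm_hasDerivWithin_le (s := Ico 0 b) (f := fun t => χ t α)
    (fun _ hr => (H.hasDerivAt (Ico_subset_Icc_self hr) α).hasDerivWithinAt)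
    (fun _ hr => hK _ hr α) (convex_Ico _ _) hs ht

lemma admissible {t : ℝ} (ht : t ∈ Ico 0 b) : D.Admissible (χ t) := by
  obtain ⟨K, hK0, hK⟩ := H.exists_velocity_bound
  refine .of_abs_sub_le (C := K * |t|) (H.continuous_space (Ico_subset_Icc_self ht)) fun β => ?_
  have := H.abs_displacement_le hK ⟨le_rfl, ht.1.trans_lt ht.2⟩ ht β
  rw [H.zero, sub_zero] at this
  linarith

/-- Characteristics satisfy the first order particle system. -/
lemma velocity_eq {t : ℝ} (ht : t ∈ Ico 0 b) (α : ℝ) :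
    v t (χ t α) = D.u₀ α + D.interaction (χ t) α (χ t α) := by
  obtain ⟨K, hK0, hK⟩ := H.exists_velocity_bound
  have h0 : (0 : ℝ) ∈ Ico 0 b := ⟨le_rfl, ht.1.trans_lt ht.2⟩
  have hsub : Icc 0 t ⊆ Ico 0 b := Icc_subset_Ico_right ht.2
  -- The derivative identity holds only in the open interval; continuity up to the endpoints extends
  -- the conservation law to time `0`.
  have hc : ContinuousOn (fun r => D.interaction (χ r) α (χ r α)) (Icc 0 t) := by
    intro r hr
    rw [ContinuousWithinAt, tendsto_iff_norm_sub_tendsto_zero]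
    refine squeeze_zero' (g := fun s => D.M * (K * D.weight α * |s - r|
      + K * D.totalWeight * |s - r|)) (.of_forall fun _ => norm_nonneg _) ?_ ?_
    · filter_upwards [self_mem_nhdsWithin] with s hs
      refine (InitialData.abs_interaction_sub_le (H.admissible (hsub hs))
        (H.admissible (hsub hr)) α _ _).trans ?_
      refine mul_le_mul_of_nonneg_left (add_le_add
        (H.abs_displacement_le hK (hsub hr) (hsub hs) α) ?_) D.M_nonneg
      have : K * D.totalWeight * |s - r| = ∫ β, K * D.weight β * |s - r| ∂D.μ := by
        rw [integral_mul_const, integral_const_mul, InitialData.totalWeight]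
      rw [this]
      exact integral_mono_of_nonneg (.of_forall fun _ => abs_nonneg _)
        ((D.integrable_weight.const_mul _).mul_const _)
        (.of_forall fun β => H.abs_displacement_le hK (hsub hr) (hsub hs) β)
    · have h1 : Continuous fun s => D.M * (K * D.weight α * |s - r|
        + K * D.totalWeight * |s - r|) := by fun_prop
      have h2 := (h1.tendsto r).mono_left (nhdsWithin_le_nhds (s := Icc 0 t))
      simpa using h2
  have hcv : ContinuousOn (fun r => v r (χ r α)) (Icc 0 t) :=
    (H.continuous_velocity_time α).continuousOn.congr fun r hr => by
      simp only [clamp_of_mem (Ico_subset_Icc_self (hsub hr))]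
  have h1 := eq_of_hasDerivAt_zero ht.1 (hcv.sub hc) fun r hr => by
    have hr' : r ∈ Ioo 0 b := ⟨hr.1, hr.2.trans ht.2⟩
    have e1 := H.hasDerivAt_velocity hr' α
    have e2 := InitialData.hasDerivAt_interaction_time (D := D) (α := α) (s := Ioo 0 b)
      (isOpen_Ioo.mem_nhds hr') (fun s hs => H.admissible (Ioo_subset_Ico_self hs))
      (Z' := fun s β => v s (χ s β))
      (fun s hs β => H.hasDerivAt (Ioo_subset_Icc_self hs) β)
      ((H.sol.contDiff_velocity (H.mem_Ico (Ioo_subset_Icc_self hr'))).continuous.comp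
        (H.continuous_space (Ioo_subset_Icc_self hr')))
      (fun s hs β => hK s (Ioo_subset_Ico_self hs) β)
    exact (e1.sub e2).congr_deriv (sub_self _)
  simp only [Pi.sub_apply, H.zero, H.sol.initial_velocity] at h1
  rw [funext H.zero] at h1
  have h2 : D.interaction (fun α => α) α α = 0 := by simp [InitialData.interaction]
  rw [h2] at h1
  linarith

end Characteristics

end EulerAlignment

/-! ### Identification of classical solutions with the Lagrangian flow. -/

namespace EulerAlignment

namespace Characteristics

variable {D : InitialData} {T b C : ℝ} {σ v χ : ℝ → ℝ → ℝ}
  (H : Characteristics D T b C σ v χ)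

include H

/-- The first order particle system has only one solution: each estimate of the distance between
the characteristics and the flow improves itself by a factor `2`. -/
lemma eq_X {t : ℝ} (ht : t ∈ Ico 0 b) (α : ℝ) : χ t α = D.X t α := by
  obtain ⟨K₁, hK₁0, hK₁⟩ := H.exists_velocity_bound
  obtain ⟨K₂, hK₂0, hK₂⟩ := D.exists_displacement_bound b
  have hM := D.M_nonneg
  have hW := D.totalWeight_nonneg
  have hb := H.mem.1
  have h0 : (0 : ℝ) ∈ Ico 0 b := ⟨le_rfl, ht.1.trans_lt ht.2⟩
  -- `k` exceeds the Lipschitz constant of the system. Integrating `k exp(2 k r)` then produces the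
  -- factor `1 / 2` of each improvement.
  set k := D.M * (1 + D.totalWeight) + 1 with hk
  have hk0 : 0 < k := by positivity
  set θ := K₁ * b + K₂ with hθ
  have hθ0 : 0 ≤ θ := by positivity
  have key : ∀ n : ℕ, ∀ t ∈ Ico 0 b, ∀ α,
      |χ t α - D.X t α| ≤ θ / 2 ^ n * D.weight α * Real.exp (2 * k * t) := by
    intro n
    induction n with
    | zero =>
      intro t ht α
      have h1 := H.abs_displacement_le hK₁ h0 ht α
      have h2 := (hK₂ t (by rw [abs_of_nonneg ht.1]; exact ht.2.le) α).1
      rw [H.zero, sub_zero, abs_of_nonneg ht.1] at h1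
      have h3 : |χ t α - D.X t α| ≤ θ * D.weight α := by
        rw [show χ t α - D.X t α = (χ t α - α) - (D.X t α - α) by ring]
        refine (abs_sub _ _).trans ((add_le_add h1 h2).trans ?_)
        have : K₁ * D.weight α * t ≤ K₁ * D.weight α * b :=
          mul_le_mul_of_nonneg_left ht.2.le (mul_nonneg hK₁0 (D.weight_pos α).le)
        rw [hθ]; linarith
      rw [pow_zero, div_one]
      refine h3.trans (le_mul_of_one_le_right (mul_nonneg hθ0 (D.weight_pos α).le)
        (Real.one_le_exp ?_))
      have := ht.1
      positivity
    | succ n ih =>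
      intro t ht α
      set η := θ / 2 ^ n with hη
      have hη0 : 0 ≤ η := by positivity
      have hw := D.weight_pos α
      have hB : ∀ r, HasDerivAt (fun r => η / 2 * D.weight α * Real.exp (2 * k * r))
          (η * D.weight α * k * Real.exp (2 * k * r)) r := fun r =>
        ((((hasDerivAt_id' r).const_mul (2 * k)).exp).const_mul (η / 2 * D.weight α)).congr_deriv
          (by ring)
      have hd : ∀ r ∈ Icc 0 t, HasDerivAt (fun r => χ r α - D.X r α)
          (v r (χ r α) - D.V r α) r := fun r hr =>
        (H.hasDerivAt ⟨hr.1, hr.2.trans ht.2.le⟩ α).sub (D.hasDerivAt_X r α)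
      have h := image_norm_le_of_norm_deriv_right_le_deriv_boundary (a := 0) (b := t)
        (fun r hr => (hd r hr).continuousAt.continuousWithinAt)
        (fun r hr => (hd r (Ico_subset_Icc_self hr)).hasDerivWithinAt)
        (B := fun r => η / 2 * D.weight α * Real.exp (2 * k * r))
        (by rw [H.zero, D.X_zero, sub_self, norm_zero]; positivity) hB (fun r hr => by
          have hr' : r ∈ Ico 0 b := ⟨hr.1, hr.2.trans ht.2⟩
          rw [H.velocity_eq hr', D.V_eq, add_sub_add_left_eq_sub]
          refine (InitialData.abs_interaction_sub_le (H.admissible hr') (D.admissible_X r)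
            α _ _).trans ?_
          set E := Real.exp (2 * k * r)
          have hE : 0 < E := Real.exp_pos _
          have h1 : ∫ β, |χ r β - D.X r β| ∂D.μ ≤ η * D.totalWeight * E := by
            have : η * D.totalWeight * E = ∫ β, η * D.weight β * E ∂D.μ := by
              rw [integral_mul_const, integral_const_mul, InitialData.totalWeight]
            rw [this]
            exact integral_mono_of_nonneg (.of_forall fun _ => abs_nonneg _)
              ((D.integrable_weight.const_mul _).mul_const _) (.of_forall fun β => ih r hr' β)
          have h2 : η * D.totalWeight * E ≤ η * (D.weight α * D.totalWeight) * E := by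
            gcongr
            exact le_mul_of_one_le_left hW (D.one_le_weight α)
          calc D.M * (|χ r α - D.X r α| + ∫ β, |χ r β - D.X r β| ∂D.μ)
              ≤ D.M * (η * D.weight α * E + η * (D.weight α * D.totalWeight) * E) :=
                mul_le_mul_of_nonneg_left (add_le_add (ih r hr' α) (h1.trans h2)) hM
            _ = η * D.weight α * (D.M * (1 + D.totalWeight)) * E := by ring
            _ ≤ η * D.weight α * k * E := by gcongr; linarith)
        (⟨ht.1, le_rfl⟩ : t ∈ Icc 0 t)
      rw [pow_succ, ← div_div]
      exact h
  have hlim : Tendsto (fun n : ℕ => θ / 2 ^ n * D.weight α * Real.exp (2 * k * t)) atTop (𝓝 0) := by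
    have h1 : Tendsto (fun n : ℕ => θ * (1 / 2 : ℝ) ^ n * D.weight α * Real.exp (2 * k * t))
        atTop (𝓝 (θ * 0 * D.weight α * Real.exp (2 * k * t))) :=
      (((tendsto_pow_atTop_nhds_zero_of_lt_one (by norm_num) (by norm_num)).const_mul θ).mul_const
        _).mul_const _
    simpa [div_eq_mul_inv] using h1
  have h2 := ge_of_tendsto' hlim fun n => key n t ht α
  exact sub_eq_zero.1 (abs_nonpos_iff.1 h2)

/-- The characteristics, now known to be `X`, expand by a uniform factor, and this passes to the
label derivative. Existence of a classical solution thus forces regularity of the flow. -/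
lemma exp_le_Y {t : ℝ} (ht : t ∈ Ico 0 b) (α : ℝ) : Real.exp (-(C * b)) ≤ D.Y t α := by
  have hmono : Monotone fun α => D.X t α - Real.exp (-(C * b)) * α := by
    intro x y hxy
    have := H.mul_sub_le (Ico_subset_Icc_self ht) x y hxy
    rw [H.eq_X ht, H.eq_X ht] at this
    simp only
    linarith
  have h1 := (D.hasDerivAt_X_space t α).sub
    ((hasDerivAt_id' α).const_mul (Real.exp (-(C * b))))
  have h2 : 0 ≤ deriv (fun α => D.X t α - Real.exp (-(C * b)) * α) α := hmono.deriv_nonneg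
  have h3 : deriv (fun α => D.X t α - Real.exp (-(C * b)) * α) α = _ := h1.deriv
  rw [h3] at h2
  linarith

lemma velocity_eq_u {p q c : ℝ} (h : D.Regular p q c) {t : ℝ} (ht : t ∈ Ico 0 b)
    (ht' : t ∈ Icc p q) : v t = D.u t := by
  funext x
  obtain ⟨α, rfl⟩ := h.surjective ht' x
  have h1 := H.velocity_eq ht α
  rw [funext (H.eq_X ht)] at h1
  rw [h1, h.u_X ht', D.V_eq]

/-- Differentiating the mass identity in the label gives `σ(X) Y = ρ₀`. -/
lemma density_eq_ρ {p q c : ℝ} (h : D.Regular p q c) {t : ℝ} (ht : t ∈ Ico 0 b)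
    (ht' : t ∈ Icc p q) : σ t = D.ρ t := by
  funext x
  obtain ⟨α, rfl⟩ := h.surjective ht' x
  have hσ := (H.sol.contDiff_density (H.mem_Ico (Ico_subset_Icc_self ht))).continuous
  have hρ := D.contDiff_ρ₀.continuous
  have h1 : HasDerivAt (fun β => ∫ y in D.X t 0..D.X t β, σ t y) (σ t (D.X t α) * D.Y t α) α :=
    HasDerivAt.comp (h₂ := fun z => ∫ y in D.X t 0..z, σ t y) α
      (intervalIntegral.integral_hasDerivAt_right (hσ.intervalIntegrable _ _)
        (hσ.stronglyMeasurableAtFilter _ _) hσ.continuousAt) (D.hasDerivAt_X_space t α)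
  have h2 : HasDerivAt (fun β => ∫ y in (0 : ℝ)..β, D.ρ₀ y) (D.ρ₀ α) α :=
    intervalIntegral.integral_hasDerivAt_right (hρ.intervalIntegrable _ _)
      (hρ.stronglyMeasurableAtFilter _ _) hρ.continuousAt
  have h3 : (fun β => ∫ y in D.X t 0..D.X t β, σ t y) = fun β => ∫ y in (0 : ℝ)..β, D.ρ₀ y := by
    funext β
    rw [← H.eq_X ht, ← H.eq_X ht, H.integral_density_eq (Ico_subset_Icc_self ht)]
  rw [h3] at h1
  rw [h.ρ_X ht', eq_div_iff (h.Y_pos ht' α).ne', h1.unique h2]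

end Characteristics

/-! ### Regular times, lifespan and blow-up. -/

namespace InitialData

variable (D : InitialData)

lemma half_le_Y_of_abs_sub_le {s t T c : ℝ} (hs : |s| ≤ T) (ht : |t| ≤ T)
    (hst : |t - s| * (2 * (D.rateBound T + 1)) ≤ c) {α : ℝ} (hY : c ≤ D.Y s α) :
    c / 2 ≤ D.Y t α := by
  have h1 := (abs_le.1 (D.abs_Y_sub_le hs ht α)).1
  have h2 : 0 ≤ |t - s| := abs_nonneg _
  nlinarith

/-- Regularity up to time `t` persists beyond `t`. -/
lemma exists_regular {t c : ℝ} (ht : 0 ≤ t) (hc : 0 < c)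
    (hY : ∀ s ∈ Icc 0 t, ∀ α, c ≤ D.Y s α) : ∃ p q c', D.Regular p q c' ∧ t < q := by
  have hR := D.rateBound_nonneg (T := t + 1) (by linarith)
  -- Within time `η` the Jacobian changes by at most `c / 2`, and the interval stays inside `[-(t +
  -- 1), t + 1]`, where the rate bound applies.
  set η := min 1 (c / (2 * (D.rateBound (t + 1) + 1))) with hη
  have hη0 : 0 < η := by positivity
  have hη1 : η ≤ 1 := min_le_left _ _
  have hηc : η * (2 * (D.rateBound (t + 1) + 1)) ≤ c :=
    (le_div_iff₀ (by positivity)).1 (min_le_right _ _)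
  refine ⟨-η, t + η, c / 2, ⟨by linarith, by linarith, by linarith, fun s hs α => ?_⟩,
    by linarith⟩
  have hcl := clamp_mem ht s
  have hdist : |s - clamp t s| ≤ η := by
    rw [abs_le, clamp]
    rcases le_total t s with h1 | h1
    · rw [min_eq_left h1, max_eq_right ht]
      constructor <;> linarith [hs.2]
    · rw [min_eq_right h1]
      rcases le_total 0 s with h2 | h2
      · rw [max_eq_right h2]; constructor <;> linarith
      · rw [max_eq_left h2]; constructor <;> linarith [hs.1]
  refine D.half_le_Y_of_abs_sub_le (T := t + 1) (abs_le.2 ⟨by linarith [hcl.1], by linarith [hcl.2]⟩)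
    (abs_le.2 ⟨by linarith [hs.1], by linarith [hs.2]⟩) ?_ (hY _ hcl α)
  exact (mul_le_mul_of_nonneg_right hdist (by positivity)).trans hηc

lemma exp_le_Y_of_nonneg (he : ∀ α, 0 ≤ D.e₀ α) {t : ℝ} (ht : 0 ≤ t) (α : ℝ) :
    Real.exp (-(D.M * t)) ≤ D.Y t α := by
  have h1 : Real.exp (-(D.M * t)) ≤ Real.exp (-D.A t α) :=
    Real.exp_le_exp.2 (neg_le_neg (D.A_le ht α))
  have h2 : 0 ≤ D.e₀ α * D.growth t α := mul_nonneg (he α) (ht.trans (D.le_growth ht α))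
  calc Real.exp (-(D.M * t)) ≤ Real.exp (-D.A t α) * 1 := by rw [mul_one]; exact h1
    _ ≤ D.Y t α := mul_le_mul_of_nonneg_left (by linarith) (Real.exp_pos _).le

/-- The times up to which the flow map stays uniformly expanding. -/
def regularTimes : Set ℝ := {t | 0 ≤ t ∧ ∃ c > 0, ∀ s ∈ Icc 0 t, ∀ α, c ≤ D.Y s α}

lemma zero_mem_regularTimes : (0 : ℝ) ∈ D.regularTimes := by
  refine ⟨le_rfl, 1, one_pos, fun s hs α => ?_⟩
  rw [le_antisymm hs.2 hs.1, D.Y_zero]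

lemma exists_gt_mem_regularTimes {t : ℝ} (ht : t ∈ D.regularTimes) :
    ∃ s ∈ D.regularTimes, t < s := by
  obtain ⟨ht0, c, hc, hY⟩ := ht
  obtain ⟨p, q, c', h, htq⟩ := D.exists_regular ht0 hc hY
  exact ⟨q, ⟨h.pos.le, c', h.c_pos, fun s hs α => h.le_Y s ⟨h.neg.le.trans hs.1, hs.2⟩ α⟩, htq⟩

/-- As `a ≥ 0`, the growth factor is at least `t`, so positivity of `Y` requires `1 + e₀ t > 0`. -/
lemma lt_of_mem_regularTimes {α : ℝ} (hα : D.e₀ α < 0) {t : ℝ} (ht : t ∈ D.regularTimes) :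
    t < -(D.e₀ α)⁻¹ := by
  obtain ⟨ht0, c, hc, hY⟩ := ht
  have h1 : 0 < D.Y t α := hc.trans_le (hY t ⟨ht0, le_rfl⟩ α)
  have h2 : 0 < 1 + D.e₀ α * D.growth t α :=
    (mul_pos_iff_of_pos_left (Real.exp_pos _)).1 h1
  have h3 := D.le_growth ht0 α
  have h4 : t * -D.e₀ α < 1 := by nlinarith
  rw [← inv_neg, ← one_div]
  exact (lt_div_iff₀ (by linarith)).2 h4

/-- The life span of the classical solution. -/
noncomputable def lifespan : ℝ := sSup D.regularTimes

section Supercritical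

variable {D} {α₀ : ℝ} (hα₀ : D.e₀ α₀ < 0)

include hα₀

lemma bddAbove_regularTimes : BddAbove D.regularTimes :=
  ⟨_, fun _ ht => (D.lt_of_mem_regularTimes hα₀ ht).le⟩

lemma lifespan_pos : 0 < D.lifespan := by
  obtain ⟨s, hs, h0⟩ := D.exists_gt_mem_regularTimes D.zero_mem_regularTimes
  exact h0.trans_le (le_csSup (bddAbove_regularTimes hα₀) hs)

/-- Regularity always persists a little longer, so the supremum is not attained. -/
lemma lifespan_notMem : D.lifespan ∉ D.regularTimes := fun h => by
  obtain ⟨s, hs, h0⟩ := D.exists_gt_mem_regularTimes h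
  exact absurd (le_csSup (bddAbove_regularTimes hα₀) hs) (not_le.2 h0)

omit hα₀ in
lemma mem_regularTimes_of_lt {t : ℝ} (ht : t ∈ Ico 0 D.lifespan) : t ∈ D.regularTimes := by
  obtain ⟨s, ⟨-, c, hc, hY⟩, hts⟩ := exists_lt_of_lt_csSup ⟨0, D.zero_mem_regularTimes⟩ ht.2
  exact ⟨ht.1, c, hc, fun r hr => hY r ⟨hr.1, hr.2.trans hts.le⟩⟩

/-- A positive lower bound at the final time alone would extend backwards by Lipschitz continuity in
time and join the bound on earlier times, making the lifespan a regular time. The infimum over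
labels need not be attained, hence one label for each `c`. -/
lemma exists_Y_lifespan_lt {c : ℝ} (hc : 0 < c) : ∃ α, D.Y D.lifespan α < c := by
  by_contra! hY
  have hT := lifespan_pos hα₀
  set T := D.lifespan with hTdef
  have hR := D.rateBound_nonneg (T := T) hT.le
  set η := min T (c / (2 * (D.rateBound T + 1))) with hη
  have hη0 : 0 < η := by positivity
  have hηT : η ≤ T := min_le_left _ _
  have hηc : η * (2 * (D.rateBound T + 1)) ≤ c :=
    (le_div_iff₀ (by positivity)).1 (min_le_right _ _)
  obtain ⟨-, c', hc', hY'⟩ := mem_regularTimes_of_lt (D := D) (t := T - η)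
    ⟨by linarith, by rw [← hTdef]; linarith⟩
  refine lifespan_notMem hα₀ ⟨hT.le, min (c / 2) c', by positivity, fun s hs α => ?_⟩
  rcases le_total s (T - η) with h1 | h1
  · exact (min_le_right _ _).trans (hY' s ⟨hs.1, h1⟩ α)
  · refine (min_le_left _ _).trans (D.half_le_Y_of_abs_sub_le (T := T) (s := T)
      (by rw [abs_of_pos hT]) (by rw [abs_of_nonneg hs.1]; exact hs.2) ?_ (hY α))
    refine (mul_le_mul_of_nonneg_right ?_ (by positivity)).trans hηc
    rw [abs_le]; constructor <;> linarith [hs.2]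

/-- The slope of the velocity tends to `-∞` at the end of the life span. -/
lemma eventually_exists_deriv_u_lt (K : ℝ) :
    ∀ᶠ t in 𝓝[<] D.lifespan, ∃ x, deriv (D.u t) x < -K := by
  have hT := lifespan_pos hα₀
  set T := D.lifespan with hTdef
  have hM := D.M_nonneg
  set E := Real.exp (D.M * T) with hE
  have hE0 : 0 < E := Real.exp_pos _
  -- The threshold `1 / (2 E)` makes `1 + e₀ * growth < 1 / 2`; since `growth ≤ E T`, this gives `e₀
  -- < -k`. The threshold `k / (|K| + 1)` then gives `e₀ / Y < -(|K| + 1)`.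
  set k := 1 / (2 * (E * T)) with hk
  have hk0 : 0 < k := by positivity
  set c := min (1 / (2 * E)) (k / (|K| + 1)) with hc
  have hc0 : 0 < c := by positivity
  obtain ⟨α, hα⟩ := exists_Y_lifespan_lt hα₀ hc0
  -- The label is now fixed, so continuity in time suffices.
  have hev : ∀ᶠ t in 𝓝[<] T, D.Y t α < c :=
    ((D.hasDerivAt_Y T α).continuousAt.eventually_lt continuousAt_const hα).filter_mono
      nhdsWithin_le_nhds
  filter_upwards [hev, Ioo_mem_nhdsLT hT] with t hYc ht
  obtain ⟨-, c', hc', hY'⟩ := mem_regularTimes_of_lt (D := D) ⟨ht.1.le, ht.2⟩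
  obtain ⟨p, q, c'', h, htq⟩ := D.exists_regular ht.1.le hc' hY'
  have htI : t ∈ Ioo p q := ⟨h.neg.trans ht.1, htq⟩
  refine ⟨D.X t α, ?_⟩
  rw [h.deriv_u htI, h.label_X (Ioo_subset_Icc_self htI)]
  have hYpos := h.Y_pos (Ioo_subset_Icc_self htI) α
  have ha := D.a_nonneg t α
  have hA : D.A t α ≤ D.M * T :=
    (D.A_le ht.1.le α).trans (mul_le_mul_of_nonneg_left ht.2.le hM)
  have hI : D.growth t α ≤ E * T := (D.growth_le ht.1.le α).trans (by
    rw [hE]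
    gcongr
    · exact ht.1.le
    · exact ht.2.le
    · exact ht.2.le)
  have hI0 : 0 < D.growth t α := ht.1.trans_le (D.le_growth ht.1.le α)
  have h1 : 1 + D.e₀ α * D.growth t α < 1 / 2 := by
    have h2 : 1 + D.e₀ α * D.growth t α = Real.exp (D.A t α) * D.Y t α := by
      rw [Y, ← mul_assoc, ← Real.exp_add]; simp
    have h3 : Real.exp (D.A t α) ≤ E := Real.exp_le_exp.2 hA
    have h4 : D.Y t α < 1 / (2 * E) := hYc.trans_le (min_le_left _ _)
    rw [h2]
    calc Real.exp (D.A t α) * D.Y t α ≤ E * D.Y t α := by gcongr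
      _ < E * (1 / (2 * E)) := by gcongr
      _ = 1 / 2 := by field_simp
  have he : D.e₀ α < -k := by
    have h2 : D.e₀ α * D.growth t α < -(1 / 2) := by linarith
    have h3 : k * D.growth t α ≤ 1 / 2 := by
      calc k * D.growth t α ≤ k * (E * T) := by gcongr
        _ = 1 / 2 := by rw [hk]; field_simp
    by_contra! h4
    nlinarith
  have h5 : D.Y t α * (|K| + 1) < k := by
    have := hYc.trans_le (min_le_right (1 / (2 * E)) (k / (|K| + 1)))
    rwa [lt_div_iff₀ (by positivity)] at this
  have h6 : D.e₀ α / D.Y t α < -(|K| + 1) := by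
    rw [div_lt_iff₀ hYpos]; linarith
  linarith [le_abs_self K]

end Supercritical

lemma exists_regular_of_mem {t : ℝ} (ht : t ∈ D.regularTimes) :
    ∃ p q c, D.Regular p q c ∧ t < q := by
  obtain ⟨ht0, c, hc, hY⟩ := ht
  exact D.exists_regular ht0 hc hY

variable {D} in
lemma _root_.EulerAlignment.IsClassicalSolution.mem_regularTimes {T : ℝ} {σ v : ℝ → ℝ → ℝ}
    (hs : IsClassicalSolution D.ψ D.ρ₀ D.u₀ (Ico 0 T) σ v) {t : ℝ} (ht : t ∈ Ico 0 T) :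
    t ∈ D.regularTimes := by
  obtain ⟨b, htb, hbT⟩ := exists_between ht.2
  obtain ⟨C, χ, H⟩ := hs.exists_characteristics ⟨ht.1.trans htb.le, hbT⟩
  exact ⟨ht.1, _, Real.exp_pos _, fun s hs α => H.exp_le_Y ⟨hs.1, hs.2.trans_lt htb⟩ α⟩

variable {D} in
/-- Classical solutions agree with the Lagrangian solution. -/
lemma _root_.EulerAlignment.IsClassicalSolution.eq {T : ℝ} {σ v : ℝ → ℝ → ℝ}
    (hs : IsClassicalSolution D.ψ D.ρ₀ D.u₀ (Ico 0 T) σ v) {t : ℝ} (ht : t ∈ Ico 0 T) :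
    σ t = D.ρ t ∧ v t = D.u t := by
  obtain ⟨b, htb, hbT⟩ := exists_between ht.2
  obtain ⟨C, χ, H⟩ := hs.exists_characteristics ⟨ht.1.trans htb.le, hbT⟩
  obtain ⟨p, q, c, h, htq⟩ := D.exists_regular_of_mem (hs.mem_regularTimes ht)
  have ht' : t ∈ Icc p q := ⟨h.neg.le.trans ht.1, htq.le⟩
  exact ⟨H.density_eq_ρ h ⟨ht.1, htb⟩ ht', H.velocity_eq_u h ⟨ht.1, htb⟩ ht'⟩

lemma convolution_eq_strength (x : ℝ) :
    (D.ψ ⋆[ContinuousLinearMap.mul ℝ ℝ, volume] D.ρ₀) x = D.strength (fun β => β) x := by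
  rw [strength, integral_μ, convolution_def,
    ← integral_sub_left_eq_self (fun y => D.ψ (x - y) * D.ρ₀ y) volume x]
  simp

end InitialData

end EulerAlignment

/-! ### Assembly of the two regimes. -/

theorem theorem1p1
    -- the influence function: bounded and Lipschitz (that is, `W^{1,∞}`), nonnegative, symmetric
    (ψ : ℝ → ℝ) (hψ_lip : ∃ L : NNReal, LipschitzWith L ψ) (hψ_bdd : ∃ M : ℝ, ∀ x, ψ x ≤ M)
    (hψ_nonneg : ∀ x, 0 ≤ ψ x) (hψ_symm : ∀ x, ψ (-x) = ψ x)
    -- the initial density: a bounded `C¹` probability density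
    (ρ₀ : ℝ → ℝ) (hρ₀ : ContDiff ℝ 1 ρ₀) (hρ₀_nonneg : ∀ x, 0 ≤ ρ₀ x)
    (hρ₀_int : Integrable ρ₀) (hρ₀_mass : ∫ x, ρ₀ x = 1) (hρ₀_bdd : ∃ C : ℝ, ∀ x, ρ₀ x ≤ C)
    -- the initial velocity: `C²`, bounded derivative, integrable against the initial density
    (u₀ : ℝ → ℝ) (hu₀ : ContDiff ℝ 2 u₀) (hu₀_bdd : ∃ C : ℝ, ∀ x, |deriv u₀ x| ≤ C)
    (hu₀_int : Integrable (fun x => u₀ x * ρ₀ x)) :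
    -- subcritical region
    ((∀ x, deriv u₀ x ≥ -(ψ ⋆[ContinuousLinearMap.mul ℝ ℝ, volume] ρ₀) x) →
      ∃ ρ u : ℝ → ℝ → ℝ,
        EulerAlignment.IsClassicalSolution ψ ρ₀ u₀ (Ici 0) ρ u ∧
        (UniformContinuous ρ₀ → UniformContinuous (deriv u₀) → (∃ C : ℝ, ∀ x, |u₀ x| ≤ C) →
          EulerAlignment.ContinuousInNorm (Ici 0) ρ u)) ∧
    -- supercritical region
    ((∃ x, deriv u₀ x < -(ψ ⋆[ContinuousLinearMap.mul ℝ ℝ, volume] ρ₀) x) →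
      ∃ T : ℝ, 0 < T ∧ ∃ ρ u : ℝ → ℝ → ℝ,
        EulerAlignment.IsClassicalSolution ψ ρ₀ u₀ (Ico 0 T) ρ u ∧
        (UniformContinuous ρ₀ → UniformContinuous (deriv u₀) → (∃ C : ℝ, ∀ x, |u₀ x| ≤ C) →
          EulerAlignment.ContinuousInNorm (Ico 0 T) ρ u) ∧
        -- `(ρ, u)` is the solution: unique, and not continuable beyond `T`
        (∀ (T' : ℝ) (ρ' u' : ℝ → ℝ → ℝ), EulerAlignment.IsClassicalSolution ψ ρ₀ u₀ (Ico 0 T') ρ' u' →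
          T' ≤ T ∧ ∀ t ∈ Ico 0 T', ρ' t = ρ t ∧ u' t = u t) ∧
        -- `inf ∂ₓu(t) → -∞`, hence `‖∂ₓu(t)‖_{L^∞} → ∞`, as `t ↑ T`
        (∀ K : ℝ, ∀ᶠ t in 𝓝[<] T, ∃ x, deriv (u t) x < -K)) := by
  obtain ⟨L, hL⟩ := hψ_lip
  obtain ⟨M, hM⟩ := hψ_bdd
  obtain ⟨C₀, hC₀⟩ := hρ₀_bdd
  obtain ⟨B, hB⟩ := hu₀_bdd
  let D : EulerAlignment.InitialData := ⟨ψ, L, M, ρ₀, u₀, B, hL, hψ_nonneg, hM, hρ₀, hρ₀_nonneg,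
    hρ₀_int, hρ₀_mass, hu₀, hB, hu₀_int⟩
  have he : ∀ x, D.e₀ x = deriv u₀ x + (ψ ⋆[ContinuousLinearMap.mul ℝ ℝ, volume] ρ₀) x :=
    fun x => congrArg (deriv u₀ x + ·) (D.convolution_eq_strength x).symm
  constructor
  · intro hsub
    have he0 : ∀ x, 0 ≤ D.e₀ x := fun x => by rw [he]; linarith [hsub x]
    have hreg : ∀ t ∈ Ici (0 : ℝ), ∃ p q c, D.Regular p q c ∧ t < q := fun t ht =>
      D.exists_regular ht (Real.exp_pos (-(D.M * t))) fun s hs α =>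
        (Real.exp_le_exp.2 (neg_le_neg (mul_le_mul_of_nonneg_left hs.2 D.M_nonneg))).trans
          (D.exp_le_Y_of_nonneg he0 hs.1 α)
    exact ⟨D.ρ, D.u, D.isClassicalSolution subset_rfl (uniqueDiffOn_Ici 0) hreg hC₀,
      fun hρ hu ⟨U, hU⟩ => D.continuousInNorm subset_rfl hreg hC₀ hρ hu hU⟩
  · rintro ⟨x₀, hx₀⟩
    have he0 : D.e₀ x₀ < 0 := by rw [he]; linarith
    have hreg : ∀ t ∈ Ico 0 D.lifespan, ∃ p q c, D.Regular p q c ∧ t < q := fun t ht =>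
      D.exists_regular_of_mem (EulerAlignment.InitialData.mem_regularTimes_of_lt ht)
    refine ⟨D.lifespan, EulerAlignment.InitialData.lifespan_pos he0, D.ρ, D.u,
      D.isClassicalSolution Ico_subset_Ici_self (uniqueDiffOn_Ico 0 _) hreg hC₀,
      fun hρ hu ⟨U, hU⟩ => D.continuousInNorm Ico_subset_Ici_self hreg hC₀ hρ hu hU,
      fun T' σ v hs => ⟨?_, fun t ht => hs.eq (D := D) ht⟩,
      EulerAlignment.InitialData.eventually_exists_deriv_u_lt he0⟩
    -- A solution living beyond the lifespan would make the lifespan itself a regular time.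
    by_contra! hlt
    exact EulerAlignment.InitialData.lifespan_notMem he0 (hs.mem_regularTimes (D := D)
      ⟨(EulerAlignment.InitialData.lifespan_pos he0).le, hlt⟩)
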